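/- Let $\mathbb T=\mathbb R^d/\ell\mathbb Z^d$ ($\ell>0$) be a torus, and let fields $\psi_a(x),\bar\psi_a(x)$ carry a component index $a\in\{1,\dots,r\}$; below, the index is suppressed, so that $x$ stands for $(a,x)$, $\int dx$ for $\sum_a\int_{\mathbb T}dx$, and $L^2(\mathbb T)$ for $L^2(\mathbb T;\mathbb C^r)$. Fix an integer $k\ge 0$ and $h>0$. Let $\mathcal C_k(\mathbb T^N)$ be the Banach space of functions of $N$ variables with continuous derivatives $\partial^\alpha f$ for all multi-indices with $|\alpha|:=\sup_i\sum_\mu\alpha_{i,\mu}\le k$, with norm $\sup_{|\alpha|\le k}\|\partial^\alpha f\|_\infty$, and let $\mathcal C_k'(\mathbb T^N)$ be its dual. Let $\mathcal G_h$ be the Banach algebra of formal expressions $$F=\sum_{n,m\ge 0}\frac1{n!\,m!}\int F_{nm}(x_1,\dots,x_n,y_1,\dots,y_m)\,\psi(x_1)\cdots\psi(x_n)\bar\psi(y_1)\cdots\bar\psi(y_m)\,dx\,dy ,$$ with $F_{nm}\in\mathcal C_k'(\mathbb T^{n+m})$ anti-symmetric in the $x_i$ and in the $y_j$ separately, and $$\|F\|_h=\sum_{n,m}\frac{h^{n+m}}{n!\,m!}\|F_{nm}\|_{\mathcal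 C_k'}<\infty ;$$ the product is the Grassmann product (all fields anti-commute), i.e. tensor product of kernels followed by anti-symmetrization. An integral on $\mathcal G_h$ is a continuous linear functional. For a smooth function $G$ on $\mathbb T\times\mathbb T$, an integral $F\mapsto\int F\,d\mu_G$ on $\mathcal G_h$ is the Gaussian integral with covariance $G$ if $$\int\psi(x_1)\cdots\psi(x_n)\bar\psi(y_1)\cdots\bar\psi(y_m)\,d\mu_G=\epsilon_n\,\delta_{nm}\det\{G(x_i,y_j)\},\qquad \epsilon_n=(-1)^{n(n-1)/2},$$ in the sense that $\int F\,d\mu_G=\sum_n\frac{\epsilon_n}{(n!)^2}\langle F_{nn},\det\{G(x_i,y_j)\}\rangle$ for all $F\in\mathcal G_h$. For a smooth function $K$ on $\mathbb T\times\mathbb T$ put $\langle\bar\psi,K\psi\rangle=\int\bar\psi(x)K(x,y)\psi(y)\,dx\,dy\in\mathcal G_h$, and also write $K$ for the bounded operator $(Kf)(x)=\int K(x,y)f(y)\,dy$ on $L^2(\mathbb T)$. Let $G$ be a smooth function on $\mathbb T\times\mathbb T$ of the form $G(x,y)=\int G_1(x,z)G_2(z,y)\,dz$, where $x\mapsto G_1(x,\cdot)$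 and $y\mapsto G_2(\cdot,y)$ are $k$ times continuously differentiable with values in $L^2(\mathbb T)$, and suppose $$h(G):=\max\Big\{\sup_{|\alpha|\le k,\,x}\|\partial_x^\alpha G_1(x,\cdot)\|_{2},\ \sup_{|\alpha|\le k,\,y}\|\partial_y^\alpha G_2(\cdot,y)\|_{2}\Big\}\le h .$$ Let $K$ be a smooth function on $\mathbb T\times\mathbb T$ such that $\|KG\|<1$ (operator norm on $L^2(\mathbb T)$). Then the Gaussian integral $\int\cdot\,d\mu_G$ with covariance $G$ exists on $\mathcal G_h$ and is unique; $I-KG$ is invertible; the exponential series $e^{\langle\bar\psi,K\psi\rangle}=\sum_p\langle\bar\psi,K\psi\rangle^p/p!$ converges in $\mathcal G_h$; $\int e^{\langle\bar\psi,K\psi\rangle}d\mu_G\ne 0$; the operator $G(I-KG)^{-1}$ has a smooth kernel; and $$F\longmapsto\int F\,d\mu_{G,K}:=\frac{\int F\,e^{\langle\bar\psi,K\psi\rangle}\,d\mu_G}{\int e^{\langle\bar\psi,K\psi\rangle}\,d\mu_G}$$ is the Gaussian integral on $\mathcal G_h$ with covariance $G(I-KG)^{-1}$. -/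

import Mathlib

noncomputable section

open MeasureTheory Filter Topology
open scoped ContDiff Nat

namespace GrassmannField

/-- The torus `ℝ^d / ℓ ℤ^d`. -/
abbrev Torus (d : ℕ) (ℓ : ℝ) : Type := Fin d → AddCircle ℓ

/-- The argument of a field: a component index (spinor and internal indices together,
`r` of them) and a point of the torus. -/
abbrev Pt (d r : ℕ) (ℓ : ℝ) : Type := Fin r × Torus d ℓ

/-- Integration over `Pt`: sum over the component index, Lebesgue integral over the torus. -/
abbrev ptMeasure (d r : ℕ) (ℓ : ℝ) [Fact (0 < ℓ)] : Measure (Pt d r ℓ) :=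
  (Measure.count : Measure (Fin r)).prod volume

/-- The Hilbert space `L²(𝕋; ℂ^r)`. -/
abbrev L2 (d r : ℕ) (ℓ : ℝ) [Fact (0 < ℓ)] : Type := Lp ℂ 2 (ptMeasure d r ℓ)

/-- Multi-indices `β ∈ ℕ^d` of order `∑ β_μ ≤ k`. -/
abbrev MultiIdx (d k : ℕ) : Type := {β : Fin d → Fin (k + 1) // ∑ μ, (β μ : ℕ) ≤ k}

instance (d k : ℕ) : Zero (MultiIdx d k) := ⟨⟨fun _ => 0, by simp⟩⟩

/-- `α' = α + e_{v,μ}`, for multi-indices in the variables `x_v`, `v ∈ V`. -/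
def IsIncr {d k : ℕ} {V : Type} [DecidableEq V] (v : V) (μ : Fin d)
    (α α' : V → MultiIdx d k) : Prop :=
  ∀ w ν, ((α' w).1 ν : ℕ) = ((α w).1 ν : ℕ) + if w = v ∧ ν = μ then 1 else 0

/-- Translation of the variable `x_v` by `t` in the direction `μ`. -/
def shift {d r : ℕ} {ℓ : ℝ} {V : Type} [DecidableEq V] (v : V) (μ : Fin d) (t : ℝ)
    (x : V → Pt d r ℓ) : V → Pt d r ℓ :=
  Function.update x v ((x v).1, (x v).2 + Pi.single μ (t : AddCircle ℓ))

/-- The Banach space `𝒞_k(𝕋^V; E)` of functions of the variables `x_v`, `v ∈ V`, that are `k` times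
continuously differentiable in each variable. A function `f` is stored together with its
derivatives: `D α = ∂^α f` for all `α` with `sup_v ∑_μ α_{v,μ} ≤ k`, all of them continuous, so that
`f = D 0`, and `D` is determined by `f`. The norm inherited from the (finite) product of
spaces of continuous functions is `sup_α ‖∂^α f‖_∞`. -/
def ckSubmodule (d r k : ℕ) (ℓ : ℝ) [Fact (0 < ℓ)] (V : Type) [Fintype V] [DecidableEq V]
    (E : Type) [NormedAddCommGroup E] [NormedSpace ℂ E] :
    Submodule ℂ ((V → MultiIdx d k) → C(V → Pt d r ℓ, E)) where
  carrier := {D | ∀ (v : V) (μ : Fin d) (α α' : V → MultiIdx d k), IsIncr v μ α α' →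
    ∀ x, HasDerivAt (fun t : ℝ => D α (shift v μ t x)) (D α' x) 0}
  add_mem' := fun ha hb v μ α α' h x => (ha v μ α α' h x).add (hb v μ α α' h x)
  zero_mem' := fun _ _ _ _ _ _ => hasDerivAt_const _ _
  smul_mem' := fun c _ ha v μ α α' h x => (ha v μ α α' h x).const_smul c

/-- The space `𝒞_k(𝕋^V; E)` as a type, with its norm. -/
def Ck (d r k : ℕ) (ℓ : ℝ) [Fact (0 < ℓ)] (V : Type) [Fintype V] [DecidableEq V]
    (E : Type) [NormedAddCommGroup E] [NormedSpace ℂ E] : Type :=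
  ckSubmodule d r k ℓ V E

instance (d r k : ℕ) (ℓ : ℝ) [Fact (0 < ℓ)] (V : Type) [Fintype V] [DecidableEq V]
    (E : Type) [NormedAddCommGroup E] [NormedSpace ℂ E] : NormedAddCommGroup (Ck d r k ℓ V E) :=
  inferInstanceAs (NormedAddCommGroup (ckSubmodule d r k ℓ V E))

instance (d r k : ℕ) (ℓ : ℝ) [Fact (0 < ℓ)] (V : Type) [Fintype V] [DecidableEq V]
    (E : Type) [NormedAddCommGroup E] [NormedSpace ℂ E] : NormedSpace ℂ (Ck d r k ℓ V E) :=
  inferInstanceAs (NormedSpace ℂ (ckSubmodule d r k ℓ V E))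

section Ck

set_option linter.unusedSectionVars false

variable {d r k : ℕ} {ℓ : ℝ} [Fact (0 < ℓ)]
variable {V W : Type} [Fintype V] [DecidableEq V] [Fintype W] [DecidableEq W]
variable {E E' : Type} [NormedAddCommGroup E] [NormedSpace ℂ E]
  [NormedAddCommGroup E'] [NormedSpace ℂ E']

theorem Ck.ext' {f g : Ck d r k ℓ V E} (h : ∀ α x, f.1 α x = g.1 α x) : f = g :=
  Subtype.ext (funext fun α => ContinuousMap.ext fun x => h α x)

/-- The value `f(x)`. -/
def Ck.eval (f : Ck d r k ℓ V E) (x : V → Pt d r ℓ) : E := f.1 (fun _ => 0) x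

theorem Ck.norm_apply_le (f : Ck d r k ℓ V E) (α : V → MultiIdx d k) (x : V → Pt d r ℓ) :
    ‖f.1 α x‖ ≤ ‖f‖ :=
  (ContinuousMap.norm_coe_le_norm (f.1 α) x).trans (norm_le_pi_norm f.1 α)

theorem Ck.norm_le {f : Ck d r k ℓ V E} {C : ℝ} (hC : 0 ≤ C) (h : ∀ α x, ‖f.1 α x‖ ≤ C) :
    ‖f‖ ≤ C :=
  (pi_norm_le_iff_of_nonneg hC).2 fun α => (ContinuousMap.norm_le _ hC).2 (h α)

/-- Evaluation at a point as a continuous linear functional. -/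
def Ck.evalL (x : V → Pt d r ℓ) : StrongDual ℂ (Ck d r k ℓ V ℂ) :=
  LinearMap.mkContinuous
    { toFun := fun f => f.eval x
      map_add' := fun _ _ => rfl
      map_smul' := fun _ _ => rfl } 1
    (fun f => by rw [one_mul]; exact Ck.norm_apply_le f _ x)

theorem shift_comp (e : V ≃ W) (w : W) (μ : Fin d) (t : ℝ) (x : W → Pt d r ℓ) :
    shift w μ t x ∘ e = shift (e.symm w) μ t (x ∘ e) := by
  funext v
  by_cases h : v = e.symm w
  · subst h; simp [shift]
  · have : e v ≠ w := fun h' => h (by simp [← h'])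
    simp [shift, h, this]

/-- Relabelling of variables: `(reindex e f)(x) = f(x ∘ e)`. -/
def Ck.reindex (e : V ≃ W) : Ck d r k ℓ V ℂ →L[ℂ] Ck d r k ℓ W ℂ :=
  LinearMap.mkContinuous
    { toFun := fun f =>
        ⟨fun β => (f.1 (β ∘ e)).comp ⟨fun x => x ∘ e, by fun_prop⟩, by
          intro w μ α α' h x
          have := f.2 (e.symm w) μ (α ∘ e) (α' ∘ e)
            (by
              intro v ν
              rw [Function.comp, h (e v) ν]
              simp [Equiv.eq_symm_apply]) (x ∘ e)
          simpa [shift_comp] using this⟩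
      map_add' := fun _ _ => rfl
      map_smul' := fun _ _ => rfl } 1
    (fun f => by
      rw [one_mul]
      exact Ck.norm_le (norm_nonneg _) fun α x => f.norm_apply_le _ _)

theorem Ck.norm_reindex_le (e : V ≃ W) : ‖(Ck.reindex e : Ck d r k ℓ V ℂ →L[ℂ] _)‖ ≤ 1 :=
  LinearMap.mkContinuous_norm_le _ zero_le_one _

/-- Composition with a continuous linear map on the values. -/
def Ck.postcomp (A : E →L[ℂ] E') (f : Ck d r k ℓ V E) : Ck d r k ℓ V E' :=
  ⟨fun α => (A : C(E, E')).comp (f.1 α), fun v μ α α' h x =>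
    ((A.restrictScalars ℝ).hasFDerivAt.comp_hasDerivAt (0 : ℝ) (f.2 v μ α α' h x))⟩

/-- Pointwise differentiability with continuous derivative gives differentiability in sup norm. -/
theorem hasDerivAt_continuousMap {X : Type} [TopologicalSpace X] [CompactSpace X]
    (g g' : ℝ → C(X, ℂ)) (hc : Continuous g')
    (h : ∀ t x, HasDerivAt (fun s => g s x) (g' t x) t) : HasDerivAt g (g' 0) 0 := by
  rw [hasDerivAt_iff_isLittleO, Asymptotics.isLittleO_iff]
  intro c hcpos
  obtain ⟨δ, hδ, hδ'⟩ := Metric.continuous_iff.1 hc 0 c hcpos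
  filter_upwards [Metric.ball_mem_nhds (0 : ℝ) hδ] with t ht
  refine (ContinuousMap.norm_le _ (by positivity)).2 fun x => ?_
  have key := Convex.norm_image_sub_le_of_norm_hasDerivWithin_le
    (f := fun s => g s x - s • g' 0 x) (f' := fun s => g' s x - g' 0 x)
    (s := Metric.ball (0 : ℝ) δ) (x := 0) (y := t) (C := c)
    (fun s _ => by
      have h2 : HasDerivAt (fun s : ℝ => s • g' 0 x) (g' 0 x) s := by
        simpa using (hasDerivAt_id s).smul_const (g' 0 x)
      exact ((h s x).sub h2).hasDerivWithinAt)
    (fun s hs => by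
      have h1 := hδ' s (by simpa using hs)
      rw [dist_eq_norm] at h1
      exact (ContinuousMap.norm_coe_le_norm (g' s - g' 0) x).trans h1.le)
    (convex_ball _ _) (Metric.mem_ball_self hδ) ht
  have e : (g t - g 0 - (t - 0) • g' 0) x = (g t x - t • g' 0 x) - (g 0 x - (0 : ℝ) • g' 0 x) := by
    simp; ring
  rw [e]
  exact key

theorem continuous_shift (v : V) (μ : Fin d) (x : V → Pt d r ℓ) :
    Continuous fun t : ℝ => shift v μ t x := by
  unfold shift
  have h1 : Continuous fun t : ℝ => (t : AddCircle ℓ) := AddCircle.continuous_mk' ℓ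
  have h2 : Continuous fun t : ℝ => (Pi.single μ (t : AddCircle ℓ) : Torus d ℓ) :=
    (continuous_single μ).comp h1
  exact continuous_const.update v (continuous_const.prodMk (continuous_const.add h2))

theorem shift_add (v : V) (μ : Fin d) (s t : ℝ) (x : V → Pt d r ℓ) :
    shift v μ (s + t) x = shift v μ t (shift v μ s x) := by
  simp [shift, Pi.single_add, add_assoc]

theorem shift_inl (v : V) (μ : Fin d) (t : ℝ) (x : V → Pt d r ℓ) (y : W → Pt d r ℓ) :
    shift (Sum.inl v) μ t (Sum.elim x y) = Sum.elim (shift v μ t x) y := by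
  funext u
  rcases u with u | u
  · by_cases h : u = v
    · subst h; simp [shift]
    · simp [shift, h]
  · simp [shift]

theorem shift_inr (w : W) (μ : Fin d) (t : ℝ) (x : V → Pt d r ℓ) (y : W → Pt d r ℓ) :
    shift (Sum.inr w) μ t (Sum.elim x y) = Sum.elim x (shift w μ t y) := by
  funext u
  rcases u with u | u
  · simp [shift]
  · by_cases h : u = w
    · subst h; simp [shift]
    · simp [shift, h]

theorem continuous_elim :
    Continuous fun p : (W → Pt d r ℓ) × (V → Pt d r ℓ) => (Sum.elim p.2 p.1 : V ⊕ W → Pt d r ℓ) := by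
  refine continuous_pi fun u => ?_
  rcases u with u | u
  · exact (continuous_apply u).comp continuous_snd
  · exact (continuous_apply u).comp continuous_fst

theorem Ck.hasDerivAt (f : Ck d r k ℓ V E) {v : V} {μ : Fin d} {α α' : V → MultiIdx d k}
    (h : IsIncr v μ α α') (x : V → Pt d r ℓ) (t : ℝ) :
    HasDerivAt (fun s : ℝ => f.1 α (shift v μ s x)) (f.1 α' (shift v μ t x)) t := by
  have h0 := f.2 v μ α α' h (shift v μ t x)
  have h1 : HasDerivAt (fun s : ℝ => s - t) 1 t := (hasDerivAt_id t).sub_const t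
  have h2 := HasDerivAt.scomp (x := t) (h := fun s : ℝ => s - t) (h' := 1)
    (g₁ := fun s : ℝ => f.1 α (shift v μ s (shift v μ t x))) (by simpa using h0) h1
  simpa [Function.comp_def, ← shift_add] using h2

/-- The slice `∂_y^β f(·, y)` of a function of the variables `x ∈ 𝕋^V`, `y ∈ 𝕋^W`. -/
def Ck.slice (f : Ck d r k ℓ (V ⊕ W) ℂ) (β : W → MultiIdx d k) (y : W → Pt d r ℓ) :
    Ck d r k ℓ V ℂ :=
  ⟨fun α => ⟨fun x => f.1 (Sum.elim α β) (Sum.elim x y),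
      (f.1 (Sum.elim α β)).continuous.comp
        (continuous_elim.comp (continuous_const.prodMk continuous_id))⟩, by
    intro v μ α α' h x
    have := f.2 (Sum.inl v) μ (Sum.elim α β) (Sum.elim α' β)
      (by
        rintro (w | w) ν
        · simpa using h w ν
        · simp) (Sum.elim x y)
    simpa [shift_inl] using this⟩

theorem Ck.continuous_slice (f : Ck d r k ℓ (V ⊕ W) ℂ) (β : W → MultiIdx d k) :
    Continuous (f.slice β) := by
  refine Continuous.subtype_mk (continuous_pi fun α => ?_) _
  exact (ContinuousMap.curry ⟨fun p : (W → Pt d r ℓ) × (V → Pt d r ℓ) =>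
    f.1 (Sum.elim α β) (Sum.elim p.2 p.1),
    (f.1 (Sum.elim α β)).continuous.comp continuous_elim⟩).continuous

theorem Ck.hasDerivAt_slice (f : Ck d r k ℓ (V ⊕ W) ℂ) {w : W} {μ : Fin d}
    {β β' : W → MultiIdx d k} (h : IsIncr w μ β β') (y : W → Pt d r ℓ) :
    HasDerivAt (fun t : ℝ => f.slice β (shift w μ t y)) (f.slice β' y) 0 := by
  have h0 : shift w μ 0 y = y := by simp [shift]
  have key : HasDerivAt (fun t : ℝ => (f.slice β (shift w μ t y)).1) (f.slice β' y).1 0 := by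
    refine hasDerivAt_pi.2 fun α => ?_
    have := hasDerivAt_continuousMap (fun t : ℝ => (f.slice β (shift w μ t y)).1 α)
      (fun t : ℝ => (f.slice β' (shift w μ t y)).1 α)
      ((continuous_apply α).comp (continuous_subtype_val.comp
        ((f.continuous_slice β').comp (continuous_shift w μ y))))
      (fun t x => by
        have := f.hasDerivAt (v := Sum.inr w) (μ := μ) (α := Sum.elim α β) (α' := Sum.elim α β')
          (by
            rintro (v | v) ν
            · simp
            · simpa using h v ν) (Sum.elim x y) t
        simp only [shift_inr] at this
        exact this)
    simpa only [h0] using this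
  rw [hasDerivAt_iff_isLittleO] at key ⊢
  exact (Asymptotics.isLittleO_norm_left.1
    ((Asymptotics.isLittleO_norm_left.2 key).congr_left fun t => rfl))

/-- A function of `x ∈ 𝕋^V`, `y ∈ 𝕋^W` as a function of `y` with values in functions of `x`. -/
def Ck.curry (f : Ck d r k ℓ (V ⊕ W) ℂ) : Ck d r k ℓ W (Ck d r k ℓ V ℂ) :=
  ⟨fun β => ⟨f.slice β, f.continuous_slice β⟩, fun _ _ _ _ h y => f.hasDerivAt_slice h y⟩

/-- The tensor product of distributions,
`⟨A ⊗ B, f⟩ = ⟨B, y ↦ ⟨A, f(·, y)⟩⟩`. -/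
def tensor (A : StrongDual ℂ (Ck d r k ℓ V ℂ)) (B : StrongDual ℂ (Ck d r k ℓ W ℂ)) :
    StrongDual ℂ (Ck d r k ℓ (V ⊕ W) ℂ) :=
  LinearMap.mkContinuous
    { toFun := fun f => B (f.curry.postcomp A)
      map_add' := fun f g => by
        rw [← map_add]
        congr 1
        refine Ck.ext' fun β y => ?_
        exact map_add A (f.slice β y) (g.slice β y)
      map_smul' := fun c f => by
        rw [RingHom.id_apply, ← map_smul]
        congr 1
        refine Ck.ext' fun β y => ?_
        exact map_smul A c (f.slice β y) }
    (‖A‖ * ‖B‖)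
    (fun f => by
      refine (B.le_opNorm _).trans ?_
      rw [mul_comm ‖A‖, mul_assoc]
      refine mul_le_mul_of_nonneg_left ?_ (norm_nonneg _)
      refine Ck.norm_le (by positivity) fun β y => ?_
      refine (A.le_opNorm (f.slice β y)).trans (mul_le_mul_of_nonneg_left ?_ (norm_nonneg _))
      exact Ck.norm_le (norm_nonneg _) fun α x => f.norm_apply_le _ _)

theorem norm_tensor_le (A : StrongDual ℂ (Ck d r k ℓ V ℂ)) (B : StrongDual ℂ (Ck d r k ℓ W ℂ)) :
    ‖tensor A B‖ ≤ ‖A‖ * ‖B‖ :=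
  LinearMap.mkContinuous_norm_le _ (by positivity) _

end Ck

section Algebra

variable {d r k : ℕ} {ℓ : ℝ} [Fact (0 < ℓ)]

/-- The distributions `𝒞_k'(𝕋^{n+m})`, the kernels `F_{nm}(x_1, …, x_n, y_1, …, y_m)`. -/
abbrev Kern (d r k : ℕ) (ℓ : ℝ) [Fact (0 < ℓ)] (n m : ℕ) : Type :=
  StrongDual ℂ (Ck d r k ℓ (Fin n ⊕ Fin m) ℂ)

/-- The sign of a pair of permutations, as a complex number. -/
def sgn {n m : ℕ} (σ : Equiv.Perm (Fin n)) (τ : Equiv.Perm (Fin m)) : ℂ :=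
  ((Equiv.Perm.sign σ * Equiv.Perm.sign τ : ℤˣ) : ℤ)

/-- Anti-symmetry in the `x_i` and in the `y_j` separately. -/
def Kern.IsAntisymm {n m : ℕ} (F : Kern d r k ℓ n m) : Prop :=
  ∀ (σ : Equiv.Perm (Fin n)) (τ : Equiv.Perm (Fin m)) (f : Ck d r k ℓ (Fin n ⊕ Fin m) ℂ),
    F (Ck.reindex (Equiv.sumCongr σ τ) f) = sgn σ τ * F f

/-- The sum of the signed permutations of a kernel. -/
def Kern.alt {n m : ℕ} (T : Kern d r k ℓ n m) : Kern d r k ℓ n m :=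
  ∑ σ : Equiv.Perm (Fin n), ∑ τ : Equiv.Perm (Fin m),
    sgn σ τ • T.comp (Ck.reindex (Equiv.sumCongr σ τ))

theorem norm_sgn {n m : ℕ} (σ : Equiv.Perm (Fin n)) (τ : Equiv.Perm (Fin m)) :
    ‖sgn σ τ‖ = 1 := by
  unfold sgn
  rcases Int.units_eq_one_or (Equiv.Perm.sign σ * Equiv.Perm.sign τ) with h | h <;> simp [h]

theorem sgn_mul {n m : ℕ} (σ σ' : Equiv.Perm (Fin n)) (τ τ' : Equiv.Perm (Fin m)) :
    sgn (σ * σ') (τ * τ') = sgn σ τ * sgn σ' τ' := by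
  simp only [sgn, Equiv.Perm.sign_mul, Units.val_mul, Int.cast_mul]
  ring

theorem sgn_mul_self {n m : ℕ} (σ : Equiv.Perm (Fin n)) (τ : Equiv.Perm (Fin m)) :
    sgn σ τ * sgn σ τ = 1 := by
  unfold sgn
  rcases Int.units_eq_one_or (Equiv.Perm.sign σ * Equiv.Perm.sign τ) with h | h <;> simp [h]

theorem Kern.isAntisymm_alt {n m : ℕ} (T : Kern d r k ℓ n m) : T.alt.IsAntisymm := by
  intro σ₀ τ₀ f
  have key : ∀ σ τ, sgn σ τ * T (Ck.reindex (Equiv.sumCongr σ τ)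
      (Ck.reindex (Equiv.sumCongr σ₀ τ₀) f)) =
      sgn σ₀ τ₀ * (sgn (σ * σ₀) (τ * τ₀) * T (Ck.reindex (Equiv.sumCongr (σ * σ₀) (τ * τ₀)) f)) := by
    intro σ τ
    have h1 : Ck.reindex (Equiv.sumCongr σ τ) (Ck.reindex (Equiv.sumCongr σ₀ τ₀) f) =
        Ck.reindex (Equiv.sumCongr (σ * σ₀) (τ * τ₀)) f := by
      have h2 : (Equiv.sumCongr (σ * σ₀) (τ * τ₀) : _ → _) =
          Equiv.sumCongr σ τ ∘ Equiv.sumCongr σ₀ τ₀ := by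
        funext u
        rcases u with u | u <;> rfl
      refine Ck.ext' fun β x => ?_
      change f.1 ((β ∘ Equiv.sumCongr σ τ) ∘ Equiv.sumCongr σ₀ τ₀)
          ((x ∘ Equiv.sumCongr σ τ) ∘ Equiv.sumCongr σ₀ τ₀) =
        f.1 (β ∘ Equiv.sumCongr (σ * σ₀) (τ * τ₀)) (x ∘ Equiv.sumCongr (σ * σ₀) (τ * τ₀))
      rw [h2]
      rfl
    rw [h1, sgn_mul, ← mul_assoc, mul_comm (sgn σ τ) (sgn σ₀ τ₀), ← mul_assoc, sgn_mul_self,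
      one_mul]
  have e1 : ∀ g, T.alt g = ∑ σ : Equiv.Perm (Fin n), ∑ τ : Equiv.Perm (Fin m),
      sgn σ τ * T (Ck.reindex (Equiv.sumCongr σ τ) g) := by
    intro g
    simp only [Kern.alt, _root_.sum_apply, _root_.smul_apply,
      ContinuousLinearMap.comp_apply, smul_eq_mul]
  rw [e1, e1, Finset.mul_sum]
  refine Fintype.sum_equiv (Equiv.mulRight σ₀) _ _ fun σ => ?_
  rw [Finset.mul_sum]
  refine Fintype.sum_equiv (Equiv.mulRight τ₀) _ _ fun τ => ?_
  exact key σ τ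

theorem Kern.norm_alt_le {n m : ℕ} (T : Kern d r k ℓ n m) : ‖T.alt‖ ≤ (n ! * m ! : ℝ) * ‖T‖ := by
  have h : ∀ σ τ, ‖sgn σ τ • T.comp (Ck.reindex (Equiv.sumCongr σ τ))‖ ≤ ‖T‖ := by
    intro σ τ
    rw [norm_smul, norm_sgn, one_mul]
    refine (ContinuousLinearMap.opNorm_comp_le _ _).trans ?_
    exact mul_le_of_le_one_right (norm_nonneg _) (Ck.norm_reindex_le _)
  unfold Kern.alt
  refine (norm_sum_le _ _).trans ((Finset.sum_le_sum fun σ _ =>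
    (norm_sum_le _ _).trans (Finset.sum_le_sum fun τ _ => h σ τ)).trans ?_)
  simp [Fintype.card_perm, mul_assoc]

/-- The weight `h^{n+m} / (n! m!)`. -/
def weight (h : ℝ) (n m : ℕ) : ℝ := h ^ (n + m) / (n ! * m !)

theorem weight_nonneg (h : ℝ) [hh : Fact (0 < h)] (n m : ℕ) : 0 ≤ weight h n m := by
  have := hh.out
  unfold weight
  positivity

theorem weight_pos (h : ℝ) [hh : Fact (0 < h)] (n m : ℕ) : 0 < weight h n m := by
  have := hh.out
  unfold weight
  positivity

/-- Families of anti-symmetric kernels with `∑_{n,m} h^{n+m}/(n! m!) ‖F_{nm}‖_{𝒞'} < ∞`. -/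
def grassmannSubmodule (d r k : ℕ) (ℓ : ℝ) [Fact (0 < ℓ)] (h : ℝ) [Fact (0 < h)] :
    Submodule ℂ (∀ n m, Kern d r k ℓ n m) where
  carrier := {F | (∀ n m, (F n m).IsAntisymm) ∧
    Summable fun p : ℕ × ℕ => weight h p.1 p.2 * ‖F p.1 p.2‖}
  add_mem' := by
    rintro F H ⟨hF, hF'⟩ ⟨hH, hH'⟩
    refine ⟨fun n m σ τ f => ?_, ?_⟩
    · have h1 := hF n m σ τ f
      have h2 := hH n m σ τ f
      simp only [Pi.add_apply, _root_.add_apply, h1, h2, mul_add]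
    · refine Summable.of_nonneg_of_le (fun p => ?_) (fun p => ?_) (hF'.add hH')
      · exact mul_nonneg (weight_nonneg h _ _) (norm_nonneg _)
      · rw [← mul_add]
        exact mul_le_mul_of_nonneg_left (norm_add_le _ _) (weight_nonneg h _ _)
  zero_mem' := by
    refine ⟨fun n m σ τ f => by simp, ?_⟩
    simp
  smul_mem' := by
    rintro c F ⟨hF, hF'⟩
    refine ⟨fun n m σ τ f => ?_, ?_⟩
    · have h1 := hF n m σ τ f
      simp only [Pi.smul_apply, _root_.smul_apply, h1, smul_eq_mul]
      ring
    · have : (fun p : ℕ × ℕ => weight h p.1 p.2 * ‖(c • F) p.1 p.2‖) =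
          fun p : ℕ × ℕ => ‖c‖ * (weight h p.1 p.2 * ‖F p.1 p.2‖) := by
        funext p
        simp only [Pi.smul_apply, norm_smul]
        ring
      rw [this]
      exact hF'.mul_left _

/-- The space `𝒢_h`: formal expressions
`F = ∑_{n,m} 1/(n! m!) ∫ F_{nm}(x, y) ψ(x_1) ⋯ ψ(x_n) ψ̄(y_1) ⋯ ψ̄(y_m) dx dy`
with `‖F‖_h = ∑_{n,m} h^{n+m}/(n! m!) ‖F_{nm}‖_{𝒞'} < ∞`. -/
def Grassmann (d r k : ℕ) (ℓ : ℝ) [Fact (0 < ℓ)] (h : ℝ) [Fact (0 < h)] : Type :=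
  grassmannSubmodule d r k ℓ h

variable {h : ℝ} [Fact (0 < h)]

instance : AddCommGroup (Grassmann d r k ℓ h) :=
  inferInstanceAs (AddCommGroup (grassmannSubmodule d r k ℓ h))

instance : Module ℂ (Grassmann d r k ℓ h) :=
  inferInstanceAs (Module ℂ (grassmannSubmodule d r k ℓ h))

/-- The kernel `F_{nm}`. -/
def Grassmann.kern (F : Grassmann d r k ℓ h) (n m : ℕ) : Kern d r k ℓ n m := F.1 n m

theorem Grassmann.summable (F : Grassmann d r k ℓ h) :
    Summable fun p : ℕ × ℕ => weight h p.1 p.2 * ‖F.kern p.1 p.2‖ := F.2.2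

/-- The norm `‖F‖_h`. -/
def Grassmann.groupNorm (d r k : ℕ) (ℓ : ℝ) [Fact (0 < ℓ)] (h : ℝ) [Fact (0 < h)] :
    AddGroupNorm (Grassmann d r k ℓ h) where
  toFun F := ∑' p : ℕ × ℕ, weight h p.1 p.2 * ‖F.kern p.1 p.2‖
  map_zero' := by
    have : ∀ n m, (0 : Grassmann d r k ℓ h).kern n m = 0 := fun _ _ => rfl
    simp [this]
  add_le' F H := by
    rw [← F.summable.tsum_add H.summable]
    refine Summable.tsum_le_tsum (fun p => ?_) (F + H).summable (F.summable.add H.summable)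
    rw [← mul_add]
    exact mul_le_mul_of_nonneg_left (norm_add_le (F.kern p.1 p.2) (H.kern p.1 p.2))
      (weight_nonneg h _ _)
  neg' F := by
    have : ∀ n m, (-F).kern n m = -F.kern n m := fun _ _ => rfl
    simp [this]
  eq_zero_of_map_eq_zero' F hF := by
    refine Subtype.ext (funext fun n => funext fun m => ?_)
    have h0 := (hasSum_zero_iff_of_nonneg (fun p : ℕ × ℕ =>
      mul_nonneg (weight_nonneg h p.1 p.2) (norm_nonneg (F.kern p.1 p.2)))).1
      (hF ▸ F.summable.hasSum)
    have h1 := congrFun h0 (n, m)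
    have h2 : ‖F.kern n m‖ = 0 := by
      simpa [(weight_pos h n m).ne'] using h1
    exact norm_eq_zero.1 h2

instance : NormedAddCommGroup (Grassmann d r k ℓ h) :=
  (Grassmann.groupNorm d r k ℓ h).toNormedAddCommGroup

theorem Grassmann.norm_def (F : Grassmann d r k ℓ h) :
    ‖F‖ = ∑' p : ℕ × ℕ, weight h p.1 p.2 * ‖F.kern p.1 p.2‖ := rfl

instance : NormedSpace ℂ (Grassmann d r k ℓ h) where
  norm_smul_le c F := by
    have : ∀ n m, (c • F).kern n m = c • F.kern n m := fun _ _ => rfl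
    refine le_of_eq ?_
    rw [Grassmann.norm_def, Grassmann.norm_def, ← tsum_mul_left]
    refine tsum_congr fun p => ?_
    rw [this, norm_smul]
    ring

/-- The identification of the variables `(x', y'), (x'', y'')` of a product with
`x = (x', x'')`, `y = (y', y'')`. -/
def splitEquiv {N M n n' m m' : ℕ} (hN : n + n' = N) (hM : m + m' = M) :
    Fin N ⊕ Fin M ≃ (Fin n ⊕ Fin m) ⊕ (Fin n' ⊕ Fin m') :=
  ((Equiv.sumSumSumComm (Fin n) (Fin m) (Fin n') (Fin m')).trans
    (Equiv.sumCongr (finSumFinEquiv.trans (finCongr hN))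
      (finSumFinEquiv.trans (finCongr hM)))).symm

/-- One term of the product: `F_{nm}` and `H_{n'm'}` contribute
`(-1)^{m n'} / (n! n'! m! m'!) ∑_{σ,τ} sgn(σ) sgn(τ) (F_{nm} ⊗ H_{n'm'})` with permuted variables,
to the kernel of `ψ^{n+n'} ψ̄^{m+m'}`; the sign comes from moving the `ψ` of `H` past the `ψ̄` of
`F`. -/
def mulTerm {N M n n' m m' : ℕ} (hN : n + n' = N) (hM : m + m' = M)
    (A : Kern d r k ℓ n m) (B : Kern d r k ℓ n' m') : Kern d r k ℓ N M :=
  ((-1 : ℂ) ^ (m * n') / (n ! * n' ! * m ! * m' !)) •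
    Kern.alt ((tensor A B).comp (Ck.reindex (splitEquiv hN hM)))

/-- The kernels of the product `F H`. -/
def mulKern (F H : ∀ n m, Kern d r k ℓ n m) (N M : ℕ) : Kern d r k ℓ N M :=
  ∑ p : ↥(Finset.HasAntidiagonal.antidiagonal N : Finset (ℕ × ℕ)),
    ∑ q : ↥(Finset.HasAntidiagonal.antidiagonal M : Finset (ℕ × ℕ)),
    mulTerm (Finset.HasAntidiagonal.mem_antidiagonal.1 p.2) (Finset.HasAntidiagonal.mem_antidiagonal.1 q.2)
      (F p.1.1 q.1.1) (H p.1.2 q.1.2)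

theorem Kern.IsAntisymm.smul {n m : ℕ} {A : Kern d r k ℓ n m} (hA : A.IsAntisymm) (c : ℂ) :
    (c • A).IsAntisymm := by
  intro σ τ f
  simp only [_root_.smul_apply, hA σ τ f, smul_eq_mul]
  ring

theorem Kern.IsAntisymm.sum {n m : ℕ} {ι : Type} {s : Finset ι} {A : ι → Kern d r k ℓ n m}
    (hA : ∀ i ∈ s, (A i).IsAntisymm) : (∑ i ∈ s, A i).IsAntisymm := by
  intro σ τ f
  simp only [_root_.sum_apply, Finset.mul_sum]
  exact Finset.sum_congr rfl fun i hi => hA i hi σ τ f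

theorem weight_mul_norm_mulTerm_le {N M n n' m m' : ℕ} (hN : n + n' = N) (hM : m + m' = M)
    (A : Kern d r k ℓ n m) (B : Kern d r k ℓ n' m') :
    weight h N M * ‖mulTerm hN hM A B‖ ≤
      (weight h n m * ‖A‖) * (weight h n' m' * ‖B‖) := by
  have h1 : ‖Kern.alt ((tensor A B).comp (Ck.reindex (splitEquiv hN hM)))‖ ≤
      (N ! * M ! : ℝ) * (‖A‖ * ‖B‖) := by
    refine (Kern.norm_alt_le _).trans (mul_le_mul_of_nonneg_left ?_ (by positivity))
    refine (ContinuousLinearMap.opNorm_comp_le _ _).trans ?_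
    exact (mul_le_of_le_one_right (norm_nonneg _) (Ck.norm_reindex_le _)).trans
      (norm_tensor_le A B)
  have h2 : ‖((-1 : ℂ) ^ (m * n') / (n ! * n' ! * m ! * m' !))‖ =
      1 / (n ! * n' ! * m ! * m' ! : ℝ) := by
    simp [norm_pow]
  rw [mulTerm, norm_smul, h2]
  calc weight h N M * (1 / (n ! * n' ! * m ! * m' ! : ℝ) *
        ‖Kern.alt ((tensor A B).comp (Ck.reindex (splitEquiv hN hM)))‖)
      ≤ weight h N M * (1 / (n ! * n' ! * m ! * m' ! : ℝ) * ((N ! * M ! : ℝ) * (‖A‖ * ‖B‖))) := by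
        refine mul_le_mul_of_nonneg_left (mul_le_mul_of_nonneg_left h1 (by positivity))
          (weight_nonneg h _ _)
    _ = (weight h n m * ‖A‖) * (weight h n' m' * ‖B‖) := by
        have hf : ∀ j : ℕ, (j ! : ℝ) ≠ 0 := fun j => by positivity
        have := hf N
        have := hf M
        unfold weight
        rw [← hN, ← hM] at *
        field_simp
        ring

theorem mulKern_mem (F H : Grassmann d r k ℓ h) :
    mulKern F.kern H.kern ∈ grassmannSubmodule d r k ℓ h := by
  refine ⟨fun N M => ?_, ?_⟩
  · refine Kern.IsAntisymm.sum fun p _ => Kern.IsAntisymm.sum fun q _ => ?_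
    exact Kern.IsAntisymm.smul (Kern.isAntisymm_alt _) _
  · let a : ℕ × ℕ → ℝ := fun p => weight h p.1 p.2 * ‖F.kern p.1 p.2‖
    let b : ℕ × ℕ → ℝ := fun p => weight h p.1 p.2 * ‖H.kern p.1 p.2‖
    have ha0 : ∀ p, 0 ≤ a p := fun p => mul_nonneg (weight_nonneg h _ _) (norm_nonneg _)
    have hb0 : ∀ p, 0 ≤ b p := fun p => mul_nonneg (weight_nonneg h _ _) (norm_nonneg _)
    have hab : Summable fun z : (ℕ × ℕ) × (ℕ × ℕ) => a z.1 * b z.2 :=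
      F.summable.mul_of_nonneg H.summable ha0 hb0
    have hbound : ∀ P : ℕ × ℕ, weight h P.1 P.2 * ‖mulKern F.kern H.kern P.1 P.2‖ ≤
        ∑ z ∈ Finset.HasAntidiagonal.antidiagonal P.1 ×ˢ Finset.HasAntidiagonal.antidiagonal P.2,
          a (z.1.1, z.2.1) * b (z.1.2, z.2.2) := by
      intro P
      rw [Finset.sum_product, ← Finset.sum_coe_sort (Finset.HasAntidiagonal.antidiagonal P.1)]
      refine (mul_le_mul_of_nonneg_left (norm_sum_le _ _) (weight_nonneg h _ _)).trans ?_
      rw [Finset.mul_sum]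
      refine Finset.sum_le_sum fun p _ => ?_
      rw [← Finset.sum_coe_sort (Finset.HasAntidiagonal.antidiagonal P.2)]
      refine (mul_le_mul_of_nonneg_left (norm_sum_le _ _) (weight_nonneg h _ _)).trans ?_
      rw [Finset.mul_sum]
      exact Finset.sum_le_sum fun q _ => weight_mul_norm_mulTerm_le _ _ _ _
    refine summable_of_sum_le (c := ∑' z : (ℕ × ℕ) × (ℕ × ℕ), a z.1 * b z.2)
      (fun P => mul_nonneg (weight_nonneg h _ _) (norm_nonneg _)) fun s => ?_
    refine (Finset.sum_le_sum fun P _ => hbound P).trans ?_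
    rw [Finset.sum_sigma']
    let j : ((_ : ℕ × ℕ) × ((ℕ × ℕ) × (ℕ × ℕ))) → (ℕ × ℕ) × (ℕ × ℕ) :=
      fun z => ((z.2.1.1, z.2.2.1), (z.2.1.2, z.2.2.2))
    have hj : Set.InjOn j (s.sigma fun P => Finset.HasAntidiagonal.antidiagonal P.1 ×ˢ Finset.HasAntidiagonal.antidiagonal P.2 :
        Finset ((_ : ℕ × ℕ) × ((ℕ × ℕ) × (ℕ × ℕ)))) := by
      rintro ⟨⟨N, M⟩, ⟨p1, p2⟩, ⟨q1, q2⟩⟩ hz ⟨⟨N', M'⟩, ⟨p1', p2'⟩, ⟨q1', q2'⟩⟩ hz' hzz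
      simp only [Finset.coe_sigma, Set.mem_sigma_iff, Finset.mem_coe, Finset.mem_product,
        Finset.HasAntidiagonal.mem_antidiagonal] at hz hz'
      simp only [j, Prod.mk.injEq] at hzz
      obtain ⟨⟨rfl, rfl⟩, rfl, rfl⟩ := hzz
      obtain ⟨-, rfl, rfl⟩ := hz
      obtain ⟨-, rfl, rfl⟩ := hz'
      rfl
    have := hab.sum_le_tsum
      ((s.sigma fun P => Finset.HasAntidiagonal.antidiagonal P.1 ×ˢ Finset.HasAntidiagonal.antidiagonal P.2).image j)
      (fun z _ => mul_nonneg (ha0 _) (hb0 _))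
    rw [Finset.sum_image hj] at this
    exact this

instance : Mul (Grassmann d r k ℓ h) := ⟨fun F H => ⟨mulKern F.kern H.kern, mulKern_mem F H⟩⟩

/-- A family of kernels whose only nonzero member is `A` at `(n, m)`. -/
def singleKern {n m : ℕ} (A : Kern d r k ℓ n m) : ∀ n' m', Kern d r k ℓ n' m' := fun n' m' =>
  if e : n = n' ∧ m = m' then e.1 ▸ e.2 ▸ A else 0

theorem singleKern_mem {n m : ℕ} (A : Kern d r k ℓ n m) (hA : A.IsAntisymm) :
    singleKern A ∈ grassmannSubmodule d r k ℓ h := by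
  refine ⟨fun n' m' => ?_, ?_⟩
  · unfold singleKern
    split_ifs with e
    · obtain ⟨rfl, rfl⟩ := e
      exact hA
    · intro σ τ f
      simp
  · refine summable_of_ne_finset_zero (s := {(n, m)}) fun p hp => ?_
    have : ¬ (n = p.1 ∧ m = p.2) := fun e => hp (by simp [e.1, e.2])
    simp [singleKern, this]

theorem isAntisymm_of_subsingleton {n m : ℕ} [Subsingleton (Fin n)] [Subsingleton (Fin m)]
    (A : Kern d r k ℓ n m) : A.IsAntisymm := by
  intro σ τ f
  obtain rfl : σ = 1 := Subsingleton.elim _ _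
  obtain rfl : τ = 1 := Subsingleton.elim _ _
  have h1 : Ck.reindex (Equiv.sumCongr (1 : Equiv.Perm (Fin n)) (1 : Equiv.Perm (Fin m))) f = f := by
    have h2 : (Equiv.sumCongr (1 : Equiv.Perm (Fin n)) (1 : Equiv.Perm (Fin m)) : _ → _) = id := by
      funext u
      rcases u with u | u <;> rfl
    refine Ck.ext' fun β x => ?_
    change f.1 (β ∘ Equiv.sumCongr (1 : Equiv.Perm (Fin n)) (1 : Equiv.Perm (Fin m)))
      (x ∘ Equiv.sumCongr (1 : Equiv.Perm (Fin n)) (1 : Equiv.Perm (Fin m))) = f.1 β x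
    rw [h2]
    rfl
  rw [h1]
  simp [sgn]

/-- The unit of `𝒢_h`: the only nonzero kernel is the constant `1` at `n = m = 0`. -/
instance : One (Grassmann d r k ℓ h) :=
  ⟨⟨singleKern (n := 0) (m := 0) (Ck.evalL fun u => u.elim Fin.elim0 Fin.elim0),
    singleKern_mem _ (isAntisymm_of_subsingleton _)⟩⟩

/-- The exponential series `∑_p A^p / p!`, convergent in the norm of `𝒢_h`. -/
def Grassmann.exp (A : Grassmann d r k ℓ h) : Grassmann d r k ℓ h :=
  ∑' p : ℕ, ((p ! : ℂ)⁻¹) • npowRec p A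

end Algebra

section Kernels

variable {d r k : ℕ} {ℓ : ℝ} [Fact (0 < ℓ)]

/-- A smooth function `K(x, y)` on `𝕋 × 𝕋`, with values in `r × r` matrices. -/
structure SmoothKernel (d r : ℕ) (ℓ : ℝ) where
  /-- the function -/
  toFun : C(Pt d r ℓ × Pt d r ℓ, ℂ)
  smooth : ∀ a b : Fin r, ContDiff ℝ ∞ fun p : (Fin d → ℝ) × (Fin d → ℝ) =>
    toFun ((a, fun μ => (p.1 μ : AddCircle ℓ)), (b, fun μ => (p.2 μ : AddCircle ℓ)))

instance : CoeFun (SmoothKernel d r ℓ) fun _ => Pt d r ℓ → Pt d r ℓ → ℂ :=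
  ⟨fun K x y => K.toFun (x, y)⟩

theorem integral_kernel_eq_inner (K : SmoothKernel d r ℓ) (f : L2 d r ℓ) (x : Pt d r ℓ) :
    ∫ y, K x y * f y ∂(ptMeasure d r ℓ) =
      inner ℂ (ContinuousMap.toLp 2 (ptMeasure d r ℓ) ℂ (star (K.toFun.curry x))) f := by
  rw [MeasureTheory.L2.inner_def]
  refine integral_congr_ae ?_
  filter_upwards [ContinuousMap.coeFn_toLp (p := 2) (𝕜 := ℂ) (ptMeasure d r ℓ)
    (star (K.toFun.curry x))] with y hy
  rw [hy]
  simp [mul_comm]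

/-- The function `x ↦ ∫ K(x, y) f(y) dy`. -/
def SmoothKernel.apply (K : SmoothKernel d r ℓ) (f : L2 d r ℓ) : C(Pt d r ℓ, ℂ) where
  toFun x := ∫ y, K x y * f y ∂(ptMeasure d r ℓ)
  continuous_toFun := by
    simp only [integral_kernel_eq_inner]
    have h1 : Continuous fun x => star (K.toFun.curry x) :=
      continuous_star.comp K.toFun.curry.continuous
    exact ((ContinuousMap.toLp 2 (ptMeasure d r ℓ) ℂ).continuous.comp h1).inner continuous_const

/-- The bounded operator `(K f)(x) = ∫ K(x, y) f(y) dy` on `L²(𝕋)`. -/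
def SmoothKernel.op (K : SmoothKernel d r ℓ) : L2 d r ℓ →L[ℂ] L2 d r ℓ :=
  LinearMap.mkContinuous
    { toFun := fun f => ContinuousMap.toLp 2 (ptMeasure d r ℓ) ℂ (K.apply f)
      map_add' := fun f g => by
        rw [← map_add]
        congr 1
        ext x
        change ∫ y, K x y * (f + g : L2 d r ℓ) y ∂(ptMeasure d r ℓ) =
          ∫ y, K x y * f y ∂(ptMeasure d r ℓ) + ∫ y, K x y * g y ∂(ptMeasure d r ℓ)
        rw [integral_kernel_eq_inner, integral_kernel_eq_inner, integral_kernel_eq_inner,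
          inner_add_right]
      map_smul' := fun c f => by
        rw [RingHom.id_apply, ← map_smul]
        congr 1
        ext x
        change ∫ y, K x y * (c • f : L2 d r ℓ) y ∂(ptMeasure d r ℓ) =
          c * ∫ y, K x y * f y ∂(ptMeasure d r ℓ)
        rw [integral_kernel_eq_inner, integral_kernel_eq_inner, inner_smul_right] }
    (‖ContinuousMap.toLp (E := ℂ) 2 (ptMeasure d r ℓ) ℂ‖ *
      (‖ContinuousMap.toLp (E := ℂ) 2 (ptMeasure d r ℓ) ℂ‖ * ‖K.toFun‖))
    (fun f => by
      refine ((ContinuousMap.toLp 2 (ptMeasure d r ℓ) ℂ).le_opNorm (K.apply f)).trans ?_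
      rw [mul_assoc]
      refine mul_le_mul_of_nonneg_left ?_ (norm_nonneg _)
      refine (ContinuousMap.norm_le _ (by positivity)).2 fun x => ?_
      change ‖∫ y, K x y * f y ∂(ptMeasure d r ℓ)‖ ≤ _
      rw [integral_kernel_eq_inner]
      refine (norm_inner_le_norm _ _).trans (mul_le_mul_of_nonneg_right ?_ (norm_nonneg _))
      refine ((ContinuousMap.toLp (E := ℂ) 2 (ptMeasure d r ℓ) ℂ).le_opNorm
        (star (K.toFun.curry x))).trans
        (mul_le_mul_of_nonneg_left ?_ (norm_nonneg _))
      rw [norm_star]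
      exact (ContinuousMap.norm_le _ (norm_nonneg _)).2 fun y =>
        ContinuousMap.norm_coe_le_norm K.toFun (x, y))

/-- The value of `f ∈ 𝒞_k(𝕋²)` at `(x, y)`, with `x` the argument of `ψ` and `y` that of `ψ̄`. -/
def evalPair (f : Ck d r k ℓ (Fin 1 ⊕ Fin 1) ℂ) (x y : Pt d r ℓ) : ℂ :=
  f.eval (Sum.elim (fun _ => x) (fun _ => y))

theorem continuous_evalPair (f : Ck d r k ℓ (Fin 1 ⊕ Fin 1) ℂ) :
    Continuous fun z : Pt d r ℓ × Pt d r ℓ => evalPair f z.1 z.2 := by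
  refine (f.1 fun _ => 0).continuous.comp (continuous_pi fun u => ?_)
  rcases u with u | u
  · exact continuous_fst
  · exact continuous_snd

/-- The kernel of `⟨ψ̄, K ψ⟩ = ∫ ψ̄(y) K(y, x) ψ(x) dx dy = -∫ K(y, x) ψ(x) ψ̄(y) dx dy`. -/
def SmoothKernel.formKern (k : ℕ) (K : SmoothKernel d r ℓ) : Kern d r k ℓ 1 1 :=
  LinearMap.mkContinuous
    { toFun := fun f => -∫ z : Pt d r ℓ × Pt d r ℓ, K z.2 z.1 * evalPair f z.1 z.2
        ∂((ptMeasure d r ℓ).prod (ptMeasure d r ℓ))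
      map_add' := fun f g => by
        rw [← neg_add, ← integral_add]
        · refine congrArg Neg.neg (integral_congr_ae (Eventually.of_forall fun z => ?_))
          exact mul_add _ _ _
        · exact ((K.toFun.continuous.comp continuous_swap).mul
            (continuous_evalPair f)).integrable_of_hasCompactSupport
            (HasCompactSupport.of_compactSpace _)
        · exact ((K.toFun.continuous.comp continuous_swap).mul
            (continuous_evalPair g)).integrable_of_hasCompactSupport
            (HasCompactSupport.of_compactSpace _)
      map_smul' := fun c f => by
        rw [RingHom.id_apply, smul_neg, ← integral_smul]
        refine congrArg Neg.neg (integral_congr_ae (Eventually.of_forall fun z => ?_))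
        exact mul_left_comm _ _ _ }
    (‖K.toFun‖ * ((ptMeasure d r ℓ).prod (ptMeasure d r ℓ)).real Set.univ)
    (fun f => by
      change ‖-∫ z : Pt d r ℓ × Pt d r ℓ, K z.2 z.1 * evalPair f z.1 z.2
        ∂((ptMeasure d r ℓ).prod (ptMeasure d r ℓ))‖ ≤ _
      rw [norm_neg]
      refine (norm_integral_le_of_norm_le_const (C := ‖K.toFun‖ * ‖f‖)
        (Eventually.of_forall fun z => ?_)).trans (le_of_eq (by ring))
      rw [norm_mul]
      exact mul_le_mul (ContinuousMap.norm_coe_le_norm K.toFun _) (f.norm_apply_le _ _)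
        (norm_nonneg _) (norm_nonneg _))

/-- The element `⟨ψ̄, K ψ⟩` of `𝒢_h`. -/
def SmoothKernel.form (k : ℕ) (h : ℝ) [Fact (0 < h)] (K : SmoothKernel d r ℓ) :
    Grassmann d r k ℓ h :=
  ⟨singleKern (K.formKern k), singleKern_mem _ (isAntisymm_of_subsingleton _)⟩

/-- A covariance of the form `G(x, y) = ∫ G₁(x, z) G₂(z, y) dz`. The factors enter as the
`L²`-valued functions `x ↦ G₁(x, ·)` and `y ↦ G₂(·, y)`, `k` times continuously differentiable. -/
def SmoothKernel.FactorsAs (G : SmoothKernel d r ℓ) (G₁ G₂ : Ck d r k ℓ Unit (L2 d r ℓ)) : Prop :=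
  ∀ x y, G x y = ∫ z, G₁.eval (fun _ => x) z * G₂.eval (fun _ => y) z ∂(ptMeasure d r ℓ)

/-- `h(G) = sup_{|α| ≤ k} { ‖∂^α G₁‖_2, ‖∂^α G₂‖_2 }`, where the derivatives act on the variable
`x` of `G₁(x, z)` and `y` of `G₂(z, y)`, the `L²` norm is taken in `z`, and the supremum is also over
`x` and `y` (on which the norm does not depend in the translation invariant case). -/
def gramBound (G₁ G₂ : Ck d r k ℓ Unit (L2 d r ℓ)) : ℝ := max ‖G₁‖ ‖G₂‖

/-- An integral on `𝒢_h` is a continuous linear functional. It is the Gaussian integral with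
covariance `G` if
`∫ ψ(x_1) ⋯ ψ(x_n) ψ̄(y_1) ⋯ ψ̄(y_m) dμ_G = ε_n δ_{nm} det {G(x_i, y_j)}`, that is
`∫ F dμ_G = ∑_n ε_n / (n!)² ⟨F_{nn}, det {G(x_i, y_j)}⟩`,
with `ε_n = (-1)^{n(n-1)/2}`, the sign for which
`∫ ψ(x_1) ψ̄(y_1) ⋯ ψ(x_n) ψ̄(y_n) dμ_G = det {G(x_i, y_j)}`.
Here `D n` is the function `det {G(x_i, y_j)}` as an element of `𝒞_k(𝕋^{2n})`. -/
def IsGaussianIntegral {h : ℝ} [Fact (0 < h)] (G : SmoothKernel d r ℓ)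
    (I : Grassmann d r k ℓ h →L[ℂ] ℂ) : Prop :=
  ∃ D : ∀ n : ℕ, Ck d r k ℓ (Fin n ⊕ Fin n) ℂ,
    (∀ n x, (D n).eval x =
      Matrix.det (Matrix.of fun i j : Fin n => G (x (Sum.inl i)) (x (Sum.inr j)))) ∧
    ∀ F : Grassmann d r k ℓ h,
      HasSum (fun n : ℕ => (-1 : ℂ) ^ (n * (n - 1) / 2) / ((n ! : ℂ) ^ 2) * F.kern n n (D n)) (I F)

end Kernels

end GrassmannField

end

noncomputable section

open MeasureTheory Filter Topology
open scoped ContDiff Nat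

namespace GrassmannField

/-! ### The Gram–Hadamard inequality. -/

section Gram

open InnerProductSpace Module

/-! Write G(x, y) = ⟨G₁(x), G₂(y)⟩ with the bilinear pairing of L². Then det {G(x_i, y_j)}, like
each of its derivatives of order at most k per variable, is a Gram determinant, and the
Gram–Hadamard inequality (`norm_det_inner_le`) bounds its 𝒞_k norm by h^{2n}. This is what the
weights of 𝒢_h ask for, so the Gaussian functional exists. It is unique because an element of 𝒞_k is
determined by its values (`Ck.ext_eval`).

For the formula with K, continuity allows F to have a single kernel A. Integrating A ⟨ψ̄, K ψ⟩^p
amounts to applying A to a Gram determinant of size n + p in which p pairs of vectors have been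
integrated against K (`powKern_gramCk`, with Fubini from `commutes_formKern`). Summed with (-1)^p /
p!, these are the Fredholm minors of M = G₂ K G₁. Laplace expansion along one column (`minor_cons`,
`series_cons_sub`) shows that they satisfy the recursion of an ordinary determinant whose columns
b_j are replaced by (1 - M)⁻¹ b_j. Hence they equal Z det ⟨a_i, (1 - M)⁻¹ b_j⟩ (`series_eq`), where
the Fredholm determinant Z is the integral of the exponential. Division by Z leaves the Gaussian
integral with covariance ⟨G₁(x), (1 - M)⁻¹ G₂(y)⟩.

With R = (1 - K G)⁻¹ one has (1 - M)⁻¹ = 1 + G₂ R K G₁, so this covariance is the kernel of G + G R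
K G = G R; it is smooth since the expression G + G R K G involves G and not its factors. The norm
condition serves only to provide R.

That Z does not vanish is a Taylor argument (`series_ne_zero`): if Z = 0, all Fredholm minors
vanish, hence so do all derivatives at -1 of the entire function t ↦ ∑ t^p e_p / p!, with e_p the
minors in which every pair is integrated. But its value at 0 is e_0 = 1. -/

theorem norm_det_orthonormalBasis_le {E : Type*} [NormedAddCommGroup E] [InnerProductSpace ℂ E]
    {n : ℕ} (b : OrthonormalBasis (Fin n) ℂ E) (f : Fin n → E) :
    ‖b.toBasis.det f‖ ≤ ∏ i, ‖f i‖ := by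
  have : FiniteDimensional ℂ E := b.toBasis.finiteDimensional_of_finite
  have hn : finrank ℂ E = Fintype.card (Fin n) := finrank_eq_card_basis b.toBasis
  set g := gramSchmidtOrthonormalBasis hn f with hg
  -- In the Gram–Schmidt basis g of f the matrix of f is triangular with diagonal entries ⟨g i, f
  -- i⟩, and passing from b to g costs a determinant of modulus one. Cauchy–Schwarz on the diagonal
  -- finishes.
  have h1 : b.toBasis.det f = b.toBasis.det g * g.toBasis.det f := by
    rw [Basis.det_apply, Basis.det_apply, Basis.det_apply, ← Matrix.det_mul]
    congr 1
    have := Basis.toMatrix_mul_toMatrix (b := b.toBasis) (b' := g.toBasis) (b'' := f)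
    simpa using this.symm
  have h2 : ‖b.toBasis.det g‖ = 1 := b.det_to_matrix_orthonormalBasis g
  rw [h1, norm_mul, h2, one_mul, hg, gramSchmidtOrthonormalBasis_det, norm_prod]
  refine Finset.prod_le_prod (fun _ _ => norm_nonneg _) fun i _ => ?_
  refine (norm_inner_le_norm _ _).trans ?_
  rw [OrthonormalBasis.norm_eq_one, one_mul]

/-- The Gram–Hadamard inequality. -/
theorem norm_det_inner_le {E : Type*} [NormedAddCommGroup E] [InnerProductSpace ℂ E]
    {n : ℕ} (u v : Fin n → E) :
    ‖Matrix.det (Matrix.of fun i j => inner ℂ (u i) (v j))‖ ≤ (∏ i, ‖u i‖) * ∏ i, ‖v i‖ := by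
  by_cases hu : LinearIndependent ℂ u
  · set U := Submodule.span ℂ (Set.range u) with hU
    have : FiniteDimensional ℂ U := FiniteDimensional.span_of_finite ℂ (Set.finite_range u)
    have hn : finrank ℂ U = Fintype.card (Fin n) := finrank_span_eq_card hu
    let b : OrthonormalBasis (Fin n) ℂ U :=
      (stdOrthonormalBasis ℂ U).reindex (finCongr (by simpa using hn))
    let u' : Fin n → U := fun i => ⟨u i, Submodule.subset_span ⟨i, rfl⟩⟩
    let v' : Fin n → U := fun i => U.orthogonalProjectionOnto (v i)
    -- Projecting v onto the span of u leaves the pairings unchanged. In orthonormal coordinates of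
    -- the span the Gram matrix is a product of two square matrices, and Hadamard's bound applies to
    -- each.
    have h1 : (Matrix.of fun i j => inner ℂ (u i) (v j)) =
        (b.toBasis.toMatrix u').conjTranspose * b.toBasis.toMatrix v' := by
      ext i j
      have e1 : inner ℂ (u i) (v j) = inner ℂ (u' i) (v' j) := by
        rw [Submodule.coe_inner]
        exact (Submodule.inner_orthogonalProjectionOnto_eq_of_mem_left (u' i) (v j)).symm
      rw [Matrix.of_apply, e1, ← b.sum_inner_mul_inner, Matrix.mul_apply]
      refine Finset.sum_congr rfl fun l _ => ?_
      simp [Basis.toMatrix_apply, OrthonormalBasis.repr_apply_apply, Matrix.conjTranspose_apply]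
    rw [h1, Matrix.det_mul, Matrix.det_conjTranspose, norm_mul, norm_star,
      ← Basis.det_apply, ← Basis.det_apply]
    refine mul_le_mul (norm_det_orthonormalBasis_le b u') ((norm_det_orthonormalBasis_le b v').trans
      (Finset.prod_le_prod (fun _ _ => norm_nonneg _) fun i _ => ?_)) (norm_nonneg _)
      (Finset.prod_nonneg fun _ _ => norm_nonneg _)
    exact (U.orthogonalProjectionOnto.le_opNorm _).trans
      (mul_le_of_le_one_left (norm_nonneg _) (U.orthogonalProjectionOnto_norm_le))
  · rw [Fintype.not_linearIndependent_iff] at hu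
    obtain ⟨c, hc, i, hi⟩ := hu
    -- A linear relation among the u i gives a left null vector, with conjugated coefficients
    -- because the inner product is antilinear in its first argument.
    have : Matrix.det (Matrix.of fun i j => inner ℂ (u i) (v j)) = 0 := by
      refine Matrix.exists_vecMul_eq_zero_iff.1 ⟨fun i => star (c i), fun h => hi ?_, ?_⟩
      · simpa using congrFun h i
      · ext j
        have : inner ℂ (∑ i, c i • u i) (v j) = 0 := by rw [hc, inner_zero_left]
        simpa [Matrix.vecMul, dotProduct, sum_inner, inner_smul_left, mul_comm] using this
    rw [this, norm_zero]
    positivity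

end Gram

/-! ### Gram determinants and abstract Fredholm theory. -/

section Fredholm

set_option linter.unusedSectionVars false

/-- The determinant `det ⟨a_i, b_j⟩` for a bilinear pairing. -/
def gramDet {H : Type*} [NormedAddCommGroup H] [NormedSpace ℂ H] (pair : H →L[ℂ] H →L[ℂ] ℂ)
    {ι : Type*} [Fintype ι] [DecidableEq ι] (a b : ι → H) : ℂ :=
  Matrix.det (Matrix.of fun i j => pair (a i) (b j))

section

variable {H : Type*} [NormedAddCommGroup H] [NormedSpace ℂ H]

theorem gramDet_update_add {ι : Type*} [Fintype ι] [DecidableEq ι]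
    (pair : H →L[ℂ] H →L[ℂ] ℂ) (a b : ι → H) (i : ι)
    (x y : H) : gramDet pair a (Function.update b i (x + y)) =
      gramDet pair a (Function.update b i x) + gramDet pair a (Function.update b i y) := by
  have h : ∀ x, (Matrix.of fun l j => pair (a l) (Function.update b i x j)) =
      (Matrix.of fun l j => pair (a l) (b j)).updateCol i (fun l => pair (a l) x) := by
    intro x
    ext l j
    by_cases hj : j = i
    · subst hj; simp
    · simp [hj]
  unfold gramDet
  rw [h, h, h, ← Matrix.det_updateCol_add]
  congr 2
  ext l
  simp

theorem gramDet_update_smul {ι : Type*} [Fintype ι] [DecidableEq ι]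
    (pair : H →L[ℂ] H →L[ℂ] ℂ) (a b : ι → H) (i : ι)
    (c : ℂ) (x : H) : gramDet pair a (Function.update b i (c • x)) =
      c * gramDet pair a (Function.update b i x) := by
  have h : ∀ x, (Matrix.of fun l j => pair (a l) (Function.update b i x j)) =
      (Matrix.of fun l j => pair (a l) (b j)).updateCol i (fun l => pair (a l) x) := by
    intro x
    ext l j
    by_cases hj : j = i
    · subst hj; simp
    · simp [hj]
  unfold gramDet
  rw [h, h, ← Matrix.det_updateCol_smul]
  congr 2
  ext l
  simp

theorem gramDet_swap {n : ℕ} (pair : H →L[ℂ] H →L[ℂ] ℂ) (a b : Fin n → H) {i j : Fin n}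
    (hij : i ≠ j) : gramDet pair a (b ∘ Equiv.swap i j) = -gramDet pair a b := by
  have := Matrix.det_permute' (Equiv.swap i j) (Matrix.of fun i j => pair (a i) (b j))
  rw [Equiv.Perm.sign_swap hij] at this
  simpa [gramDet, Matrix.submatrix] using this

theorem continuous_gramDet {ι : Type*} [Fintype ι] [DecidableEq ι]
    (pair : H →L[ℂ] H →L[ℂ] ℂ) :
    Continuous fun q : (ι → H) × (ι → H) => gramDet pair q.1 q.2 := by
  unfold gramDet
  refine Continuous.matrix_det (continuous_matrix fun i j => ?_)
  simp only [Matrix.of_apply]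
  fun_prop

theorem gramDet_cons {n : ℕ} (pair : H →L[ℂ] H →L[ℂ] ℂ) (a : Fin (n + 1) → H) (x : H)
    (b : Fin n → H) : gramDet pair a (Fin.cons x b : Fin (n + 1) → H) =
      ∑ i : Fin (n + 1), (-1) ^ (i : ℕ) * pair (a i) x *
        gramDet pair (a ∘ i.succAbove) b := by
  unfold gramDet
  rw [Matrix.det_succ_column_zero]
  rfl

theorem continuous_cons {X : Type*} [TopologicalSpace X] {n : ℕ} {f : X → H} {g : X → Fin n → H}
    (hf : Continuous f) (hg : Continuous g) :
    Continuous fun x => (Fin.cons (f x) (g x) : Fin (n + 1) → H) :=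
  continuous_pi fun i => by
    refine Fin.cases ?_ (fun i => ?_) i
    · simpa using hf
    · exact (continuous_apply i).comp hg

theorem cons_comp_swap {n : ℕ} {X : Type*} (x : X) (b : Fin n → X) (i j : Fin n) :
    (Fin.cons x (b ∘ Equiv.swap i j) : Fin (n + 1) → X) =
      (Fin.cons x b : Fin (n + 1) → X) ∘ Equiv.swap i.succ j.succ := by
  funext l
  refine Fin.cases ?_ (fun l => ?_) l
  · rw [Function.comp, Equiv.swap_apply_of_ne_of_ne (Fin.succ_ne_zero i).symm
      (Fin.succ_ne_zero j).symm]
    rfl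
  · rw [Fin.cons_succ, Function.comp, Function.comp,
      (Fin.succ_injective n).swap_apply, Fin.cons_succ]

end

/-- Currying makes f a continuous map into C(Ω, ℂ), on which integration is Lipschitz with constant
the total mass. -/
theorem continuous_integral_of_compact {Ω : Type*} [TopologicalSpace Ω]
    [MeasurableSpace Ω] [CompactSpace Ω] [OpensMeasurableSpace Ω] {X : Type*} [TopologicalSpace X] {μ : Measure Ω}
    [IsFiniteMeasure μ] {f : X → Ω → ℂ} (hf : Continuous f.uncurry) :
    Continuous fun x => ∫ z, f x z ∂μ := by
  have h1 : Continuous fun g : C(Ω, ℂ) => ∫ z, g z ∂μ := by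
    refine (LipschitzWith.of_dist_le_mul (K := μ.real Set.univ |>.toNNReal) fun g g' => ?_).continuous
    have hi : ∀ g : C(Ω, ℂ), Integrable (fun z => g z) μ := fun g =>
      g.continuous.integrable_of_hasCompactSupport (HasCompactSupport.of_compactSpace _)
    rw [dist_eq_norm, ← integral_sub (hi g) (hi g'), Real.coe_toNNReal _ measureReal_nonneg, mul_comm]
    refine norm_integral_le_of_norm_le_const (Eventually.of_forall fun z => ?_)
    rw [← dist_eq_norm]
    exact ContinuousMap.dist_apply_le_dist z
  exact h1.comp (ContinuousMap.curry ⟨f.uncurry, hf⟩).continuous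

/-- A pairing on `H` satisfying the Gram–Hadamard inequality, together with the data of a trace
class operator `∫ κ(z) ⟨s(z), ·⟩ t(z) dμ(z)`. -/
structure FredholmData (H Ω : Type*) [NormedAddCommGroup H] [NormedSpace ℂ H]
    [TopologicalSpace Ω] [MeasurableSpace Ω] where
  /-- the pairing -/
  pair : H →L[ℂ] H →L[ℂ] ℂ
  norm_gramDet_le : ∀ (n : ℕ) (a b : Fin n → H), ‖gramDet pair a b‖ ≤ (∏ i, ‖a i‖) * ∏ i, ‖b i‖
  /-- the measure -/
  μ : Measure Ω
  finite : IsFiniteMeasure μ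
  /-- the density -/
  κ : C(Ω, ℂ)
  /-- the left vectors -/
  s : C(Ω, H)
  /-- the right vectors -/
  t : C(Ω, H)

variable {H Ω : Type*} [NormedAddCommGroup H] [NormedSpace ℂ H]
  [TopologicalSpace Ω] [MeasurableSpace Ω]

namespace FredholmData

variable (P : FredholmData H Ω)

instance : IsFiniteMeasure P.μ := P.finite

/-- The determinant of `a, b` together with `p` pairs `s(z), t(z)` that are integrated over. -/
def minor : ℕ → ∀ {n : ℕ}, (Fin n → H) → (Fin n → H) → ℂ
  | 0, _, a, b => gramDet P.pair a b
  | p + 1, n, a, b => ∫ z, P.κ z *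
      minor p (Fin.cons (P.s z) a : Fin (n + 1) → H) (Fin.cons (P.t z) b : Fin (n + 1) → H) ∂P.μ

theorem minor_zero {n : ℕ} (a b : Fin n → H) : P.minor 0 a b = gramDet P.pair a b := rfl

theorem minor_succ (p : ℕ) {n : ℕ} (a b : Fin n → H) :
    P.minor (p + 1) a b = ∫ z, P.κ z *
      P.minor p (Fin.cons (P.s z) a : Fin (n + 1) → H) (Fin.cons (P.t z) b : Fin (n + 1) → H) ∂P.μ :=
  rfl

variable [CompactSpace Ω] [OpensMeasurableSpace Ω]

/-- Joint continuity in all vectors is what the induction needs, since the vectors integrated at one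
level are ordinary arguments at the level below. All later integrability rests on it. -/
theorem continuous_minor (p : ℕ) {n : ℕ} :
    Continuous fun q : (Fin n → H) × (Fin n → H) => P.minor p q.1 q.2 := by
  induction p generalizing n with
  | zero => exact continuous_gramDet P.pair
  | succ p ih =>
    refine continuous_integral_of_compact (f := fun (q : (Fin n → H) × (Fin n → H)) z => P.κ z *
      P.minor p (Fin.cons (P.s z) q.1 : Fin (n + 1) → H)
        (Fin.cons (P.t z) q.2 : Fin (n + 1) → H)) ?_
    refine (P.κ.continuous.comp continuous_snd).mul (ih.comp (Continuous.prodMk ?_ ?_))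
    · exact continuous_cons (P.s.continuous.comp continuous_snd)
        (continuous_fst.comp continuous_fst)
    · exact continuous_cons (P.t.continuous.comp continuous_snd)
        (continuous_snd.comp continuous_fst)

theorem continuous_integrand (p : ℕ) {n : ℕ} (a b : Fin n → H) :
    Continuous fun z => P.κ z *
      P.minor p (Fin.cons (P.s z) a : Fin (n + 1) → H) (Fin.cons (P.t z) b : Fin (n + 1) → H) := by
  refine P.κ.continuous.mul ((P.continuous_minor p).comp (Continuous.prodMk ?_ ?_))
  · exact continuous_cons P.s.continuous continuous_const
  · exact continuous_cons P.t.continuous continuous_const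

theorem integrable_of_continuous {f : Ω → ℂ} (hf : Continuous f) : Integrable f P.μ :=
  hf.integrable_of_hasCompactSupport (HasCompactSupport.of_compactSpace _)

theorem minor_update_add (p : ℕ) {n : ℕ} (a b : Fin n → H) (i : Fin n) (x y : H) :
    P.minor p a (Function.update b i (x + y)) =
      P.minor p a (Function.update b i x) + P.minor p a (Function.update b i y) := by
  induction p generalizing n with
  | zero => exact gramDet_update_add P.pair a b i x y
  | succ p ih =>
    simp only [minor_succ]
    rw [← integral_add (P.integrable_of_continuous (P.continuous_integrand p _ _))
      (P.integrable_of_continuous (P.continuous_integrand p _ _))]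
    refine integral_congr_ae (Eventually.of_forall fun z => ?_)
    simp only [Fin.cons_update, ih, mul_add]

theorem minor_update_smul (p : ℕ) {n : ℕ} (a b : Fin n → H) (i : Fin n) (c : ℂ) (x : H) :
    P.minor p a (Function.update b i (c • x)) = c * P.minor p a (Function.update b i x) := by
  induction p generalizing n with
  | zero => exact gramDet_update_smul P.pair a b i c x
  | succ p ih =>
    simp only [minor_succ]
    rw [← integral_const_mul]
    refine integral_congr_ae (Eventually.of_forall fun z => ?_)
    simp only [Fin.cons_update, ih, mul_left_comm]

theorem minor_swap (p : ℕ) {n : ℕ} (a b : Fin n → H) {i j : Fin n} (hij : i ≠ j) :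
    P.minor p a (b ∘ Equiv.swap i j) = -P.minor p a b := by
  induction p generalizing n with
  | zero => exact gramDet_swap P.pair a b hij
  | succ p ih =>
    simp only [minor_succ]
    rw [← integral_neg]
    refine integral_congr_ae (Eventually.of_forall fun z => ?_)
    have := ih (Fin.cons (P.s z) a : Fin (n + 1) → H) (Fin.cons (P.t z) b)
      (fun e => hij (Fin.succ_injective n e))
    simp only [cons_comp_swap, this, mul_neg]

theorem minor_cons_cons (p : ℕ) {n : ℕ} (a : Fin (n + 2) → H) (x y : H) (b : Fin n → H) :
    P.minor p a (Fin.cons x (Fin.cons y b : Fin (n + 1) → H) : Fin (n + 2) → H) =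
      -P.minor p a (Fin.cons y (Fin.cons x b : Fin (n + 1) → H) : Fin (n + 2) → H) := by
  rw [← P.minor_swap p a _ (i := 0) (j := 1) (by simp)]
  congr 1
  funext l
  refine Fin.cases ?_ (fun l => Fin.cases ?_ (fun l => ?_) l) l
  · simp only [Function.comp, Equiv.swap_apply_left]
    rfl
  · change _ = (Fin.cons y (Fin.cons x b : Fin (n + 1) → H) : Fin (n + 2) → H) (Equiv.swap 0 1 1)
    rw [Equiv.swap_apply_right]
    rfl
  · have : Equiv.swap (0 : Fin (n + 2)) 1 l.succ.succ = l.succ.succ :=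
      Equiv.swap_apply_of_ne_of_ne (Fin.succ_ne_zero _) (fun e => by
        have := congrArg Fin.val e
        simp at this)
    simp only [Function.comp, this, Fin.cons_succ]

/-- `P.minor p a (cons x b)` as a continuous linear functional of `x`. -/
def minorL (p : ℕ) {n : ℕ} (a : Fin (n + 1) → H) (b : Fin n → H) : H →L[ℂ] ℂ where
  toFun x := P.minor p a (Fin.cons x b : Fin (n + 1) → H)
  map_add' x y := by
    have := P.minor_update_add p a (Fin.cons 0 b : Fin (n + 1) → H) 0 x y
    simpa only [Fin.update_cons_zero] using this
  map_smul' c x := by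
    have := P.minor_update_smul p a (Fin.cons 0 b : Fin (n + 1) → H) 0 c x
    simpa only [Fin.update_cons_zero, RingHom.id_apply, smul_eq_mul] using this
  cont := (P.continuous_minor p).comp (continuous_const.prodMk
    (continuous_cons continuous_id continuous_const))

theorem minorL_apply (p : ℕ) {n : ℕ} (a : Fin (n + 1) → H) (b : Fin n → H) (x : H) :
    P.minorL p a b x = P.minor p a (Fin.cons x b : Fin (n + 1) → H) := rfl

/-- The factor gained by each integration. -/
def bound : ℝ := ‖P.κ‖ * ‖P.s‖ * ‖P.t‖ * P.μ.real Set.univ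

theorem bound_nonneg : 0 ≤ P.bound := by
  unfold bound
  positivity

/-- Gram–Hadamard is applied to the full determinant of size n + p before integrating, so no p!
appears. With the weights 1 / p! the Fredholm series then converges for every K, however large. -/
theorem norm_minor_le (p : ℕ) {n : ℕ} (a b : Fin n → H) :
    ‖P.minor p a b‖ ≤ P.bound ^ p * ((∏ i, ‖a i‖) * ∏ i, ‖b i‖) := by
  induction p generalizing n with
  | zero => simpa [minor_zero] using P.norm_gramDet_le n a b
  | succ p ih =>
    have hb := P.bound_nonneg
    have : ∀ z, ‖P.κ z * P.minor p (Fin.cons (P.s z) a : Fin (n + 1) → H)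
        (Fin.cons (P.t z) b : Fin (n + 1) → H)‖ ≤
        ‖P.κ‖ * (P.bound ^ p * ((‖P.s‖ * ∏ i, ‖a i‖) * (‖P.t‖ * ∏ i, ‖b i‖))) := by
      intro z
      rw [norm_mul]
      refine mul_le_mul (P.κ.norm_coe_le_norm z) ((ih _ _).trans ?_) (norm_nonneg _) (norm_nonneg _)
      simp only [Fin.prod_univ_succ, Fin.cons_zero, Fin.cons_succ]
      gcongr
      · exact P.s.norm_coe_le_norm z
      · exact P.t.norm_coe_le_norm z
    refine (norm_integral_le_of_norm_le_const (Eventually.of_forall this)).trans (le_of_eq ?_)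
    unfold bound
    ring

/-- The operator `M` is `∫ κ(z) ⟨s(z), ·⟩ t(z) dμ(z)`. -/
def Represents (M : H →L[ℂ] H) : Prop :=
  ∀ (f : H →L[ℂ] ℂ) (x : H), ∫ z, P.κ z * (P.pair (P.s z) x * f (P.t z)) ∂P.μ = f (M x)

/-- Fredholm's recursion: the determinant is expanded along the column of x. A row a i leaves a
smaller minor. Each of the p integrated rows s z also pairs with x, and integrating over its z turns
the column t z into M x, with a minus sign from exchanging two columns. -/
theorem minor_cons {M : H →L[ℂ] H} (hM : P.Represents M) (p : ℕ) {n : ℕ} (a : Fin (n + 1) → H)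
    (x : H) (b : Fin n → H) :
    P.minor p a (Fin.cons x b : Fin (n + 1) → H) =
      ∑ i : Fin (n + 1), (-1) ^ (i : ℕ) * P.pair (a i) x * P.minor p (a ∘ i.succAbove) b -
        p * P.minor (p - 1) a (Fin.cons (M x) b : Fin (n + 1) → H) := by
  induction p generalizing n with
  | zero =>
    simp only [minor_zero, Nat.cast_zero, zero_mul, sub_zero]
    exact gramDet_cons P.pair a x b
  | succ p ih =>
    have key : ∀ z, P.κ z * P.minor p (Fin.cons (P.s z) a : Fin (n + 2) → H)
        (Fin.cons (P.t z) (Fin.cons x b : Fin (n + 1) → H) : Fin (n + 2) → H) =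
        ∑ i : Fin (n + 1), (-1) ^ (i : ℕ) * P.pair (a i) x * (P.κ z *
          P.minor p (Fin.cons (P.s z) (a ∘ i.succAbove) : Fin (n + 1) → H)
            (Fin.cons (P.t z) b : Fin (n + 1) → H)) -
        P.κ z * (P.pair (P.s z) x * P.minorL p a b (P.t z)) -
        p * (P.κ z * P.minor (p - 1) (Fin.cons (P.s z) a : Fin (n + 2) → H)
          (Fin.cons (P.t z) (Fin.cons (M x) b : Fin (n + 1) → H) : Fin (n + 2) → H)) := by
      intro z
      -- The column x is exchanged with t z so as to stand first, and the induction hypothesis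
      -- expands along it. Row 0 is now s z; in the last term M x is exchanged back behind t z.
      rw [minor_cons_cons, ih, Fin.sum_univ_succ, P.minor_cons_cons (p - 1)]
      have e1 : (Fin.cons (P.s z) a : Fin (n + 2) → H) ∘ (0 : Fin (n + 2)).succAbove = a := by
        funext l; simp
      have e2 : ∀ i : Fin (n + 1), (Fin.cons (P.s z) a : Fin (n + 2) → H) ∘ i.succ.succAbove =
          (Fin.cons (P.s z) (a ∘ i.succAbove) : Fin (n + 1) → H) := by
        intro i
        funext l
        refine Fin.cases ?_ (fun l => ?_) l
        · simp
        · simp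
      simp only [e1, e2, Fin.cons_zero, Fin.cons_succ, Fin.val_zero, Fin.val_succ, pow_zero, one_mul,
        minorL_apply, pow_succ]
      rw [show ∑ i : Fin (n + 1), (-1 : ℂ) ^ (i : ℕ) * -1 * P.pair (a i) x *
            P.minor p (Fin.cons (P.s z) (a ∘ i.succAbove) : Fin (n + 1) → H)
              (Fin.cons (P.t z) b : Fin (n + 1) → H) =
          -∑ i : Fin (n + 1), (-1 : ℂ) ^ (i : ℕ) * P.pair (a i) x *
            P.minor p (Fin.cons (P.s z) (a ∘ i.succAbove) : Fin (n + 1) → H)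
              (Fin.cons (P.t z) b : Fin (n + 1) → H) by
        rw [← Finset.sum_neg_distrib]
        exact Finset.sum_congr rfl fun i _ => by ring]
      rw [show ∑ i : Fin (n + 1), (-1 : ℂ) ^ (i : ℕ) * P.pair (a i) x * (P.κ z *
            P.minor p (Fin.cons (P.s z) (a ∘ i.succAbove) : Fin (n + 1) → H)
              (Fin.cons (P.t z) b : Fin (n + 1) → H)) =
          P.κ z * ∑ i : Fin (n + 1), (-1 : ℂ) ^ (i : ℕ) * P.pair (a i) x *
            P.minor p (Fin.cons (P.s z) (a ∘ i.succAbove) : Fin (n + 1) → H)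
              (Fin.cons (P.t z) b : Fin (n + 1) → H) by
        rw [Finset.mul_sum]
        exact Finset.sum_congr rfl fun i _ => by ring]
      ring
    have i1 : Integrable (fun z => ∑ i : Fin (n + 1), (-1) ^ (i : ℕ) * P.pair (a i) x * (P.κ z *
          P.minor p (Fin.cons (P.s z) (a ∘ i.succAbove) : Fin (n + 1) → H)
            (Fin.cons (P.t z) b : Fin (n + 1) → H))) P.μ :=
      integrable_finsetSum _ fun i _ =>
        (P.integrable_of_continuous (P.continuous_integrand p _ _)).const_mul _
    have i2 : Integrable (fun z => P.κ z * (P.pair (P.s z) x * P.minorL p a b (P.t z))) P.μ :=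
      P.integrable_of_continuous (by fun_prop)
    have i3 : Integrable (fun z => (p : ℂ) * (P.κ z *
        P.minor (p - 1) (Fin.cons (P.s z) a : Fin (n + 2) → H)
          (Fin.cons (P.t z) (Fin.cons (M x) b : Fin (n + 1) → H) : Fin (n + 2) → H))) P.μ :=
      (P.integrable_of_continuous (P.continuous_integrand (p - 1) _ _)).const_mul _
    -- For p = 0 the truncated p - 1 is harmless, because of the prefactor p.
    have h3 : (p : ℂ) * P.minor (p - 1 + 1) a (Fin.cons (M x) b : Fin (n + 1) → H) =
        p * P.minor p a (Fin.cons (M x) b : Fin (n + 1) → H) := by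
      rcases p with _ | p
      · simp
      · simp
    rw [minor_succ]
    simp only [key]
    -- The term of row s z integrates to M x by `Represents` for the functional `minorL`. It
    -- supplies the 1 in p + 1; the induction hypothesis supplies the p.
    rw [integral_sub (by exact i1.sub i2) i3, integral_sub i1 i2, hM, integral_const_mul, ← minor_succ, h3,
      integral_finsetSum _ fun i _ =>
        (P.integrable_of_continuous (P.continuous_integrand p _ _)).const_mul _]
    simp only [integral_const_mul, ← minor_succ, minorL_apply, Nat.add_sub_cancel, Nat.cast_succ]
    ring

/-- The Fredholm minors, `j` further pairs being integrated over. -/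
def series (j : ℕ) {n : ℕ} (a b : Fin n → H) : ℂ :=
  ∑' p : ℕ, (-1) ^ p / (p ! : ℂ) * P.minor (p + j) a b

theorem norm_series_term_le (p j : ℕ) {n : ℕ} (a b : Fin n → H) :
    ‖(-1) ^ p / (p ! : ℂ) * P.minor (p + j) a b‖ ≤
      (P.bound ^ p / p !) * (P.bound ^ j * ((∏ i, ‖a i‖) * ∏ i, ‖b i‖)) := by
  have h1 : ‖(-1) ^ p / (p ! : ℂ)‖ = 1 / p ! := by simp
  rw [norm_mul, h1]
  refine (mul_le_mul_of_nonneg_left (P.norm_minor_le _ a b) (by positivity)).trans (le_of_eq ?_)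
  ring

theorem summable_norm_series (j : ℕ) {n : ℕ} (a b : Fin n → H) :
    Summable fun p : ℕ => ‖(-1) ^ p / (p ! : ℂ) * P.minor (p + j) a b‖ :=
  Summable.of_nonneg_of_le (fun _ => norm_nonneg _) (fun p => P.norm_series_term_le p j a b)
    ((Real.summable_pow_div_factorial P.bound).mul_right _)

theorem hasSum_series (j : ℕ) {n : ℕ} (a b : Fin n → H) :
    HasSum (fun p : ℕ => (-1) ^ p / (p ! : ℂ) * P.minor (p + j) a b) (P.series j a b) :=
  (P.summable_norm_series j a b).of_norm.hasSum

/-- In the sum over p with weights (-1)^p / p!, the last terms of `minor_cons` reproduce, after a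
shift of p by one, the series with M x in place of x. Carried to the left it turns the column x into
x - M x, and a pure Laplace expansion remains. -/
theorem series_cons_sub {M : H →L[ℂ] H} (hM : P.Represents M) {n : ℕ} (a : Fin (n + 1) → H)
    (x : H) (b : Fin n → H) :
    P.series 0 a (Fin.cons (x - M x) b : Fin (n + 1) → H) =
      ∑ i : Fin (n + 1), (-1) ^ (i : ℕ) * P.pair (a i) x * P.series 0 (a ∘ i.succAbove) b := by
  have h1 : HasSum (fun p : ℕ => (-1) ^ p / (p ! : ℂ) * (p *
      P.minor (p - 1) a (Fin.cons (M x) b : Fin (n + 1) → H)))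
      (-P.series 0 a (Fin.cons (M x) b : Fin (n + 1) → H)) := by
    rw [← hasSum_nat_add_iff' 1]
    simp only [Finset.range_one, Finset.sum_singleton, Nat.cast_zero, zero_mul, mul_zero, sub_zero]
    refine (P.hasSum_series 0 a _).neg.congr_fun fun p => ?_
    have : (p ! : ℂ) ≠ 0 := by exact_mod_cast p.factorial_ne_zero
    have : (p + 1 : ℂ) ≠ 0 := by exact_mod_cast Nat.succ_ne_zero p
    simp only [Nat.add_sub_cancel, Nat.factorial_succ, Nat.cast_mul, Nat.cast_succ, add_zero,
      pow_succ]
    field_simp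
  have h2 : HasSum (fun p : ℕ => ∑ i : Fin (n + 1), (-1) ^ (i : ℕ) * P.pair (a i) x *
      ((-1) ^ p / (p ! : ℂ) * P.minor (p + 0) (a ∘ i.succAbove) b))
      (∑ i : Fin (n + 1), (-1) ^ (i : ℕ) * P.pair (a i) x * P.series 0 (a ∘ i.succAbove) b) :=
    hasSum_sum fun i _ => (P.hasSum_series 0 _ b).mul_left _
  have h3 := (h2.sub h1).sub (P.hasSum_series 0 a (Fin.cons (M x) b : Fin (n + 1) → H))
  rw [sub_neg_eq_add, add_sub_cancel_right] at h3
  refine (P.hasSum_series 0 a _).unique (h3.congr_fun fun p => ?_)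
  have h4 : P.minor p a (Fin.cons (x - M x) b : Fin (n + 1) → H) =
      P.minor p a (Fin.cons x b : Fin (n + 1) → H) -
        P.minor p a (Fin.cons (M x) b : Fin (n + 1) → H) := map_sub (P.minorL p a b) x (M x)
  simp only [add_zero]
  rw [h4, P.minor_cons hM p a x b, mul_sub, mul_sub, Finset.mul_sum]
  congr 2
  exact Finset.sum_congr rfl fun i _ => by ring

/-- The Fredholm minors are the Fredholm determinant times the minors of the resolvent. -/
theorem series_eq {M B : H →L[ℂ] H} (hM : P.Represents M) (hB : ∀ x, B x - M (B x) = x) {n : ℕ}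
    (a b : Fin n → H) :
    P.series 0 a b = P.series 0 (Fin.elim0 : Fin 0 → H) Fin.elim0 * gramDet P.pair a (B ∘ b) := by
  induction n with
  | zero =>
    obtain rfl : a = Fin.elim0 := Subsingleton.elim _ _
    obtain rfl : b = Fin.elim0 := Subsingleton.elim _ _
    simp [gramDet]
  | succ n ih =>
    -- Since B is a right inverse of 1 - M, the first column has the form x - M x with x = B (b 0),
    -- so `series_cons_sub` removes it exactly as Laplace expansion removes the first column of det
    -- ⟨a_i, B b_j⟩.
    have h1 : b = Fin.cons (B (b 0) - M (B (b 0))) (Fin.tail b) := by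
      rw [hB, Fin.cons_self_tail]
    have h2 : B ∘ b = Fin.cons (B (b 0)) (B ∘ Fin.tail b) := by
      funext l
      refine Fin.cases rfl (fun l => rfl) l
    rw [h2, gramDet_cons, Finset.mul_sum]
    conv_lhs => rw [h1]
    rw [P.series_cons_sub hM]
    refine Finset.sum_congr rfl fun i _ => ?_
    rw [ih]
    ring

/-- Sum and integral are exchanged, the terms being dominated by an exponential series. The identity
passes vanishing from `series j` for all vectors to `series (j + 1)`. -/
theorem series_succ (j : ℕ) {n : ℕ} (a b : Fin n → H) :
    P.series (j + 1) a b = ∫ z, P.κ z *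
      P.series j (Fin.cons (P.s z) a : Fin (n + 1) → H) (Fin.cons (P.t z) b : Fin (n + 1) → H) ∂P.μ := by
  have h1 := hasSum_integral_of_summable_integral_norm (μ := P.μ) (F := fun p z => P.κ z *
    ((-1) ^ p / (p ! : ℂ) * P.minor (p + j) (Fin.cons (P.s z) a : Fin (n + 1) → H)
      (Fin.cons (P.t z) b : Fin (n + 1) → H))) (fun p => ?_) ?_
  · simp only [tsum_mul_left] at h1
    refine (P.hasSum_series (j + 1) a b).unique (h1.congr_fun fun p => ?_)
    rw [← add_assoc, minor_succ, ← integral_const_mul]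
    refine integral_congr_ae (Eventually.of_forall fun z => ?_)
    exact mul_left_comm _ _ _
  · simpa only [mul_left_comm] using
      (P.integrable_of_continuous (P.continuous_integrand (p + j) a b)).const_mul _
  · refine Summable.of_nonneg_of_le (fun p => integral_nonneg fun z => norm_nonneg _) (fun p => ?_)
      (((Real.summable_pow_div_factorial P.bound).mul_right (‖P.κ‖ * (P.bound ^ j *
        ((‖P.s‖ * ∏ i, ‖a i‖) * (‖P.t‖ * ∏ i, ‖b i‖))))).mul_right (P.μ.real Set.univ))
    have h2 : ∀ z, ‖P.κ z * ((-1) ^ p / (p ! : ℂ) *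
        P.minor (p + j) (Fin.cons (P.s z) a : Fin (n + 1) → H)
          (Fin.cons (P.t z) b : Fin (n + 1) → H))‖ ≤ (P.bound ^ p / p !) * (‖P.κ‖ * (P.bound ^ j *
        ((‖P.s‖ * ∏ i, ‖a i‖) * (‖P.t‖ * ∏ i, ‖b i‖)))) := by
      intro z
      have hb := P.bound_nonneg
      rw [norm_mul, mul_left_comm (P.bound ^ p / _)]
      refine mul_le_mul (P.κ.norm_coe_le_norm z) ((P.norm_series_term_le p j _ _).trans ?_)
        (norm_nonneg _) (norm_nonneg _)
      simp only [Fin.prod_univ_succ, Fin.cons_zero, Fin.cons_succ]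
      gcongr
      · exact P.s.norm_coe_le_norm z
      · exact P.t.norm_coe_le_norm z
    refine (le_abs_self _).trans ?_
    rw [← Real.norm_eq_abs]
    exact norm_integral_le_of_norm_le_const (Eventually.of_forall fun z => by
      rw [norm_norm]; exact h2 z)

/-- The Fredholm determinant does not vanish if `1 - M` has a right inverse. -/
theorem series_ne_zero {M B : H →L[ℂ] H} (hM : P.Represents M) (hB : ∀ x, B x - M (B x) = x) :
    P.series 0 (Fin.elim0 : Fin 0 → H) Fin.elim0 ≠ 0 := by
  -- Put f(t) = ∑ t^p e_p / p!, whose j-th derivative at -1 is `series j` without vectors. If f(-1)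
  -- = 0, then all minors `series 0 a b` vanish by `series_eq`, and by integration so does every
  -- derivative of f at -1. The Taylor double sum for f(0) about -1 is then evaluated in two ways:
  -- by rows it is 0, along antidiagonals it is e_0 = 1.
  intro h0
  have h1 : ∀ (j : ℕ) {n : ℕ} (a b : Fin n → H), P.series j a b = 0 := by
    intro j
    induction j with
    | zero => intro n a b; rw [P.series_eq hM hB, h0, zero_mul]
    | succ j ih => intro n a b; simp [series_succ, ih]
  set e : ℕ → ℂ := fun m => P.minor m (Fin.elim0 : Fin 0 → H) Fin.elim0 with he
  have hb := P.bound_nonneg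
  have hnorm : ∀ m, ‖e m‖ ≤ P.bound ^ m := fun m => by
    simpa using P.norm_minor_le m (Fin.elim0 : Fin 0 → H) Fin.elim0
  have hs : Summable fun q : ℕ × ℕ => (1 / (q.1 ! : ℂ)) * ((-1) ^ q.2 / (q.2 ! : ℂ) * e (q.2 + q.1)) := by
    refine Summable.of_norm_bounded (g := fun q : ℕ × ℕ => (P.bound ^ q.1 / q.1 !) *
      (P.bound ^ q.2 / q.2 !)) ((Real.summable_pow_div_factorial P.bound).mul_of_nonneg
        (Real.summable_pow_div_factorial P.bound) (fun _ => by positivity) fun _ => by positivity)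
      fun q => ?_
    have := hnorm (q.2 + q.1)
    simp only [norm_mul, norm_div, norm_one, norm_pow, norm_neg, one_pow, Complex.norm_natCast]
    calc 1 / (q.1 ! : ℝ) * (1 / (q.2 ! : ℝ) * ‖e (q.2 + q.1)‖)
        ≤ 1 / (q.1 ! : ℝ) * (1 / (q.2 ! : ℝ) * P.bound ^ (q.2 + q.1)) := by gcongr
      _ = _ := by rw [pow_add]; ring
  have h2 : ∑' q : ℕ × ℕ, (1 / (q.1 ! : ℂ)) * ((-1) ^ q.2 / (q.2 ! : ℂ) * e (q.2 + q.1)) = 0 := by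
    rw [hs.tsum_prod]
    simp only [tsum_mul_left]
    refine (tsum_congr fun j => ?_).trans tsum_zero
    rw [show ∑' p : ℕ, ((-1) ^ p / (p ! : ℂ) * e (p + j)) = 0 from h1 j _ _, mul_zero]
  have h3 : ∑' q : ℕ × ℕ, (1 / (q.1 ! : ℂ)) * ((-1) ^ q.2 / (q.2 ! : ℂ) * e (q.2 + q.1)) = e 0 := by
    rw [← Finset.HasAntidiagonal.sigmaAntidiagonalEquivProd.tsum_eq (_ : ℕ × ℕ → ℂ)]
    refine ((Finset.HasAntidiagonal.sigmaAntidiagonalEquivProd.summable_iff.2 hs).tsum_sigma'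
        fun m => (hasSum_fintype _).summable).trans ?_
    -- On an antidiagonal the factorials combine to a binomial expansion of (1 - 1)^m, so only m = 0
    -- survives.
    have h5 : ∀ m : ℕ, ∑' q : Finset.HasAntidiagonal.antidiagonal m,
        (1 / (q.1.1 ! : ℂ)) * ((-1) ^ q.1.2 / (q.1.2 ! : ℂ) * e (q.1.2 + q.1.1)) =
        e m / m ! * (1 + -1) ^ m := by
      intro m
      rw [tsum_fintype, (Commute.all (1 : ℂ) (-1)).add_pow' m, Finset.mul_sum,
        Finset.sum_coe_sort (Finset.HasAntidiagonal.antidiagonal m) fun q : ℕ × ℕ =>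
          (1 / (q.1 ! : ℂ)) * ((-1) ^ q.2 / (q.2 ! : ℂ) * e (q.2 + q.1))]
      refine Finset.sum_congr rfl fun q hq => ?_
      obtain rfl := Finset.HasAntidiagonal.mem_antidiagonal.1 hq
      have hf : ∀ n : ℕ, (n ! : ℂ) ≠ 0 := fun n => by exact_mod_cast n.factorial_ne_zero
      have := hf q.1
      have := hf q.2
      have := hf (q.1 + q.2)
      have hc : ((q.1 + q.2).choose q.1 : ℂ) * q.1 ! * q.2 ! = (q.1 + q.2)! := by
        rw [Nat.choose_symm_add]; exact_mod_cast Nat.add_choose_mul_factorial_mul_factorial q.1 q.2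
      rw [← hc, add_comm q.2, nsmul_eq_mul, one_pow, one_mul]
      rw [← hc] at this
      have : ((q.1 + q.2).choose q.1 : ℂ) ≠ 0 := fun h => this (by rw [h]; ring)
      field_simp
    refine (tsum_congr h5).trans ?_
    rw [tsum_eq_single 0 fun m hm => by simp [hm]]
    simp
  have h4 : e 0 = 1 := by simp [he, minor_zero, gramDet]
  rw [h3, h4] at h2
  exact one_ne_zero h2

end FredholmData

end Fredholm

/-! ### Completeness of 𝒞_k, and determination of its elements by their values. -/

section CkSpace

variable {d r k : ℕ} {ℓ : ℝ} [Fact (0 < ℓ)]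
variable {V W : Type} [Fintype V] [DecidableEq V] [Fintype W] [DecidableEq W]
variable {E : Type} [NormedAddCommGroup E] [NormedSpace ℂ E]

/-- Derivatives pass to the limit when functions and derivatives converge uniformly. The resulting
completeness is needed for the series in `hasSum_contraction` and for the 𝒞_k-valued integral in
`commutes_formKern`. -/
theorem isClosed_ckSubmodule : 
    IsClosed (ckSubmodule d r k ℓ V E : Set ((V → MultiIdx d k) → C(V → Pt d r ℓ, E))) := by
  refine isClosed_of_closure_subset fun D hD => ?_
  obtain ⟨u, hu, hlim⟩ := mem_closure_iff_seq_limit.1 hD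
  intro v μ α α' h x
  have hunif : ∀ β : V → MultiIdx d k,
      TendstoUniformly (fun n t => u n β (shift v μ t x)) (fun t : ℝ => D β (shift v μ t x)) atTop := by
    intro β
    exact (ContinuousMap.tendsto_iff_tendstoUniformly.1
      ((continuous_apply β).continuousAt.tendsto.comp hlim)).comp fun t : ℝ => shift v μ t x
  have := hasDerivAt_of_tendstoUniformly (hunif α')
    (Eventually.of_forall fun n t => Ck.hasDerivAt (⟨u n, hu n⟩ : Ck d r k ℓ V E) h x t)
    (fun t => (hunif α).tendsto_at t) 0
  have h0 : shift v μ 0 x = x := by simp [shift]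
  simpa only [h0] using this

instance [CompleteSpace E] : CompleteSpace (Ck d r k ℓ V E) := by
  have h : CompleteSpace C(V → Pt d r ℓ, E) := inferInstance
  have : CompleteSpace ((V → MultiIdx d k) → C(V → Pt d r ℓ, E)) := Pi.complete _
  exact (isClosed_ckSubmodule (d := d) (r := r) (k := k) (ℓ := ℓ) (V := V) (E := E)).completeSpace_coe

/-- A derivative at a point as a continuous linear map. -/
def Ck.derivL (α : V → MultiIdx d k) (x : V → Pt d r ℓ) : Ck d r k ℓ V E →L[ℂ] E :=
  LinearMap.mkContinuous
    { toFun := fun f => f.1 α x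
      map_add' := fun _ _ => rfl
      map_smul' := fun _ _ => rfl } 1
    (fun f => by rw [one_mul]; exact Ck.norm_apply_le f _ x)

theorem Ck.derivL_apply (α : V → MultiIdx d k) (x : V → Pt d r ℓ) (f : Ck d r k ℓ V E) :
    Ck.derivL α x f = f.1 α x := rfl

/-- A function in `𝒞_k` is determined by its values. -/
theorem Ck.ext_eval {f g : Ck d r k ℓ V E} (h : ∀ x, f.eval x = g.eval x) : f = g := by
  -- Induction on the total order of α: a nonzero α is an increment of some α₀ of order one less,
  -- and the derivative of a function of one real variable is unique.
  have key : ∀ (N : ℕ) (α : V → MultiIdx d k), ∑ v, ∑ μ, ((α v).1 μ : ℕ) = N →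
      ∀ x, f.1 α x = g.1 α x := by
    intro N
    induction N with
    | zero =>
      intro α hα x
      have : α = fun _ => 0 := by
        funext v
        refine Subtype.ext (funext fun μ => Fin.ext ?_)
        simp only [Finset.sum_eq_zero_iff, Finset.mem_univ, true_implies] at hα
        exact hα v μ
      rw [this]
      exact h x
    | succ N ih =>
      intro α hα x
      obtain ⟨v, μ, hv⟩ : ∃ v μ, ((α v).1 μ : ℕ) ≠ 0 := by
        by_contra! hc
        simp [hc] at hα
      let β : Fin d → Fin (k + 1) := Function.update (α v).1 μ
        ⟨((α v).1 μ : ℕ) - 1, lt_of_le_of_lt (Nat.sub_le _ _) ((α v).1 μ).2⟩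
      have hβ : ∀ ν, ((α v).1 ν : ℕ) = (β ν : ℕ) + if ν = μ then 1 else 0 := by
        intro ν
        by_cases hν : ν = μ
        · subst hν
          simp [β]
          omega
        · simp [β, hν]
      let α₀ : V → MultiIdx d k := Function.update α v ⟨β, by
        refine le_trans (Finset.sum_le_sum fun ν _ => ?_) (α v).2
        rw [hβ ν]
        exact Nat.le_add_right _ _⟩
      have hincr : IsIncr v μ α₀ α := by
        intro w ν
        by_cases hw : w = v
        · subst hw
          simpa [α₀] using hβ ν
        · simp [α₀, hw]
      have hN : ∑ v, ∑ μ, ((α₀ v).1 μ : ℕ) = N := by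
        have e : ∑ v, ∑ μ, ((α v).1 μ : ℕ) = ∑ v, ∑ μ, ((α₀ v).1 μ : ℕ) + 1 := by
          rw [Finset.sum_congr rfl fun w _ => Finset.sum_congr rfl fun ν _ => hincr w ν]
          simp only [Finset.sum_add_distrib]
          congr 1
          rw [Finset.sum_eq_single v, Finset.sum_eq_single μ] <;> simp +contextual
        omega
      have hf := f.2 v μ α₀ α hincr x
      have hg := g.2 v μ α₀ α hincr x
      simp only [ih α₀ hN] at hf
      exact hf.unique hg
  exact Ck.ext' fun α x => key _ α rfl x

end CkSpace

/-! ### Gram determinants as elements of 𝒞_k. -/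

section GramCk

set_option linter.unusedSectionVars false

variable {H : Type*} [NormedAddCommGroup H] [NormedSpace ℂ H]
variable {ι ι' : Type*} [Fintype ι] [DecidableEq ι] [Fintype ι'] [DecidableEq ι']

theorem gramDet_equiv (pair : H →L[ℂ] H →L[ℂ] ℂ) {a b : ι → H} {a' b' : ι' → H} (e : ι ≃ ι')
    (ha : ∀ i, a i = a' (e i)) (hb : ∀ i, b i = b' (e i)) :
    gramDet pair a b = gramDet pair a' b' := by
  unfold gramDet
  rw [← Matrix.det_submatrix_equiv_self e (Matrix.of fun i j => pair (a' i) (b' j))]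
  congr 1
  ext i j
  simp [ha, hb]

theorem gramDet_flip (pair : H →L[ℂ] H →L[ℂ] ℂ) (a b : ι → H) :
    gramDet pair.flip b a = gramDet pair a b := by
  unfold gramDet
  rw [← Matrix.det_transpose]
  rfl

theorem gramDet_perm (pair : H →L[ℂ] H →L[ℂ] ℂ) (a b : ι → H) (σ τ : Equiv.Perm ι) :
    gramDet pair (a ∘ σ) (b ∘ τ) =
      ((Equiv.Perm.sign σ * Equiv.Perm.sign τ : ℤˣ) : ℤ) * gramDet pair a b := by
  have h1 := Matrix.det_permute σ (Matrix.of fun i j => pair (a i) (b (τ j)))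
  have h2 := Matrix.det_permute' τ (Matrix.of fun i j => pair (a i) (b j))
  have e1 : gramDet pair (a ∘ σ) (b ∘ τ) =
      ((Matrix.of fun i j => pair (a i) (b (τ j))).submatrix σ id).det := rfl
  have e2 : (Matrix.of fun i j => pair (a i) (b (τ j))) =
      (Matrix.of fun i j => pair (a i) (b j)).submatrix id τ := rfl
  rw [e1, h1, e2, h2]
  simp only [gramDet, Units.val_mul, Int.cast_mul]
  ring

/-- The determinant is continuous and linear in its i-th vector alone, so differentiating in one
variable differentiates one vector. -/
theorem HasDerivAt.gramDet_right (pair : H →L[ℂ] H →L[ℂ] ℂ) (a b : ι → H) (i : ι) {γ : ℝ → H}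
    {γ' : H} {t : ℝ} (h : HasDerivAt γ γ' t) :
    HasDerivAt (fun s => gramDet pair a (Function.update b i (γ s)))
      (gramDet pair a (Function.update b i γ')) t := by
  let L : H →L[ℂ] ℂ :=
    { toFun := fun x => gramDet pair a (Function.update b i x)
      map_add' := gramDet_update_add pair a b i
      map_smul' := fun c x => gramDet_update_smul pair a b i c x
      cont := (continuous_gramDet pair).comp
        (continuous_const.prodMk (continuous_const.update i continuous_id)) }
  exact (L.restrictScalars ℝ).hasFDerivAt.comp_hasDerivAt t h

theorem HasDerivAt.gramDet_left (pair : H →L[ℂ] H →L[ℂ] ℂ) (a b : ι → H) (i : ι) {γ : ℝ → H}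
    {γ' : H} {t : ℝ} (h : HasDerivAt γ γ' t) :
    HasDerivAt (fun s => gramDet pair (Function.update a i (γ s)) b)
      (gramDet pair (Function.update a i γ') b) t := by
  simpa only [gramDet_flip] using HasDerivAt.gramDet_right pair.flip b a i h

theorem norm_gramDet_le_of_fin {pair : H →L[ℂ] H →L[ℂ] ℂ}
    (hp : ∀ (n : ℕ) (a b : Fin n → H), ‖gramDet pair a b‖ ≤ (∏ i, ‖a i‖) * ∏ i, ‖b i‖)
    (a b : ι → H) : ‖gramDet pair a b‖ ≤ (∏ i, ‖a i‖) * ∏ i, ‖b i‖ := by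
  let e := Fintype.equivFin ι
  rw [gramDet_equiv pair (a' := a ∘ e.symm) (b' := b ∘ e.symm) e (by simp) (by simp)]
  refine (hp _ _ _).trans (le_of_eq ?_)
  congr 1
  · exact Fintype.prod_equiv e.symm _ _ fun _ => rfl
  · exact Fintype.prod_equiv e.symm _ _ fun _ => rfl

variable {d r k : ℕ} {ℓ : ℝ} [Fact (0 < ℓ)]
variable {H : Type} [NormedAddCommGroup H] [NormedSpace ℂ H]
variable (pair : H →L[ℂ] H →L[ℂ] ℂ) (g₁ g₂ : Ck d r k ℓ Unit H)

/-- A derivative `∂^β g(x)` of a function of one variable. -/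
def Ck.one (g : Ck d r k ℓ Unit H) (β : MultiIdx d k) (x : Pt d r ℓ) : H :=
  g.1 (fun _ => β) (fun _ => x)

theorem Ck.continuous_one (g : Ck d r k ℓ Unit H) (β : MultiIdx d k) : Continuous (g.one β) :=
  (g.1 _).continuous.comp (continuous_pi fun _ => continuous_id)

theorem Ck.hasDerivAt_one {V : Type} [DecidableEq V] (g : Ck d r k ℓ Unit H) {v : V} {μ : Fin d}
    {α α' : V → MultiIdx d k} (h : IsIncr v μ α α') (x : V → Pt d r ℓ) :
    HasDerivAt (fun t : ℝ => g.one (α v) (shift v μ t x v)) (g.one (α' v) (x v)) 0 := by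
  have := g.2 () μ (fun _ => α v) (fun _ => α' v) (fun _ ν => by simpa using h v ν) (fun _ => x v)
  refine this.congr_deriv rfl |>.congr_of_eventuallyEq (Eventually.of_forall fun t => ?_)
  simp only [Ck.one]
  congr 1
  funext u
  simp [shift]

theorem IsIncr.eq_of_ne {V : Type} [DecidableEq V] {v : V} {μ : Fin d}
    {α α' : V → MultiIdx d k} (h : IsIncr v μ α α') {w : V} (hw : w ≠ v) : α' w = α w :=
  Subtype.ext (funext fun ν => Fin.ext (by simpa [hw] using h w ν))

theorem shift_of_ne {V : Type} [DecidableEq V] {v w : V} (hw : w ≠ v) (μ : Fin d) (t : ℝ)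
    (x : V → Pt d r ℓ) : shift v μ t x w = x w := by
  simp [shift, hw]

theorem shift_zero {V : Type} [DecidableEq V] (v : V) (μ : Fin d)
    (x : V → Pt d r ℓ) : shift v μ 0 x = x := by
  simp [shift]

/-- The vectors `a_i` followed by `∂^{α_j} g(x_j)`. -/
def gramVec {p : ℕ} (g : Ck d r k ℓ Unit H) (a : ι → H) (α : Fin p → MultiIdx d k)
    (x : Fin p → Pt d r ℓ) : ι ⊕ Fin p → H :=
  Sum.elim a fun i => g.one (α i) (x i)

theorem continuous_gramVec {p : ℕ} (g : Ck d r k ℓ Unit H) (a : ι → H) (α : Fin p → MultiIdx d k) :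
    Continuous (gramVec g a α) := by
  refine continuous_pi fun u => ?_
  rcases u with u | u
  · exact continuous_const
  · exact (g.continuous_one (α u)).comp (continuous_apply u)

/-- The function `det` of the pairings of `a, g₁(x_1), …, g₁(x_p)` with `b, g₂(y_1), …, g₂(y_p)`,
as an element of `𝒞_k(𝕋^{2p})`. -/
def gramCk (p : ℕ) (a b : ι → H) : Ck d r k ℓ (Fin p ⊕ Fin p) ℂ :=
  ⟨fun α => ⟨fun x => gramDet pair (gramVec g₁ a (α ∘ Sum.inl) (x ∘ Sum.inl))
      (gramVec g₂ b (α ∘ Sum.inr) (x ∘ Sum.inr)), by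
    have h₁ : Continuous fun x : Fin p ⊕ Fin p → Pt d r ℓ =>
        gramVec g₁ a (α ∘ Sum.inl) (x ∘ Sum.inl) := (continuous_gramVec g₁ a _).comp (by fun_prop)
    have h₂ : Continuous fun x : Fin p ⊕ Fin p → Pt d r ℓ =>
        gramVec g₂ b (α ∘ Sum.inr) (x ∘ Sum.inr) := (continuous_gramVec g₂ b _).comp (by fun_prop)
    exact (continuous_gramDet pair).comp (h₁.prodMk h₂)⟩, by
    -- A shift of one variable moves only the vector attached to it. `hvec` treats the family
    -- containing that variable, `hvec'` the family that does not see it.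
    have hvec : ∀ (g : Ck d r k ℓ Unit H) (c : ι → H) (q : Fin p → Fin p ⊕ Fin p)
        (hq : Function.Injective q) (i : Fin p) (μ : Fin d) (α α' : Fin p ⊕ Fin p → MultiIdx d k)
        (β : Fin p ⊕ Fin p → MultiIdx d k) (h : ∀ w, w ≠ q i → β w = α w) (t : ℝ)
        (x : Fin p ⊕ Fin p → Pt d r ℓ), gramVec g c (β ∘ q) (shift (q i) μ t x ∘ q) =
          Function.update (gramVec g c (α ∘ q) (x ∘ q)) (Sum.inr i)
            (g.one (β (q i)) (shift (q i) μ t x (q i))) := by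
      intro g c q hq i μ α α' β h t x
      funext u
      rcases u with u | u
      · simp [gramVec]
      · by_cases hu : u = i
        · subst hu; simp [gramVec]
        · have hne : q u ≠ q i := fun e => hu (hq e)
          simp [gramVec, hu, h _ hne, shift_of_ne hne]
    have hvec' : ∀ (g : Ck d r k ℓ Unit H) (c : ι → H) (q q' : Fin p → Fin p ⊕ Fin p)
        (hq : ∀ i j, q i ≠ q' j) (i : Fin p) (μ : Fin d)
        (α β : Fin p ⊕ Fin p → MultiIdx d k) (h : ∀ w, w ≠ q' i → β w = α w) (t : ℝ)
        (x : Fin p ⊕ Fin p → Pt d r ℓ), gramVec g c (β ∘ q) (shift (q' i) μ t x ∘ q) =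
          gramVec g c (α ∘ q) (x ∘ q) := by
      intro g c q q' hq i μ α β h t x
      funext u
      rcases u with u | u
      · rfl
      · simp [gramVec, h _ (hq u i), shift_of_ne (hq u i)]
    rintro (i | i) μ α α' h x
    · have e0 : ∀ β : Fin p ⊕ Fin p → MultiIdx d k, (∀ w, w ≠ Sum.inl i → β w = α w) → ∀ t : ℝ,
          gramDet pair (gramVec g₁ a (β ∘ Sum.inl) (shift (Sum.inl i) μ t x ∘ Sum.inl))
            (gramVec g₂ b (β ∘ Sum.inr) (shift (Sum.inl i) μ t x ∘ Sum.inr)) =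
          gramDet pair (Function.update (gramVec g₁ a (α ∘ Sum.inl) (x ∘ Sum.inl)) (Sum.inr i)
            (g₁.one (β (Sum.inl i)) (shift (Sum.inl i) μ t x (Sum.inl i))))
            (gramVec g₂ b (α ∘ Sum.inr) (x ∘ Sum.inr)) := fun β hβ t => by
        rw [hvec g₁ a Sum.inl Sum.inl_injective i μ α α' β hβ t x,
          hvec' g₂ b Sum.inr Sum.inl (by simp) i μ α β hβ t x]
      have := HasDerivAt.gramDet_left pair (gramVec g₁ a (α ∘ Sum.inl) (x ∘ Sum.inl))
        (gramVec g₂ b (α ∘ Sum.inr) (x ∘ Sum.inr)) (Sum.inr i) (g₁.hasDerivAt_one h x)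
      have e1 := e0 α' (fun w hw => h.eq_of_ne hw) 0
      simp only [shift_zero] at e1
      exact (this.congr_deriv e1.symm).congr_of_eventuallyEq
        (Eventually.of_forall fun t => e0 α (fun _ _ => rfl) t)
    · have e0 : ∀ β : Fin p ⊕ Fin p → MultiIdx d k, (∀ w, w ≠ Sum.inr i → β w = α w) → ∀ t : ℝ,
          gramDet pair (gramVec g₁ a (β ∘ Sum.inl) (shift (Sum.inr i) μ t x ∘ Sum.inl))
            (gramVec g₂ b (β ∘ Sum.inr) (shift (Sum.inr i) μ t x ∘ Sum.inr)) =
          gramDet pair (gramVec g₁ a (α ∘ Sum.inl) (x ∘ Sum.inl))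
            (Function.update (gramVec g₂ b (α ∘ Sum.inr) (x ∘ Sum.inr)) (Sum.inr i)
            (g₂.one (β (Sum.inr i)) (shift (Sum.inr i) μ t x (Sum.inr i)))) := fun β hβ t => by
        rw [hvec g₂ b Sum.inr Sum.inr_injective i μ α α' β hβ t x,
          hvec' g₁ a Sum.inl Sum.inr (by simp) i μ α β hβ t x]
      have := HasDerivAt.gramDet_right pair (gramVec g₁ a (α ∘ Sum.inl) (x ∘ Sum.inl))
        (gramVec g₂ b (α ∘ Sum.inr) (x ∘ Sum.inr)) (Sum.inr i) (g₂.hasDerivAt_one h x)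
      have e1 := e0 α' (fun w hw => h.eq_of_ne hw) 0
      simp only [shift_zero] at e1
      exact (this.congr_deriv e1.symm).congr_of_eventuallyEq
        (Eventually.of_forall fun t => e0 α (fun _ _ => rfl) t)⟩

theorem gramCk_apply (p : ℕ) (a b : ι → H) (α : Fin p ⊕ Fin p → MultiIdx d k)
    (x : Fin p ⊕ Fin p → Pt d r ℓ) : (gramCk pair g₁ g₂ p a b).1 α x =
      gramDet pair (gramVec g₁ a (α ∘ Sum.inl) (x ∘ Sum.inl))
        (gramVec g₂ b (α ∘ Sum.inr) (x ∘ Sum.inr)) := rfl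

theorem reindex_gramCk {p : ℕ} (a b : ι → H) (σ τ : Equiv.Perm (Fin p)) :
    Ck.reindex (Equiv.sumCongr σ τ) (gramCk pair g₁ g₂ p a b) =
      sgn σ τ • gramCk pair g₁ g₂ p a b := by
  refine Ck.ext' fun α x => ?_
  have h1 : ∀ (g : Ck d r k ℓ Unit H) (c : ι → H) (q : Fin p → Fin p ⊕ Fin p)
      (ρ : Equiv.Perm (Fin p)), gramVec g c (α ∘ q ∘ ρ) (x ∘ q ∘ ρ) =
      gramVec g c (α ∘ q) (x ∘ q) ∘ Equiv.sumCongr 1 ρ := by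
    intro g c q ρ
    funext u
    rcases u with u | u <;> rfl
  change gramDet pair (gramVec g₁ a (α ∘ Sum.inl ∘ σ) (x ∘ Sum.inl ∘ σ))
    (gramVec g₂ b (α ∘ Sum.inr ∘ τ) (x ∘ Sum.inr ∘ τ)) = sgn σ τ * gramDet pair _ _
  rw [h1, h1, gramDet_perm, Equiv.Perm.sign_sumCongr, Equiv.Perm.sign_sumCongr]
  simp [sgn]

/-- Each derivative stored in 𝒞_k is the Gram determinant of the corresponding derivatives of g₁ and
g₂, so Gram–Hadamard controls the full 𝒞_k norm and no p! arises from expanding the determinant. -/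
theorem norm_gramCk_le
    (hp : ∀ (n : ℕ) (a b : Fin n → H), ‖gramDet pair a b‖ ≤ (∏ i, ‖a i‖) * ∏ i, ‖b i‖) (p : ℕ) :
    ‖gramCk pair g₁ g₂ p (Fin.elim0 : Fin 0 → H) Fin.elim0‖ ≤ ‖g₁‖ ^ p * ‖g₂‖ ^ p := by
  refine Ck.norm_le (by positivity) fun α x => ?_
  rw [gramCk_apply]
  refine (norm_gramDet_le_of_fin hp _ _).trans ?_
  have h1 : ∀ (g : Ck d r k ℓ Unit H) (α : Fin p → MultiIdx d k) (x : Fin p → Pt d r ℓ),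
      ∏ i, ‖gramVec g (Fin.elim0 : Fin 0 → H) α x i‖ ≤ ‖g‖ ^ p := by
    intro g α x
    rw [Fintype.prod_sum_type, Fin.prod_univ_zero, one_mul]
    refine (Finset.prod_le_prod (fun _ _ => norm_nonneg _)
      fun i _ => g.norm_apply_le (fun _ => α i) (fun _ => x i)).trans (le_of_eq (by simp))
  exact mul_le_mul (h1 _ _ _) (h1 _ _ _) (Finset.prod_nonneg fun _ _ => norm_nonneg _)
    (by positivity)

theorem splitEquiv_inl_castAdd {N n n' m m' M : ℕ} (hN : n + n' = N) (hM : m + m' = M) (i : Fin n) :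
    splitEquiv hN hM (Sum.inl (Fin.cast hN (Fin.castAdd n' i))) = Sum.inl (Sum.inl i) := by
  subst hN hM
  simp [splitEquiv]

theorem splitEquiv_inl_natAdd {N n n' m m' M : ℕ} (hN : n + n' = N) (hM : m + m' = M) (i : Fin n') :
    splitEquiv hN hM (Sum.inl (Fin.cast hN (Fin.natAdd n i))) = Sum.inr (Sum.inl i) := by
  subst hN hM
  simp [splitEquiv]

theorem splitEquiv_inr_castAdd {N n n' m m' M : ℕ} (hN : n + n' = N) (hM : m + m' = M) (i : Fin m) :
    splitEquiv hN hM (Sum.inr (Fin.cast hM (Fin.castAdd m' i))) = Sum.inl (Sum.inr i) := by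
  subst hN hM
  simp [splitEquiv]

theorem splitEquiv_inr_natAdd {N n n' m m' M : ℕ} (hN : n + n' = N) (hM : m + m' = M) (i : Fin m') :
    splitEquiv hN hM (Sum.inr (Fin.cast hM (Fin.natAdd m i))) = Sum.inr (Sum.inr i) := by
  subst hN hM
  simp [splitEquiv]

/-- Fixing the last variables of a Gram determinant. -/
theorem slice_gramCk_last (p : ℕ) {n : ℕ} (a b : Fin n → H) (β : Fin 1 ⊕ Fin 1 → MultiIdx d k)
    (y : Fin 1 ⊕ Fin 1 → Pt d r ℓ) :
    (Ck.reindex (splitEquiv (rfl : p + 1 = p + 1) (rfl : p + 1 = p + 1))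
      (gramCk pair g₁ g₂ (p + 1) a b)).slice β y =
    gramCk pair g₁ g₂ p
      (Fin.cons (g₁.one (β (Sum.inl 0)) (y (Sum.inl 0))) a : Fin (n + 1) → H)
      (Fin.cons (g₂.one (β (Sum.inr 0)) (y (Sum.inr 0))) b : Fin (n + 1) → H) := by
  refine Ck.ext' fun α x => ?_
  -- The pair of vectors at the last variables becomes the first pair of fixed vectors. Rows and
  -- columns undergo the same permutation, so no sign appears.
  let e₀ : Fin (n + 1) ⊕ Fin p → Fin n ⊕ Fin (p + 1) :=
    Sum.elim (Fin.cons (Sum.inr (Fin.last p)) Sum.inl) fun i => Sum.inr i.castSucc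
  have he : Function.Bijective e₀ := by
    rw [Fintype.bijective_iff_surjective_and_card]
    refine ⟨?_, by simp; omega⟩
    rintro (i | i)
    · exact ⟨Sum.inl i.succ, by simp [e₀]⟩
    · refine Fin.lastCases ⟨Sum.inl 0, by simp [e₀]⟩ (fun i => ⟨Sum.inr i, by simp [e₀]⟩) i
  symm
  have hl : ∀ i : Fin p, splitEquiv (rfl : p + 1 = p + 1) (rfl : p + 1 = p + 1)
      (Sum.inl i.castSucc) = Sum.inl (Sum.inl i) := fun i => splitEquiv_inl_castAdd rfl rfl i
  have hl' : splitEquiv (rfl : p + 1 = p + 1) (rfl : p + 1 = p + 1)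
      (Sum.inl (Fin.last p)) = Sum.inr (Sum.inl 0) := splitEquiv_inl_natAdd rfl rfl 0
  have hr : ∀ i : Fin p, splitEquiv (rfl : p + 1 = p + 1) (rfl : p + 1 = p + 1)
      (Sum.inr i.castSucc) = Sum.inl (Sum.inr i) := fun i => splitEquiv_inr_castAdd rfl rfl i
  have hr' : splitEquiv (rfl : p + 1 = p + 1) (rfl : p + 1 = p + 1)
      (Sum.inr (Fin.last p)) = Sum.inr (Sum.inr 0) := splitEquiv_inr_natAdd rfl rfl 0
  refine gramDet_equiv pair (Equiv.ofBijective e₀ he) ?_ ?_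
  · rintro (i | i)
    · refine Fin.cases ?_ (fun i => ?_) i
      · simp [gramVec, e₀, hl']
      · simp [gramVec, e₀]
    · simp [gramVec, e₀, hl]
  · rintro (i | i)
    · refine Fin.cases ?_ (fun i => ?_) i
      · simp [gramVec, e₀, hr']
      · simp [gramVec, e₀]
    · simp [gramVec, e₀, hr]

/-- Fixing the first variables of a Gram determinant. -/
theorem slice_gramCk_first (n p : ℕ) (α : Fin n ⊕ Fin n → MultiIdx d k)
    (x : Fin n ⊕ Fin n → Pt d r ℓ) :
    (Ck.reindex (Equiv.sumComm _ _) (Ck.reindex (splitEquiv (rfl : n + p = n + p) (rfl : n + p = n + p))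
      (gramCk pair g₁ g₂ (n + p) (Fin.elim0 : Fin 0 → H) Fin.elim0))).slice α x =
    gramCk pair g₁ g₂ p (fun i => g₁.one (α (Sum.inl i)) (x (Sum.inl i)))
      (fun i => g₂.one (α (Sum.inr i)) (x (Sum.inr i))) := by
  refine Ck.ext' fun β y => ?_
  symm
  refine gramDet_equiv pair (finSumFinEquiv.trans (Equiv.emptySum (Fin 0) _).symm) ?_ ?_
  · have hl : ∀ i : Fin n, splitEquiv (rfl : n + p = n + p) (rfl : n + p = n + p)
        (Sum.inl (Fin.castAdd p i)) = Sum.inl (Sum.inl i) := splitEquiv_inl_castAdd rfl rfl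
    have hl' : ∀ i : Fin p, splitEquiv (rfl : n + p = n + p) (rfl : n + p = n + p)
        (Sum.inl (Fin.natAdd n i)) = Sum.inr (Sum.inl i) := splitEquiv_inl_natAdd rfl rfl
    rintro (i | i)
    · simp [gramVec, hl]
    · simp [gramVec, hl']
  · have hr : ∀ i : Fin n, splitEquiv (rfl : n + p = n + p) (rfl : n + p = n + p)
        (Sum.inr (Fin.castAdd p i)) = Sum.inl (Sum.inr i) := splitEquiv_inr_castAdd rfl rfl
    have hr' : ∀ i : Fin p, splitEquiv (rfl : n + p = n + p) (rfl : n + p = n + p)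
        (Sum.inr (Fin.natAdd n i)) = Sum.inr (Sum.inr i) := splitEquiv_inr_natAdd rfl rfl
    rintro (i | i)
    · simp [gramVec, hr]
    · simp [gramVec, hr']

end GramCk

/-! ### The algebra 𝒢_h: product, norm, single-degree elements, exponential. -/

section GrassmannAlgebra

variable {d r k : ℕ} {ℓ : ℝ} [Fact (0 < ℓ)]
variable {V W : Type} [Fintype V] [DecidableEq V] [Fintype W] [DecidableEq W]

theorem tensor_apply (A : StrongDual ℂ (Ck d r k ℓ V ℂ)) (B : StrongDual ℂ (Ck d r k ℓ W ℂ))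
    (f : Ck d r k ℓ (V ⊕ W) ℂ) : tensor A B f = B (f.curry.postcomp A) := rfl

theorem tensor_add_left (A A' : StrongDual ℂ (Ck d r k ℓ V ℂ)) (B : StrongDual ℂ (Ck d r k ℓ W ℂ)) :
    tensor (A + A') B = tensor A B + tensor A' B := by
  ext f
  change B _ = B _ + B _
  rw [← map_add]
  rfl

theorem tensor_smul_left (c : ℂ) (A : StrongDual ℂ (Ck d r k ℓ V ℂ))
    (B : StrongDual ℂ (Ck d r k ℓ W ℂ)) : tensor (c • A) B = c • tensor A B := by
  ext f
  change B _ = c • B _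
  rw [← map_smul]
  rfl

theorem tensor_add_right (A : StrongDual ℂ (Ck d r k ℓ V ℂ)) (B B' : StrongDual ℂ (Ck d r k ℓ W ℂ)) :
    tensor A (B + B') = tensor A B + tensor A B' := rfl

theorem tensor_smul_right (c : ℂ) (A : StrongDual ℂ (Ck d r k ℓ V ℂ))
    (B : StrongDual ℂ (Ck d r k ℓ W ℂ)) : tensor A (c • B) = c • tensor A B := rfl

theorem Kern.alt_apply {n m : ℕ} (T : Kern d r k ℓ n m) (f : Ck d r k ℓ (Fin n ⊕ Fin m) ℂ) :
    T.alt f = ∑ σ : Equiv.Perm (Fin n), ∑ τ : Equiv.Perm (Fin m),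
      sgn σ τ * T (Ck.reindex (Equiv.sumCongr σ τ) f) := by
  simp only [Kern.alt, _root_.sum_apply, _root_.smul_apply,
    ContinuousLinearMap.comp_apply, smul_eq_mul]

theorem mulTerm_apply {N M n n' m m' : ℕ} (hN : n + n' = N) (hM : m + m' = M)
    (A : Kern d r k ℓ n m) (B : Kern d r k ℓ n' m') (f : Ck d r k ℓ (Fin N ⊕ Fin M) ℂ) :
    mulTerm hN hM A B f = ((-1 : ℂ) ^ (m * n') / (n ! * n' ! * m ! * m' !)) *
      ∑ σ : Equiv.Perm (Fin N), ∑ τ : Equiv.Perm (Fin M), sgn σ τ *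
        tensor A B (Ck.reindex (splitEquiv hN hM) (Ck.reindex (Equiv.sumCongr σ τ) f)) := by
  rw [mulTerm, _root_.smul_apply, Kern.alt_apply, smul_eq_mul]
  rfl

/-- On an anti-symmetric test function all permutations contribute equally, so the alternation is
just a factor N! M!. Gram determinants are such functions. -/
theorem mulTerm_apply_antisymm {N M n n' m m' : ℕ} (hN : n + n' = N) (hM : m + m' = M)
    (A : Kern d r k ℓ n m) (B : Kern d r k ℓ n' m') (f : Ck d r k ℓ (Fin N ⊕ Fin M) ℂ)
    (hf : ∀ σ τ, Ck.reindex (Equiv.sumCongr σ τ) f = sgn σ τ • f) :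
    mulTerm hN hM A B f = ((-1 : ℂ) ^ (m * n') / (n ! * n' ! * m ! * m' !)) *
      (N ! * M ! * tensor A B (Ck.reindex (splitEquiv hN hM) f)) := by
  rw [mulTerm_apply]
  congr 1
  simp only [hf, map_smul, smul_eq_mul, ← mul_assoc, sgn_mul_self, one_mul, Finset.sum_const,
    Finset.card_univ, Fintype.card_perm, Fintype.card_fin, nsmul_eq_mul]

theorem mulTerm_add_left {N M n n' m m' : ℕ} (hN : n + n' = N) (hM : m + m' = M)
    (A A' : Kern d r k ℓ n m) (B : Kern d r k ℓ n' m') :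
    mulTerm hN hM (A + A') B = mulTerm hN hM A B + mulTerm hN hM A' B := by
  ext f
  simp only [_root_.add_apply, mulTerm_apply, tensor_add_left, mul_add, Finset.sum_add_distrib]

theorem mulTerm_add_right {N M n n' m m' : ℕ} (hN : n + n' = N) (hM : m + m' = M)
    (A : Kern d r k ℓ n m) (B B' : Kern d r k ℓ n' m') :
    mulTerm hN hM A (B + B') = mulTerm hN hM A B + mulTerm hN hM A B' := by
  ext f
  simp only [_root_.add_apply, mulTerm_apply, tensor_add_right, mul_add, Finset.sum_add_distrib]

theorem mulTerm_smul_left {N M n n' m m' : ℕ} (hN : n + n' = N) (hM : m + m' = M) (c : ℂ)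
    (A : Kern d r k ℓ n m) (B : Kern d r k ℓ n' m') :
    mulTerm hN hM (c • A) B = c • mulTerm hN hM A B := by
  ext f
  simp only [_root_.smul_apply, mulTerm_apply, tensor_smul_left, smul_eq_mul, Finset.mul_sum]
  exact Finset.sum_congr rfl fun σ _ => Finset.sum_congr rfl fun τ _ => by ring

theorem mulTerm_smul_right {N M n n' m m' : ℕ} (hN : n + n' = N) (hM : m + m' = M) (c : ℂ)
    (A : Kern d r k ℓ n m) (B : Kern d r k ℓ n' m') :
    mulTerm hN hM A (c • B) = c • mulTerm hN hM A B := by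
  ext f
  simp only [_root_.smul_apply, mulTerm_apply, tensor_smul_right, smul_eq_mul, Finset.mul_sum]
  exact Finset.sum_congr rfl fun σ _ => Finset.sum_congr rfl fun τ _ => by ring

theorem mulTerm_zero_left {N M n n' m m' : ℕ} (hN : n + n' = N) (hM : m + m' = M)
    (B : Kern d r k ℓ n' m') : mulTerm hN hM (0 : Kern d r k ℓ n m) B = 0 := by
  simpa using mulTerm_add_left hN hM (0 : Kern d r k ℓ n m) 0 B

theorem mulTerm_zero_right {N M n n' m m' : ℕ} (hN : n + n' = N) (hM : m + m' = M)
    (A : Kern d r k ℓ n m) : mulTerm hN hM A (0 : Kern d r k ℓ n' m') = 0 := by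
  simpa using mulTerm_add_right hN hM A (0 : Kern d r k ℓ n' m') 0

variable {h : ℝ} [Fact (0 < h)]

theorem Grassmann.ext {F H : Grassmann d r k ℓ h} (e : ∀ n m, F.kern n m = H.kern n m) : F = H :=
  Subtype.ext (funext fun n => funext fun m => e n m)

theorem Grassmann.isAntisymm (F : Grassmann d r k ℓ h) (n m : ℕ) : (F.kern n m).IsAntisymm :=
  F.2.1 n m

/-- The kernel `F_{nm}` as a linear function of `F`. -/
def Grassmann.kernₗ (n m : ℕ) : Grassmann d r k ℓ h →ₗ[ℂ] Kern d r k ℓ n m where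
  toFun F := F.kern n m
  map_add' _ _ := rfl
  map_smul' _ _ := rfl

theorem Grassmann.kernₗ_apply (n m : ℕ) (F : Grassmann d r k ℓ h) :
    Grassmann.kernₗ n m F = F.kern n m := rfl

/-- The N! M! of the alternation is absorbed by the weights, so each term of the product is bounded
by a product of weighted norms. A term is labelled by its four degrees, hence is counted once in the
double series for ‖F‖ ‖H‖. -/
theorem Grassmann.norm_mul_le (F H : Grassmann d r k ℓ h) : ‖F * H‖ ≤ ‖F‖ * ‖H‖ := by
  let a : ℕ × ℕ → ℝ := fun p => weight h p.1 p.2 * ‖F.kern p.1 p.2‖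
  let b : ℕ × ℕ → ℝ := fun p => weight h p.1 p.2 * ‖H.kern p.1 p.2‖
  have ha0 : ∀ p, 0 ≤ a p := fun p => mul_nonneg (weight_nonneg h _ _) (norm_nonneg _)
  have hb0 : ∀ p, 0 ≤ b p := fun p => mul_nonneg (weight_nonneg h _ _) (norm_nonneg _)
  have hab : Summable fun z : (ℕ × ℕ) × (ℕ × ℕ) => a z.1 * b z.2 :=
    F.summable.mul_of_nonneg H.summable ha0 hb0
  have hbound : ∀ P : ℕ × ℕ, weight h P.1 P.2 * ‖mulKern F.kern H.kern P.1 P.2‖ ≤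
      ∑ z ∈ Finset.HasAntidiagonal.antidiagonal P.1 ×ˢ Finset.HasAntidiagonal.antidiagonal P.2,
        a (z.1.1, z.2.1) * b (z.1.2, z.2.2) := by
    intro P
    rw [Finset.sum_product, ← Finset.sum_coe_sort (Finset.HasAntidiagonal.antidiagonal P.1)]
    refine (mul_le_mul_of_nonneg_left (norm_sum_le _ _) (weight_nonneg h _ _)).trans ?_
    rw [Finset.mul_sum]
    refine Finset.sum_le_sum fun p _ => ?_
    rw [← Finset.sum_coe_sort (Finset.HasAntidiagonal.antidiagonal P.2)]
    refine (mul_le_mul_of_nonneg_left (norm_sum_le _ _) (weight_nonneg h _ _)).trans ?_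
    rw [Finset.mul_sum]
    exact Finset.sum_le_sum fun q _ => weight_mul_norm_mulTerm_le _ _ _ _
  have h1 : ‖F‖ * ‖H‖ = ∑' z : (ℕ × ℕ) × (ℕ × ℕ), a z.1 * b z.2 :=
    F.summable.tsum_mul_tsum H.summable hab
  rw [h1, Grassmann.norm_def]
  refine (F * H).summable.tsum_le_of_sum_le fun s => ?_
  refine (Finset.sum_le_sum fun P _ => hbound P).trans ?_
  rw [Finset.sum_sigma']
  let j : ((_ : ℕ × ℕ) × ((ℕ × ℕ) × (ℕ × ℕ))) → (ℕ × ℕ) × (ℕ × ℕ) :=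
    fun z => ((z.2.1.1, z.2.2.1), (z.2.1.2, z.2.2.2))
  have hj : Set.InjOn j (s.sigma fun P => Finset.HasAntidiagonal.antidiagonal P.1 ×ˢ
      Finset.HasAntidiagonal.antidiagonal P.2 :
      Finset ((_ : ℕ × ℕ) × ((ℕ × ℕ) × (ℕ × ℕ)))) := by
    rintro ⟨⟨N, M⟩, ⟨p1, p2⟩, ⟨q1, q2⟩⟩ hz ⟨⟨N', M'⟩, ⟨p1', p2'⟩, ⟨q1', q2'⟩⟩ hz' hzz
    simp only [Finset.coe_sigma, Set.mem_sigma_iff, Finset.mem_coe, Finset.mem_product,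
      Finset.HasAntidiagonal.mem_antidiagonal] at hz hz'
    simp only [j, Prod.mk.injEq] at hzz
    obtain ⟨⟨rfl, rfl⟩, rfl, rfl⟩ := hzz
    obtain ⟨-, rfl, rfl⟩ := hz
    obtain ⟨-, rfl, rfl⟩ := hz'
    rfl
  have := hab.sum_le_tsum ((s.sigma fun P => Finset.HasAntidiagonal.antidiagonal P.1 ×ˢ
      Finset.HasAntidiagonal.antidiagonal P.2).image j)
    (fun z _ => mul_nonneg (ha0 _) (hb0 _))
  rw [Finset.sum_image hj] at this
  exact this

/-- Multiplication as a continuous bilinear map. -/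
def Grassmann.mulL : Grassmann d r k ℓ h →L[ℂ] Grassmann d r k ℓ h →L[ℂ] Grassmann d r k ℓ h :=
  LinearMap.mkContinuous₂
    (LinearMap.mk₂ ℂ (fun F H => F * H)
      (fun F F' H => Grassmann.ext fun N M => by
        change mulKern (F.kern + F'.kern) H.kern N M =
          mulKern F.kern H.kern N M + mulKern F'.kern H.kern N M
        simp only [mulKern, Pi.add_apply, mulTerm_add_left, Finset.sum_add_distrib])
      (fun c F H => Grassmann.ext fun N M => by
        change mulKern (c • F.kern) H.kern N M = c • mulKern F.kern H.kern N M
        simp only [mulKern, Pi.smul_apply, mulTerm_smul_left, Finset.smul_sum])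
      (fun F H H' => Grassmann.ext fun N M => by
        change mulKern F.kern (H.kern + H'.kern) N M =
          mulKern F.kern H.kern N M + mulKern F.kern H'.kern N M
        simp only [mulKern, Pi.add_apply, mulTerm_add_right, Finset.sum_add_distrib])
      (fun c F H => Grassmann.ext fun N M => by
        change mulKern F.kern (c • H.kern) N M = c • mulKern F.kern H.kern N M
        simp only [mulKern, Pi.smul_apply, mulTerm_smul_right, Finset.smul_sum]))
    1 fun F H => by rw [one_mul]; exact Grassmann.norm_mul_le F H

theorem Grassmann.mulL_apply (F H : Grassmann d r k ℓ h) : Grassmann.mulL F H = F * H := rfl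

theorem singleKern_self {n m : ℕ} (A : Kern d r k ℓ n m) : singleKern A n m = A := by
  simp [singleKern]

theorem singleKern_of_ne {n m n' m' : ℕ} (A : Kern d r k ℓ n m) (e : ¬(n = n' ∧ m = m')) :
    singleKern A n' m' = 0 := by
  simp [singleKern, e]

/-- The element of `𝒢_h` with the single kernel `A`. -/
def single (h : ℝ) [Fact (0 < h)] {n m : ℕ} (A : Kern d r k ℓ n m) (hA : A.IsAntisymm) :
    Grassmann d r k ℓ h :=
  ⟨singleKern A, singleKern_mem A hA⟩

theorem kern_single {n m : ℕ} (A : Kern d r k ℓ n m) (hA : A.IsAntisymm) (n' m' : ℕ) :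
    (single h A hA).kern n' m' = singleKern A n' m' := rfl

theorem norm_single {n m : ℕ} (A : Kern d r k ℓ n m) (hA : A.IsAntisymm) :
    ‖single h A hA‖ = weight h n m * ‖A‖ := by
  rw [Grassmann.norm_def, tsum_eq_single (n, m)]
  · rw [kern_single, singleKern_self]
  · rintro ⟨n', m'⟩ hne
    rw [kern_single, singleKern_of_ne A fun e => hne (by rw [e.1, e.2]), norm_zero, mul_zero]

theorem isAntisymm_mulTerm {N M n n' m m' : ℕ} (hN : n + n' = N) (hM : m + m' = M)
    (A : Kern d r k ℓ n m) (B : Kern d r k ℓ n' m') : (mulTerm hN hM A B).IsAntisymm :=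
  Kern.IsAntisymm.smul (Kern.isAntisymm_alt _) _

theorem single_mul_single {n m n' m' : ℕ} (A : Kern d r k ℓ n m) (hA : A.IsAntisymm)
    (B : Kern d r k ℓ n' m') (hB : B.IsAntisymm) :
    single h A hA * single h B hB =
      single h (mulTerm rfl rfl A B) (isAntisymm_mulTerm _ _ A B) := by
  refine Grassmann.ext fun N M => ?_
  change mulKern (singleKern A) (singleKern B) N M = singleKern _ N M
  by_cases e : n + n' = N ∧ m + m' = M
  · obtain ⟨rfl, rfl⟩ := e
    rw [singleKern_self, mulKern,
      Finset.sum_eq_single ⟨(n, n'), Finset.HasAntidiagonal.mem_antidiagonal.2 rfl⟩,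
      Finset.sum_eq_single ⟨(m, m'), Finset.HasAntidiagonal.mem_antidiagonal.2 rfl⟩]
    · rw [singleKern_self, singleKern_self]
    · rintro ⟨⟨q, q'⟩, hq⟩ - hne
      rw [singleKern_of_ne A, mulTerm_zero_left]
      rintro ⟨-, rfl⟩
      have := Finset.HasAntidiagonal.mem_antidiagonal.1 hq
      exact hne (Subtype.ext (Prod.ext rfl (by simpa using this)))
    · simp
    · rintro ⟨⟨q, q'⟩, hq⟩ - hne
      refine Finset.sum_eq_zero fun u _ => ?_
      rw [singleKern_of_ne A, mulTerm_zero_left]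
      rintro ⟨rfl, -⟩
      have := Finset.HasAntidiagonal.mem_antidiagonal.1 hq
      exact hne (Subtype.ext (Prod.ext rfl (by simpa using this)))
    · simp
  · rw [singleKern_of_ne _ e, mulKern]
    refine Finset.sum_eq_zero fun p _ => Finset.sum_eq_zero fun q _ => ?_
    by_cases e1 : n = p.1.1 ∧ m = q.1.1
    · rw [singleKern_of_ne B, mulTerm_zero_right]
      rintro ⟨e2, e3⟩
      refine e ⟨?_, ?_⟩
      · rw [e1.1, e2]; exact Finset.HasAntidiagonal.mem_antidiagonal.1 p.2
      · rw [e1.2, e3]; exact Finset.HasAntidiagonal.mem_antidiagonal.1 q.2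
    · rw [singleKern_of_ne A e1, mulTerm_zero_left]

/-- An element of `𝒢_h` is the sum of its components. -/
theorem hasSum_single (F : Grassmann d r k ℓ h) :
    HasSum (fun p : ℕ × ℕ => single h (F.kern p.1 p.2) (F.isAntisymm p.1 p.2)) F := by
  -- The norm is an ℓ¹ sum over degrees, so the distance to a partial sum is the tail of a
  -- convergent series.
  rw [HasSum, SummationFilter.unconditional_filter, tendsto_iff_norm_sub_tendsto_zero]
  have h1 := tendsto_tsum_compl_atTop_zero
    fun p : ℕ × ℕ => weight h p.1 p.2 * ‖F.kern p.1 p.2‖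
  refine h1.congr fun s => ?_
  have h2 : ∀ p : ℕ × ℕ, (∑ q ∈ s, single h (F.kern q.1 q.2) (F.isAntisymm q.1 q.2) - F).kern p.1 p.2 =
      if p ∈ s then 0 else -F.kern p.1 p.2 := by
    intro p
    rw [← Grassmann.kernₗ_apply, map_sub, map_sum]
    simp only [Grassmann.kernₗ_apply, kern_single]
    have h3 : ∀ q : ℕ × ℕ, q ≠ p → singleKern (F.kern q.1 q.2) p.1 p.2 = 0 := fun q hq =>
      singleKern_of_ne _ fun e => hq (Prod.ext e.1 e.2)
    split_ifs with hp
    · rw [Finset.sum_eq_single p (fun q _ hq => h3 q hq) (fun hn => absurd hp hn),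
        singleKern_self, sub_self]
    · rw [Finset.sum_eq_zero fun q hq => h3 q (fun e => hp (e ▸ hq)), zero_sub]
  rw [Grassmann.norm_def]
  refine (tsum_subtype {x | x ∉ s} fun p : ℕ × ℕ => weight h p.1 p.2 * ‖F.kern p.1 p.2‖).trans ?_
  refine tsum_congr fun p => ?_
  rw [h2]
  by_cases hp : p ∈ s
  · simp [hp]
  · simp [hp]

theorem hasSum_diagonal_iff {X : Type*} [AddCommMonoid X] [TopologicalSpace X] {f : ℕ × ℕ → X}
    (hf : ∀ n m, n ≠ m → f (n, m) = 0) {x : X} :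
    HasSum (fun n => f (n, n)) x ↔ HasSum f x := by
  have hi : Function.Injective fun n : ℕ => (n, n) := fun n m e => congrArg Prod.fst e
  refine hi.hasSum_iff fun p hp => hf p.1 p.2 fun e => hp ⟨p.1, Prod.ext rfl e⟩

/-- The kernel of `A^p` for an element `A` of degree `(1, 1)`. -/
def powKern (A : Kern d r k ℓ 1 1) : ∀ p : ℕ, Kern d r k ℓ p p
  | 0 => Ck.evalL fun u => u.elim Fin.elim0 Fin.elim0
  -- The new factor stands on the right, as in `npowRec`; associativity of the product is never
  -- needed.
  | p + 1 => mulTerm rfl rfl (powKern A p) A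

theorem isAntisymm_powKern (A : Kern d r k ℓ 1 1) (p : ℕ) : (powKern A p).IsAntisymm := by
  cases p with
  | zero => exact isAntisymm_of_subsingleton _
  | succ p => exact isAntisymm_mulTerm _ _ _ _

theorem npowRec_single (A : Kern d r k ℓ 1 1) (p : ℕ) :
    npowRec p (single h A (isAntisymm_of_subsingleton A)) =
      single h (powKern A p) (isAntisymm_powKern A p) := by
  induction p with
  | zero => rfl
  | succ p ih =>
    have : npowRec (p + 1) (single h A (isAntisymm_of_subsingleton A)) =
      npowRec p (single h A (isAntisymm_of_subsingleton A)) *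
        single h A (isAntisymm_of_subsingleton A) := rfl
    rw [this, ih, single_mul_single]
    rfl

theorem norm_npowRec_le (A : Grassmann d r k ℓ h) (p : ℕ) :
    ‖npowRec p A‖ ≤ ‖(1 : Grassmann d r k ℓ h)‖ * ‖A‖ ^ p := by
  induction p with
  | zero => exact le_of_eq (by rw [pow_zero, mul_one]; rfl)
  | succ p ih =>
    have : npowRec (p + 1) A = npowRec p A * A := rfl
    rw [this, pow_succ, ← mul_assoc]
    exact (Grassmann.norm_mul_le _ _).trans (mul_le_mul_of_nonneg_right ih (norm_nonneg _))

theorem isAntisymm_singleKern {n m : ℕ} {A : Kern d r k ℓ n m} (hA : A.IsAntisymm) (n' m' : ℕ) :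
    (singleKern A n' m').IsAntisymm :=
  (single 1 A hA).isAntisymm n' m'

theorem smul_single (c : ℂ) {n m : ℕ} (A : Kern d r k ℓ n m) (hA : A.IsAntisymm) :
    c • single h A hA = single h (c • A) (hA.smul c) := by
  refine Grassmann.ext fun n' m' => ?_
  change c • singleKern A n' m' = singleKern (c • A) n' m'
  by_cases e : n = n' ∧ m = m'
  · obtain ⟨rfl, rfl⟩ := e
    rw [singleKern_self, singleKern_self]
  · rw [singleKern_of_ne _ e, singleKern_of_ne _ e]
    exact smul_zero (A := Kern d r k ℓ n' m') c

/-- The exponential series of an element of degree `(1, 1)` converges. -/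
theorem summable_exp_single (A : Kern d r k ℓ 1 1) :
    Summable fun p : ℕ => (p ! : ℂ)⁻¹ •
      npowRec p (single h A (isAntisymm_of_subsingleton A) : Grassmann d r k ℓ h) := by
  set a : Grassmann d r k ℓ h := single h A (isAntisymm_of_subsingleton A) with ha
  have hanti : ∀ p, ((p ! : ℂ)⁻¹ • powKern A p).IsAntisymm := fun p => (isAntisymm_powKern A p).smul _
  have hdiag : ∀ n m, n ≠ m → singleKern ((n ! : ℂ)⁻¹ • powKern A n) n m = 0 := fun n m hnm =>
    singleKern_of_ne _ fun e => hnm e.2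
  have hnorm : ∀ p, weight h p p * ‖(p ! : ℂ)⁻¹ • powKern A p‖ ≤
      ‖(1 : Grassmann d r k ℓ h)‖ * (‖a‖ ^ p / p !) := by
    intro p
    rw [← norm_single _ (hanti p), ← smul_single _ _ (isAntisymm_powKern A p), ← npowRec_single,
      norm_smul, norm_inv, Complex.norm_natCast]
    refine (mul_le_mul_of_nonneg_left (norm_npowRec_le _ p) (by positivity)).trans (le_of_eq ?_)
    ring
  -- The sum is exhibited rather than derived from completeness of 𝒢_h: the p-th term sits in degree
  -- (p, p), so the kernels of the exponential are known, and `hnorm` puts them in 𝒢_h.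
  let X : Grassmann d r k ℓ h := ⟨fun n m => singleKern ((n ! : ℂ)⁻¹ • powKern A n) n m,
    fun n m => isAntisymm_singleKern (hanti n) n m, by
      have h1 : Summable fun n : ℕ => weight h n n *
          ‖singleKern ((n ! : ℂ)⁻¹ • powKern A n) n n‖ := by
        refine Summable.of_nonneg_of_le (fun n => mul_nonneg (weight_nonneg h _ _) (norm_nonneg _))
          (fun n => ?_) ((Real.summable_pow_div_factorial ‖a‖).mul_left ‖(1 : Grassmann d r k ℓ h)‖)
        rw [singleKern_self]
        exact hnorm n
      obtain ⟨S, hS⟩ := h1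
      exact ⟨S, (hasSum_diagonal_iff (f := fun p : ℕ × ℕ => weight h p.1 p.2 *
        ‖singleKern ((p.1 ! : ℂ)⁻¹ • powKern A p.1) p.1 p.2‖) fun n m hnm => by
          simp [hdiag n m hnm]).1 hS⟩⟩
  have hX := hasSum_single X
  rw [← hasSum_diagonal_iff fun n m hnm => ?_] at hX
  · refine ⟨X, hX.congr_fun fun p => ?_⟩
    rw [npowRec_single, smul_single]
    refine Grassmann.ext fun n' m' => ?_
    change singleKern _ n' m' = singleKern (singleKern ((p ! : ℂ)⁻¹ • powKern A p) p p) n' m'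
    rw [singleKern_self]
  · refine Grassmann.ext fun n' m' => ?_
    change singleKern (singleKern ((n ! : ℂ)⁻¹ • powKern A n) n m) n' m' = 0
    rw [hdiag n m hnm]
    by_cases e : n = n' ∧ m = m'
    · obtain ⟨rfl, rfl⟩ := e
      rw [singleKern_self]
    · rw [singleKern_of_ne _ e]

end GrassmannAlgebra

/-! ### Fubini's theorem for tensor products of distributions. -/

section Commutes

set_option linter.unusedSectionVars false

variable {d r k : ℕ} {ℓ : ℝ} [Fact (0 < ℓ)]
variable {V W W' : Type} [Fintype V] [DecidableEq V] [Fintype W] [DecidableEq W]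
  [Fintype W'] [DecidableEq W']

/-- A distribution for which Fubini's theorem holds, in a tensor product with any other. -/
def Commutes (Θ : StrongDual ℂ (Ck d r k ℓ W ℂ)) : Prop :=
  ∀ (V : Type) [Fintype V] [DecidableEq V] (Φ : StrongDual ℂ (Ck d r k ℓ V ℂ))
    (f : Ck d r k ℓ (V ⊕ W) ℂ), tensor Φ Θ f = tensor Θ Φ (Ck.reindex (Equiv.sumComm V W) f)

theorem reindex_apply (e : V ≃ W) (f : Ck d r k ℓ V ℂ) (β : W → MultiIdx d k) (x : W → Pt d r ℓ) :
    (Ck.reindex e f).1 β x = f.1 (β ∘ e) (x ∘ e) := rfl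

theorem slice_apply (f : Ck d r k ℓ (V ⊕ W) ℂ) (β : W → MultiIdx d k) (y : W → Pt d r ℓ)
    (α : V → MultiIdx d k) (x : V → Pt d r ℓ) :
    (f.slice β y).1 α x = f.1 (Sum.elim α β) (Sum.elim x y) := rfl

theorem curry_postcomp_apply (f : Ck d r k ℓ (V ⊕ W) ℂ) (A : StrongDual ℂ (Ck d r k ℓ V ℂ))
    (β : W → MultiIdx d k) (y : W → Pt d r ℓ) :
    (f.curry.postcomp A).1 β y = A (f.slice β y) := rfl

theorem elim_comp_sumComm {X : Type*} (a : V → X) (b : W → X) :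
    Sum.elim b a ∘ Equiv.sumComm V W = Sum.elim a b := by
  funext u
  rcases u with u | u <;> rfl

theorem slice_sumComm_apply (f : Ck d r k ℓ (V ⊕ W) ℂ) (α : V → MultiIdx d k) (x : V → Pt d r ℓ)
    (β : W → MultiIdx d k) (y : W → Pt d r ℓ) :
    ((Ck.reindex (Equiv.sumComm V W) f).slice α x).1 β y =
      f.1 (Sum.elim α β) (Sum.elim x y) := by
  rw [slice_apply, reindex_apply, elim_comp_sumComm, elim_comp_sumComm]

theorem commutes_evalL (y : W → Pt d r ℓ) :
    Commutes (Ck.evalL y : StrongDual ℂ (Ck d r k ℓ W ℂ)) := by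
  intro V _ _ Φ f
  change Φ (f.slice (fun _ => 0) y) = Φ _
  congr 1
  refine Ck.ext' fun α x => ?_
  exact (slice_sumComm_apply f α x _ y).symm

theorem Commutes.smul {Θ : StrongDual ℂ (Ck d r k ℓ W ℂ)} (hΘ : Commutes Θ) (c : ℂ) :
    Commutes (c • Θ) := by
  intro V _ _ Φ f
  rw [tensor_smul_left, tensor_smul_right, _root_.smul_apply, _root_.smul_apply, hΘ]

theorem Commutes.add {Θ Θ' : StrongDual ℂ (Ck d r k ℓ W ℂ)} (hΘ : Commutes Θ) (hΘ' : Commutes Θ') :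
    Commutes (Θ + Θ') := by
  intro V _ _ Φ f
  rw [tensor_add_left, tensor_add_right, _root_.add_apply, _root_.add_apply, hΘ, hΘ']

theorem commutes_zero : Commutes (0 : StrongDual ℂ (Ck d r k ℓ W ℂ)) := by
  intro V _ _ Φ f
  exact (map_zero Φ).symm

theorem Commutes.sum {ι : Type*} (s : Finset ι) {Θ : ι → StrongDual ℂ (Ck d r k ℓ W ℂ)}
    (hΘ : ∀ i ∈ s, Commutes (Θ i)) : Commutes (∑ i ∈ s, Θ i) := by
  classical
  induction s using Finset.induction_on with
  | empty => simpa using commutes_zero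
  | insert i s hi ih =>
    rw [Finset.sum_insert hi]
    exact (hΘ i (by simp)).add (ih fun j hj => hΘ j (by simp [hj]))

theorem Commutes.comp_reindex {Θ : StrongDual ℂ (Ck d r k ℓ W ℂ)} (hΘ : Commutes Θ) (e : W' ≃ W) :
    Commutes (Θ.comp (Ck.reindex e)) := by
  intro V _ _ Φ f
  have hs : ∀ {X : Type} (a : V → X) (b : W → X),
      Sum.elim a b ∘ Equiv.sumCongr (Equiv.refl V) e = Sum.elim a (b ∘ e) := by
    intro X a b
    funext u
    rcases u with u | u <;> rfl
  have h1 := hΘ V Φ (Ck.reindex (Equiv.sumCongr (Equiv.refl V) e) f)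
  refine Eq.trans ?_ (h1.trans ?_)
  · refine congrArg Θ (Ck.ext' fun β y => ?_)
    refine congrArg Φ (a₁ := f.slice (β ∘ e) (y ∘ e))
      (a₂ := (Ck.reindex (Equiv.sumCongr (Equiv.refl V) e) f).slice β y) (Ck.ext' fun α x => ?_)
    rw [slice_apply, slice_apply, reindex_apply, hs, hs]
  · refine congrArg Φ (Ck.ext' fun α x => ?_)
    refine congrArg Θ (a₁ := (Ck.reindex (Equiv.sumComm V W)
      (Ck.reindex (Equiv.sumCongr (Equiv.refl V) e) f)).slice α x)
      (a₂ := Ck.reindex e ((Ck.reindex (Equiv.sumComm V W') f).slice α x))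
      (Ck.ext' fun β y => ?_)
    rw [slice_sumComm_apply, reindex_apply, reindex_apply, slice_sumComm_apply, hs, hs]

theorem Commutes.tensor {A : StrongDual ℂ (Ck d r k ℓ W ℂ)} {B : StrongDual ℂ (Ck d r k ℓ W' ℂ)}
    (hA : Commutes A) (hB : Commutes B) : Commutes (tensor A B) := by
  intro V _ _ Φ f
  let e : V ⊕ (W ⊕ W') ≃ W ⊕ (V ⊕ W') :=
    (Equiv.sumAssoc V W W').symm.trans
      ((Equiv.sumCongr (Equiv.sumComm V W) (Equiv.refl W')).trans (Equiv.sumAssoc W V W'))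
  have he : ∀ {X : Type} (a : V → X) (b : W → X) (c : W' → X),
      Sum.elim b (Sum.elim a c) ∘ e = Sum.elim a (Sum.elim b c) := by
    intro X a b c
    funext u
    rcases u with u | u | u <;> rfl
  have he' : ∀ {X : Type} (a : V → X) (b : W → X) (c : W' → X),
      Sum.elim (Sum.elim a b) c ∘ (Equiv.sumAssoc V W W').symm = Sum.elim a (Sum.elim b c) := by
    intro X a b c
    funext u
    rcases u with u | u | u <;> rfl
  -- `f'` is f with A already applied. Φ is first moved past A, with the variable of B held fixed,
  -- and then past B.
  let f' : Ck d r k ℓ (V ⊕ W') ℂ := (Ck.reindex e f).curry.postcomp A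
  refine Eq.trans ?_ ((hB V Φ f').trans ?_)
  · refine congrArg B (Ck.ext' fun γ z => ?_)
    have h1 := hA V Φ ((Ck.reindex (Equiv.sumAssoc V W W').symm f).slice γ z)
    refine Eq.trans ?_ (h1.trans ?_)
    · refine congrArg A (a₁ := (f.curry.postcomp Φ).slice γ z)
        (a₂ := ((Ck.reindex (Equiv.sumAssoc V W W').symm f).slice γ z).curry.postcomp Φ)
        (Ck.ext' fun β y => ?_)
      refine congrArg Φ (a₁ := f.slice (Sum.elim β γ) (Sum.elim y z))
        (a₂ := ((Ck.reindex (Equiv.sumAssoc V W W').symm f).slice γ z).slice β y)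
        (Ck.ext' fun α x => ?_)
      rw [slice_apply, slice_apply, slice_apply, reindex_apply, he', he']
    · refine congrArg Φ (a₂ := f'.slice γ z) (Ck.ext' fun α x => ?_)
      refine congrArg A (a₁ := (Ck.reindex (Equiv.sumComm V W)
          ((Ck.reindex (Equiv.sumAssoc V W W').symm f).slice γ z)).slice α x)
        (a₂ := (Ck.reindex e f).slice (Sum.elim α γ) (Sum.elim x z)) (Ck.ext' fun β y => ?_)
      rw [slice_sumComm_apply, slice_apply, slice_apply, reindex_apply, reindex_apply, he', he',
        he, he]
  · refine congrArg Φ (Ck.ext' fun α x => ?_)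
    refine congrArg B (a₁ := (Ck.reindex (Equiv.sumComm V W') f').slice α x)
      (a₂ := ((Ck.reindex (Equiv.sumComm V (W ⊕ W')) f).slice α x).curry.postcomp A)
      (Ck.ext' fun γ z => ?_)
    rw [slice_sumComm_apply]
    refine congrArg A (a₁ := (Ck.reindex e f).slice (Sum.elim α γ) (Sum.elim x z))
      (a₂ := ((Ck.reindex (Equiv.sumComm V (W ⊕ W')) f).slice α x).slice γ z)
      (Ck.ext' fun β y => ?_)
    rw [slice_apply, reindex_apply, slice_apply, slice_sumComm_apply, he, he]

theorem formKern_apply (K : SmoothKernel d r ℓ) (f : Ck d r k ℓ (Fin 1 ⊕ Fin 1) ℂ) :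
    K.formKern k f = -∫ z : Pt d r ℓ × Pt d r ℓ, K z.2 z.1 * evalPair f z.1 z.2
      ∂((ptMeasure d r ℓ).prod (ptMeasure d r ℓ)) := rfl

/-- Pairing with a continuous density is a Bochner integral in 𝒞_k, and any continuous functional Φ
passes through it. This suffices: the kernels of F are arbitrary distributions, but those of the
powers of ⟨ψ̄, K ψ⟩ are built from this one and from a point evaluation. -/
theorem commutes_formKern (K : SmoothKernel d r ℓ) : Commutes (K.formKern k) := by
  intro V _ _ Φ f
  let y : Pt d r ℓ × Pt d r ℓ → Fin 1 ⊕ Fin 1 → Pt d r ℓ := fun z =>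
    Sum.elim (fun _ => z.1) (fun _ => z.2)
  have hy : Continuous y := continuous_pi fun u => by
    rcases u with u | u
    · exact continuous_fst
    · exact continuous_snd
  let g : Pt d r ℓ × Pt d r ℓ → Ck d r k ℓ V ℂ := fun z => K z.2 z.1 • f.slice (fun _ => 0) (y z)
  have hg : Integrable g ((ptMeasure d r ℓ).prod (ptMeasure d r ℓ)) :=
    ((K.toFun.continuous.comp continuous_swap).smul
      ((f.continuous_slice _).comp hy)).integrable_of_hasCompactSupport
      (HasCompactSupport.of_compactSpace _)
  have h1 : tensor Φ (K.formKern k) f =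
      Φ (-∫ z, g z ∂((ptMeasure d r ℓ).prod (ptMeasure d r ℓ))) := by
    rw [map_neg, ← ContinuousLinearMap.integral_comp_comm Φ hg, tensor_apply, formKern_apply]
    congr 2
    funext z
    rw [map_smul]
    rfl
  rw [h1, tensor_apply]
  congr 1
  refine Ck.ext' fun α x => ?_
  rw [curry_postcomp_apply, formKern_apply, ← Ck.derivL_apply, map_neg,
    ← ContinuousLinearMap.integral_comp_comm _ hg]
  congr 2
  funext z
  rw [map_smul, Ck.derivL_apply]
  exact congrArg (K z.2 z.1 * ·) (slice_sumComm_apply f α x _ (y z)).symm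

theorem Commutes.mulTerm {N M n n' m m' : ℕ} (hN : n + n' = N) (hM : m + m' = M)
    {A : Kern d r k ℓ n m} {B : Kern d r k ℓ n' m'} (hA : Commutes A) (hB : Commutes B) :
    Commutes (mulTerm hN hM A B) :=
  Commutes.smul (Commutes.sum _ fun _ _ => Commutes.sum _ fun _ _ =>
    (((hA.tensor hB).comp_reindex _).comp_reindex _).smul _) _

theorem commutes_powKern {A : Kern d r k ℓ 1 1} (hA : Commutes A) (p : ℕ) :
    Commutes (powKern A p) := by
  induction p with
  | zero => exact commutes_evalL _
  | succ p ih => exact ih.mulTerm rfl rfl hA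

end Commutes

/-! ### Powers of ⟨ψ̄, K ψ⟩ evaluated on Gram determinants. -/

section FredholmForm

variable {d r k : ℕ} {ℓ : ℝ} [Fact (0 < ℓ)]
variable {H : Type} [NormedAddCommGroup H] [NormedSpace ℂ H]

/-- The Fredholm data of the form `⟨ψ̄, K ψ⟩` and the covariance `⟨g₁(x), g₂(y)⟩`. -/
def SmoothKernel.fredholm (K : SmoothKernel d r ℓ) (pair : H →L[ℂ] H →L[ℂ] ℂ)
    (hp : ∀ (n : ℕ) (a b : Fin n → H), ‖gramDet pair a b‖ ≤ (∏ i, ‖a i‖) * ∏ i, ‖b i‖)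
    (g₁ g₂ : Ck d r k ℓ Unit H) : FredholmData H (Pt d r ℓ × Pt d r ℓ) where
  pair := pair
  norm_gramDet_le := hp
  μ := (ptMeasure d r ℓ).prod (ptMeasure d r ℓ)
  finite := inferInstance
  κ := ⟨fun z => K z.2 z.1, K.toFun.continuous.comp continuous_swap⟩
  s := ⟨fun z => g₁.one 0 z.1, (g₁.continuous_one 0).comp continuous_fst⟩
  t := ⟨fun z => g₂.one 0 z.2, (g₂.continuous_one 0).comp continuous_snd⟩

/-- The sign `(-1)^{n(n-1)/2}`. -/
def gaussSign (n : ℕ) : ℂ := (-1) ^ (n * (n - 1) / 2)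

/-- The exponents satisfy C(n + p, 2) = C(n, 2) + C(p, 2) + n p. The extra sign (-1)^{n p} is the
one that `mulTerm` produces in moving ψ past ψ̄. -/
theorem gaussSign_add (n p : ℕ) : gaussSign (n + p) = gaussSign n * gaussSign p * (-1) ^ (n * p) := by
  have h1 : ∀ n : ℕ, (n * (n - 1) / 2 : ℕ) = n.choose 2 := fun n => (Nat.choose_two_right n).symm
  unfold gaussSign
  rw [h1, h1, h1, ← pow_add, ← pow_add]
  congr 1
  induction p with
  | zero => simp
  | succ p ih =>
    rw [← add_assoc, Nat.choose_succ_succ' (n + p) 1, ih, Nat.choose_succ_succ' p 1, Nat.choose_one_right,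
      Nat.choose_one_right]
    ring

theorem gaussSign_mul_self (n : ℕ) : gaussSign n * gaussSign n = 1 := by
  unfold gaussSign
  rw [← mul_pow]
  simp

/-- Each factor of the form fixes the last pair of variables, moves its two vectors to the fixed
ones and integrates: the recursion defining `minor`. The minus sign of `formKern` gives (-1)^p, the
reordering of fields ε_p, and the factorials of the alternations telescope to (p!)². -/
theorem powKern_gramCk (K : SmoothKernel d r ℓ) (pair : H →L[ℂ] H →L[ℂ] ℂ)
    (hp : ∀ (n : ℕ) (a b : Fin n → H), ‖gramDet pair a b‖ ≤ (∏ i, ‖a i‖) * ∏ i, ‖b i‖)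
    (g₁ g₂ : Ck d r k ℓ Unit H) (p : ℕ) {n : ℕ} (a b : Fin n → H) :
    powKern (K.formKern k) p (gramCk pair g₁ g₂ p a b) =
      gaussSign p * (p ! : ℂ) ^ 2 * (-1) ^ p * (K.fredholm pair hp g₁ g₂).minor p a b := by
  induction p generalizing n with
  | zero =>
    have h0 : powKern (K.formKern k) 0 (gramCk pair g₁ g₂ 0 a b) = gramDet pair a b :=
      (gramDet_equiv pair (Equiv.sumEmpty (Fin n) (Fin 0)).symm (fun _ => rfl) (fun _ => rfl)).symm
    rw [h0]
    simp [gaussSign, FredholmData.minor_zero, SmoothKernel.fredholm]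
  | succ p ih =>
    have hf : ∀ n : ℕ, (n ! : ℂ) ≠ 0 := fun n => by exact_mod_cast n.factorial_ne_zero
    have h1 : powKern (K.formKern k) (p + 1) = mulTerm rfl rfl (powKern (K.formKern k) p)
      (K.formKern k) := rfl
    rw [h1, mulTerm_apply_antisymm _ _ _ _ _ (reindex_gramCk pair g₁ g₂ a b), tensor_apply,
      formKern_apply, FredholmData.minor_succ]
    have h2 : ∀ z : Pt d r ℓ × Pt d r ℓ, evalPair ((Ck.reindex (splitEquiv rfl rfl)
        (gramCk pair g₁ g₂ (p + 1) a b)).curry.postcomp (powKern (K.formKern k) p)) z.1 z.2 =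
        gaussSign p * (p ! : ℂ) ^ 2 * (-1) ^ p * (K.fredholm pair hp g₁ g₂).minor p
          (Fin.cons ((K.fredholm pair hp g₁ g₂).s z) a : Fin (n + 1) → H)
          (Fin.cons ((K.fredholm pair hp g₁ g₂).t z) b : Fin (n + 1) → H) := by
      intro z
      rw [← ih, evalPair, Ck.eval, curry_postcomp_apply, slice_gramCk_last]
      rfl
    have h3 : (fun z : Pt d r ℓ × Pt d r ℓ => K z.2 z.1 *
        evalPair ((Ck.reindex (splitEquiv rfl rfl)
        (gramCk pair g₁ g₂ (p + 1) a b)).curry.postcomp (powKern (K.formKern k) p)) z.1 z.2) =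
      fun z => (gaussSign p * (p ! : ℂ) ^ 2 * (-1) ^ p) * ((K.fredholm pair hp g₁ g₂).κ z *
        (K.fredholm pair hp g₁ g₂).minor p
          (Fin.cons ((K.fredholm pair hp g₁ g₂).s z) a : Fin (n + 1) → H)
          (Fin.cons ((K.fredholm pair hp g₁ g₂).t z) b : Fin (n + 1) → H)) := by
      funext z
      rw [h2]
      exact mul_left_comm _ _ _
    rw [h3, integral_const_mul]
    change _ * (_ * _ * -(_ * ∫ z, _ ∂(K.fredholm pair hp g₁ g₂).μ)) = _
    rw [gaussSign_add p 1]
    have := hf p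
    have h4 : gaussSign 1 = 1 := by simp [gaussSign]
    rw [h4, Nat.factorial_one, Nat.cast_one, mul_one, mul_one]
    field_simp
    ring

end FredholmForm

/-! ### Jointly smooth functions as smooth families of continuous functions. -/

section SmoothFamilies

set_option linter.unusedSectionVars false

variable {d r : ℕ} {ℓ : ℝ} [Fact (0 < ℓ)]

/-- The projection `ℝ^d → 𝕋`. -/
def torusMk (ℓ : ℝ) (x : Fin d → ℝ) : Torus d ℓ := fun μ => (x μ : AddCircle ℓ)

theorem isOpenQuotientMap_torusMk : IsOpenQuotientMap (torusMk (d := d) ℓ) :=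
  IsOpenQuotientMap.piMap fun _ => QuotientAddGroup.isOpenQuotientMap_mk

variable {F : Type} [NormedAddCommGroup F] [NormedSpace ℝ F]

/-- A product of open quotient maps is again a quotient map, so continuity can be tested after
lifting 𝕋 to ℝ^d. -/
theorem continuous_uncurry_of_lift (f : (Fin d → ℝ) → Pt d r ℓ → F)
    (hf : ∀ b : Fin r, Continuous fun p : (Fin d → ℝ) × (Fin d → ℝ) => f p.1 (b, torusMk ℓ p.2)) :
    Continuous fun q : (Fin d → ℝ) × Pt d r ℓ => f q.1 q.2 := by
  have h1 : ∀ b : Fin r, Continuous fun q : (Fin d → ℝ) × Torus d ℓ => f q.1 (b, q.2) := by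
    intro b
    have hq := (IsOpenQuotientMap.id (X := Fin d → ℝ)).prodMap
      (isOpenQuotientMap_torusMk (d := d) (ℓ := ℓ))
    exact hq.isQuotientMap.continuous_iff.2 (hf b)
  have h2 : Continuous fun q : Fin r × ((Fin d → ℝ) × Torus d ℓ) => f q.2.1 (q.1, q.2.2) :=
    continuous_prod_of_discrete_left.2 h1
  exact h2.comp ((continuous_fst.comp continuous_snd).prodMk
    (continuous_fst.prodMk (continuous_snd.comp continuous_snd)))

section

variable {X E L F : Type*} [TopologicalSpace X] [CompactSpace X] [NormedAddCommGroup E]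
  [NormedSpace ℝ E] [NormedAddCommGroup L] [NormedSpace ℝ L] [NormedAddCommGroup F]
  [NormedSpace ℝ F]

/-- A continuous function with values in linear maps, as a linear map into continuous functions. -/
def swapCLM (T : L →L[ℝ] E →L[ℝ] F) : C(X, L) →L[ℝ] E →L[ℝ] C(X, F) :=
  LinearMap.mkContinuous₂
    (LinearMap.mk₂ ℝ (fun (g : C(X, L)) (v : E) => (⟨fun y => T (g y) v, by fun_prop⟩ : C(X, F)))
      (fun g g' v => ContinuousMap.ext fun y => by simp)
      (fun c g v => ContinuousMap.ext fun y => by simp)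
      (fun g v w => ContinuousMap.ext fun y => map_add (T (g y)) v w)
      (fun c g v => ContinuousMap.ext fun y => map_smul (T (g y)) c v)) ‖T‖
    fun g v => by
      refine (ContinuousMap.norm_le _ (by positivity)).2 fun y => ?_
      refine ((T (g y)).le_opNorm v).trans (mul_le_mul_of_nonneg_right ?_ (norm_nonneg _))
      exact (T.le_opNorm _).trans
        (mul_le_mul_of_nonneg_left (g.norm_coe_le_norm y) (norm_nonneg _))

theorem swapCLM_apply (T : L →L[ℝ] E →L[ℝ] F) (g : C(X, L)) (v : E) (y : X) :
    swapCLM T g v y = T (g y) v := rfl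

/-- On a ball where f' stays within c of f' x in sup norm, the mean value inequality bounds the
remainder uniformly in y. -/
theorem hasFDerivAt_continuousMap {T : L →L[ℝ] E →L[ℝ] F} (hT : ‖T‖ ≤ 1)
    {f : E → C(X, F)} {f' : E → C(X, L)} (hc : Continuous f')
    (h : ∀ x y, HasFDerivAt (fun x => f x y) (T (f' x y)) x) (x : E) :
    HasFDerivAt f (swapCLM T (f' x)) x := by
  rw [hasFDerivAt_iff_isLittleO, Asymptotics.isLittleO_iff]
  intro c hcpos
  obtain ⟨δ, hδ, hδ'⟩ := Metric.continuous_iff.1 hc x c hcpos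
  filter_upwards [Metric.ball_mem_nhds x hδ] with w hw
  refine (ContinuousMap.norm_le _ (by positivity)).2 fun y => ?_
  have key := Convex.norm_image_sub_le_of_norm_hasFDerivWithin_le
    (f := fun v => f v y - T (f' x y) v) (f' := fun v => T (f' v y) - T (f' x y))
    (s := Metric.ball x δ) (x := x) (y := w) (C := c) (𝕜 := ℝ)
    (fun v _ => ((h v y).sub (T (f' x y)).hasFDerivAt).hasFDerivWithinAt)
    (fun v hv => by
      have h1 := hδ' v (by simpa using hv)
      rw [dist_eq_norm] at h1
      rw [← map_sub]
      refine (T.le_opNorm _).trans ((mul_le_of_le_one_left (norm_nonneg _) hT).trans ?_)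
      exact (ContinuousMap.norm_coe_le_norm (f' v - f' x) y).trans h1.le)
    (convex_ball _ _) (Metric.mem_ball_self hδ) hw
  have e : (f w - f x - swapCLM T (f' x) (w - x)) y =
      f w y - T (f' x y) w - (f x y - T (f' x y) x) := by
    simp only [ContinuousMap.sub_apply, swapCLM_apply, map_sub]
    abel
  rw [e]
  exact key

theorem contDiff_succ_continuousMap {T : L →L[ℝ] E →L[ℝ] F} (hT : ‖T‖ ≤ 1)
    {f : E → C(X, F)} {f' : E → C(X, L)} {n : ℕ} (hf' : ContDiff ℝ n f')
    (h : ∀ x y, HasFDerivAt (fun x => f x y) (T (f' x y)) x) : ContDiff ℝ (n + 1 : ℕ) f := by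
  rw [Nat.cast_succ, contDiff_succ_iff_hasFDerivAt]
  have hS : IsBoundedLinearMap ℝ fun g : C(X, L) => swapCLM (X := X) T g :=
    { map_add := map_add _
      map_smul := map_smul _
      bound := ⟨‖T‖ + 1, by positivity, fun g => by
        refine ContinuousLinearMap.opNorm_le_bound _ (by positivity) fun v => ?_
        refine (ContinuousMap.norm_le _ (by positivity)).2 fun y => ?_
        rw [swapCLM_apply]
        refine ((T (g y)).le_opNorm v).trans (mul_le_mul_of_nonneg_right ?_ (norm_nonneg _))
        refine (T.le_opNorm _).trans (mul_le_mul ?_ (g.norm_coe_le_norm y) ?_ ?_) <;>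
          first | positivity | linarith⟩ }
  exact ⟨fun x => swapCLM T (f' x), hS.contDiff.comp hf',
    hasFDerivAt_continuousMap hT hf'.continuous h⟩

end

/-- A jointly smooth function on `ℝ^d × 𝕋` is a smooth family of continuous functions. -/
theorem contDiff_continuousMap (n : ℕ) (f : (Fin d → ℝ) → C(Pt d r ℓ, F))
    (hf : ∀ b : Fin r, ContDiff ℝ ∞ fun p : (Fin d → ℝ) × (Fin d → ℝ) =>
      f p.1 (b, torusMk ℓ p.2)) : ContDiff ℝ n f := by
  -- The partial derivative in the first variable is again a jointly smooth family, now with values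
  -- in linear maps into F; hence the induction runs over all target spaces.
  induction n generalizing F with
  | zero =>
    refine contDiff_zero.2 ?_
    exact (ContinuousMap.curry ⟨_, continuous_uncurry_of_lift (fun x y => f x y)
      fun b => (hf b).continuous⟩).continuous
  | succ n ih =>
    let J : (Fin d → ℝ) →L[ℝ] (Fin d → ℝ) × (Fin d → ℝ) := ContinuousLinearMap.inl ℝ _ _
    have hd : ∀ (b : Fin r) (x y : Fin d → ℝ), HasFDerivAt (fun x => f x (b, torusMk ℓ y))
        ((fderiv ℝ (fun p : (Fin d → ℝ) × (Fin d → ℝ) => f p.1 (b, torusMk ℓ p.2)) (x, y)).comp J)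
        x := by
      intro b x y
      have h1 := (((hf b).differentiable (by simp)) (x, y)).hasFDerivAt
      exact HasFDerivAt.comp (g := fun p : (Fin d → ℝ) × (Fin d → ℝ) => f p.1 (b, torusMk ℓ p.2))
        (f := fun x => (x, y)) x h1 (hasFDerivAt_prodMk_left x y)
    have hd' : ∀ (b : Fin r) (x y : Fin d → ℝ), fderiv ℝ (fun x => f x (b, torusMk ℓ y)) x =
        (fderiv ℝ (fun p : (Fin d → ℝ) × (Fin d → ℝ) => f p.1 (b, torusMk ℓ p.2)) (x, y)).comp J :=
      fun b x y => (hd b x y).fderiv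
    have hsm : ∀ b : Fin r, ContDiff ℝ ∞ fun p : (Fin d → ℝ) × (Fin d → ℝ) =>
        fderiv ℝ (fun x => f x (b, torusMk ℓ p.2)) p.1 := by
      intro b
      simp only [hd']
      exact ((hf b).fderiv_right (m := ∞) (by simp)).clm_comp contDiff_const
    have hcont := continuous_uncurry_of_lift (ℓ := ℓ)
      (fun x y => fderiv ℝ (fun x => f x y) x) fun b => (hsm b).continuous
    let f' : (Fin d → ℝ) → C(Pt d r ℓ, (Fin d → ℝ) →L[ℝ] F) := fun x =>
      ⟨fun y => fderiv ℝ (fun x => f x y) x,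
        hcont.comp (continuous_const.prodMk continuous_id)⟩
    have hf' : ContDiff ℝ n f' := ih f' hsm
    refine contDiff_succ_continuousMap (X := Pt d r ℓ) (E := Fin d → ℝ)
      (L := (Fin d → ℝ) →L[ℝ] F) (F := F) (T := ContinuousLinearMap.id ℝ ((Fin d → ℝ) →L[ℝ] F))
      ContinuousLinearMap.norm_id_le (f := f) (f' := f') hf' fun x y => ?_
    obtain ⟨b, y⟩ := y
    obtain ⟨y, rfl⟩ := isOpenQuotientMap_torusMk.surjective y
    exact (hd b x y).differentiableAt.hasFDerivAt

end SmoothFamilies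

/-! ### The bilinear pairing on L² and operators given by families of vectors. -/

section Pairing

variable {d r : ℕ} {ℓ : ℝ} [Fact (0 < ℓ)]

/-- Complex conjugation on `L²`. -/
def conjL2 : L2 d r ℓ →L⋆[ℂ] L2 d r ℓ :=
  LinearMap.mkContinuous
    { toFun := fun f => star f
      map_add' := fun f g => by
        refine Lp.ext ?_
        filter_upwards [Lp.coeFn_star (f + g), Lp.coeFn_star f, Lp.coeFn_star g, Lp.coeFn_add f g,
          Lp.coeFn_add (star f) (star g)] with x h1 h2 h3 h4 h5
        rw [h1, h5, Pi.star_apply, h4]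
        simp [h2, h3]
      map_smul' := fun c f => by
        refine Lp.ext ?_
        filter_upwards [Lp.coeFn_star (c • f), Lp.coeFn_star f, Lp.coeFn_smul c f,
          Lp.coeFn_smul ((starRingEnd ℂ) c) (star f)] with x h1 h2 h3 h4
        rw [h1, h4]
        simp [h2, h3] } 1
    fun f => by
      rw [one_mul]
      refine Lp.norm_le_norm_of_ae_le ?_
      filter_upwards [Lp.coeFn_star f] with x hx
      change ‖(star f : L2 d r ℓ) x‖ ≤ _
      rw [hx]
      simp

theorem coeFn_conjL2 (f : L2 d r ℓ) :
    (conjL2 f : L2 d r ℓ) =ᵐ[ptMeasure d r ℓ] fun x => star (f x) := Lp.coeFn_star f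

theorem conjL2_conjL2 (f : L2 d r ℓ) : conjL2 (conjL2 f) = f := star_star f

theorem norm_conjL2_le (f : L2 d r ℓ) : ‖conjL2 f‖ ≤ ‖f‖ := by
  refine Lp.norm_le_norm_of_ae_le ?_
  filter_upwards [coeFn_conjL2 f] with x hx
  rw [hx]
  simp

/-- The bilinear pairing `∫ a(z) b(z) dz`. -/
def pairL2 : L2 d r ℓ →L[ℂ] L2 d r ℓ →L[ℂ] ℂ := (innerSL ℂ).comp conjL2

theorem pairL2_eq_inner (a b : L2 d r ℓ) : pairL2 a b = inner ℂ (conjL2 a) b := rfl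

theorem pairL2_apply (a b : L2 d r ℓ) : pairL2 a b = ∫ z, a z * b z ∂(ptMeasure d r ℓ) := by
  rw [pairL2_eq_inner, MeasureTheory.L2.inner_def]
  refine integral_congr_ae ?_
  filter_upwards [coeFn_conjL2 a] with z hz
  rw [hz]
  simp [mul_comm]

theorem pairL2_comm (a b : L2 d r ℓ) : pairL2 a b = pairL2 b a := by
  simp only [pairL2_apply, mul_comm]

theorem exists_eq_pairL2 (L : L2 d r ℓ →L[ℂ] ℂ) : ∃ a, L = pairL2 a := by
  refine ⟨conjL2 ((InnerProductSpace.toDual ℂ (L2 d r ℓ)).symm L), ?_⟩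
  ext b
  rw [pairL2_eq_inner, conjL2_conjL2, InnerProductSpace.toDual_symm_apply]

/-- G = ∫ G₁ G₂ has no complex conjugate. Conjugating the left vectors turns the bilinear pairing
into the inner product without increasing norms. -/
theorem norm_gramDet_pairL2_le (n : ℕ) (a b : Fin n → L2 d r ℓ) :
    ‖gramDet pairL2 a b‖ ≤ (∏ i, ‖a i‖) * ∏ i, ‖b i‖ :=
  (norm_det_inner_le (fun i => conjL2 (a i)) b).trans
    (mul_le_mul_of_nonneg_right (Finset.prod_le_prod (fun _ _ => norm_nonneg _)
      fun i _ => norm_conjL2_le (a i)) (Finset.prod_nonneg fun _ _ => norm_nonneg _))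

/-- The transpose of an operator with respect to the bilinear pairing. -/
def transposeL2 (A : L2 d r ℓ →L[ℂ] L2 d r ℓ) : L2 d r ℓ →L[ℂ] L2 d r ℓ :=
  conjL2.comp ((ContinuousLinearMap.adjoint A).comp conjL2)

theorem pairL2_transposeL2 (A : L2 d r ℓ →L[ℂ] L2 d r ℓ) (a f : L2 d r ℓ) :
    pairL2 a (transposeL2 A f) = pairL2 f (A a) := by
  change pairL2 a (conjL2 ((ContinuousLinearMap.adjoint A) (conjL2 f))) = _
  rw [pairL2_comm, pairL2_eq_inner, conjL2_conjL2, ContinuousLinearMap.adjoint_inner_left,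
    pairL2_eq_inner]

/-- The continuous function `x ↦ ⟨γ(x), b⟩`. -/
def pairC (γ : C(Pt d r ℓ, L2 d r ℓ)) (b : L2 d r ℓ) : C(Pt d r ℓ, ℂ) :=
  ⟨fun x => pairL2 (γ x) b, by fun_prop⟩

/-- The operator `b ↦ ⟨γ(x), b⟩`. -/
def colOp (γ : C(Pt d r ℓ, L2 d r ℓ)) : L2 d r ℓ →L[ℂ] L2 d r ℓ :=
  LinearMap.mkContinuous
    { toFun := fun b => ContinuousMap.toLp 2 (ptMeasure d r ℓ) ℂ (pairC γ b)
      map_add' := fun b c => by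
        rw [← map_add]
        exact congrArg _ (ContinuousMap.ext fun x => map_add (pairL2 (γ x)) b c)
      map_smul' := fun c b => by
        rw [RingHom.id_apply, ← map_smul]
        exact congrArg _ (ContinuousMap.ext fun x => map_smul (pairL2 (γ x)) c b) }
    (‖ContinuousMap.toLp (E := ℂ) 2 (ptMeasure d r ℓ) ℂ‖ * ‖γ‖)
    fun b => by
      refine ((ContinuousMap.toLp 2 (ptMeasure d r ℓ) ℂ).le_opNorm (pairC γ b)).trans ?_
      rw [mul_assoc]
      refine mul_le_mul_of_nonneg_left ?_ (norm_nonneg _)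
      refine (ContinuousMap.norm_le _ (by positivity)).2 fun x => ?_
      refine (norm_inner_le_norm (𝕜 := ℂ) (conjL2 (γ x)) b).trans
        (mul_le_mul_of_nonneg_right ?_ (norm_nonneg _))
      exact (norm_conjL2_le _).trans (γ.norm_coe_le_norm x)

theorem coeFn_colOp (γ : C(Pt d r ℓ, L2 d r ℓ)) (b : L2 d r ℓ) :
    colOp γ b =ᵐ[ptMeasure d r ℓ] fun x => pairL2 (γ x) b :=
  ContinuousMap.coeFn_toLp (p := 2) (𝕜 := ℂ) (ptMeasure d r ℓ) (pairC γ b)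

/-- The operator `f ↦ ∫ f(y) γ(y) dy`. -/
def rowOp (γ : C(Pt d r ℓ, L2 d r ℓ)) : L2 d r ℓ →L[ℂ] L2 d r ℓ := transposeL2 (colOp γ)

/-- Every functional on L² is a pairing, so the formula is the transpose relation with `colOp`: an
L²-valued integral in weak form. -/
theorem apply_rowOp (L : L2 d r ℓ →L[ℂ] ℂ) (γ : C(Pt d r ℓ, L2 d r ℓ)) (f : L2 d r ℓ) :
    L (rowOp γ f) = ∫ y, f y * L (γ y) ∂(ptMeasure d r ℓ) := by
  obtain ⟨a, rfl⟩ := exists_eq_pairL2 L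
  rw [rowOp, pairL2_transposeL2, pairL2_apply]
  refine integral_congr_ae ?_
  filter_upwards [coeFn_colOp γ a] with y hy
  rw [hy, pairL2_comm]

theorem rowOp_comp (B : L2 d r ℓ →L[ℂ] L2 d r ℓ) (γ γ' : C(Pt d r ℓ, L2 d r ℓ))
    (h : ∀ y, γ' y = B (γ y)) : rowOp γ' = B.comp (rowOp γ) := by
  ext1 f
  have h1 : ∀ a, pairL2 a (rowOp γ' f) = pairL2 a (B (rowOp γ f)) := by
    intro a
    rw [apply_rowOp]
    have := apply_rowOp ((pairL2 a).comp B) γ f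
    simp only [ContinuousLinearMap.comp_apply] at this
    simp only [this, h]
  refine ext_inner_left ℂ fun v => ?_
  have := h1 (conjL2 v)
  rwa [pairL2_eq_inner, pairL2_eq_inner, conjL2_conjL2] at this

theorem SmoothKernel.op_eq_comp (G : SmoothKernel d r ℓ) (γ₁ γ₂ : C(Pt d r ℓ, L2 d r ℓ))
    (h : ∀ x y, G x y = pairL2 (γ₁ x) (γ₂ y)) : G.op = (colOp γ₁).comp (rowOp γ₂) := by
  ext1 f
  refine congrArg (ContinuousMap.toLp 2 (ptMeasure d r ℓ) ℂ) (ContinuousMap.ext fun x => ?_)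
  change _ = pairL2 (γ₁ x) (rowOp γ₂ f)
  rw [apply_rowOp]
  change ∫ y, G x y * f y ∂(ptMeasure d r ℓ) = _
  simp only [h, mul_comm]

end Pairing

/-! ### The operator M = G₂ K G₁ and the kernel of G (1 - K G)⁻¹. -/

section Resolvent

variable {d r k : ℕ} {ℓ : ℝ} [Fact (0 < ℓ)]

/-- The function underlying an element of `𝒞_k(𝕋; E)`. -/
def Ck.toC {E : Type} [NormedAddCommGroup E] [NormedSpace ℂ E] (g : Ck d r k ℓ Unit E) :
    C(Pt d r ℓ, E) :=
  ⟨g.one 0, g.continuous_one 0⟩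

theorem SmoothKernel.FactorsAs.eq_pairL2 {G : SmoothKernel d r ℓ}
    {G₁ G₂ : Ck d r k ℓ Unit (L2 d r ℓ)} (hG : G.FactorsAs G₁ G₂) (x y : Pt d r ℓ) :
    G x y = pairL2 (G₁.toC x) (G₂.toC y) :=
  (hG x y).trans (pairL2_apply _ _).symm

/-- Integrating over the argument u of ψ first gives (K G₁ x)(y), and integrating over y against
G₂(y) then gives G₂ K G₁ x. This is the cyclic rotation of K G = K G₁ G₂. -/
theorem represents_fredholm (K : SmoothKernel d r ℓ) (G₁ G₂ : Ck d r k ℓ Unit (L2 d r ℓ)) :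
    (K.fredholm pairL2 norm_gramDet_pairL2_le G₁ G₂).Represents
      ((rowOp G₂.toC).comp (K.op.comp (colOp G₁.toC))) := by
  intro L x
  change ∫ z : Pt d r ℓ × Pt d r ℓ, K z.2 z.1 * (pairL2 (G₁.toC z.1) x * L (G₂.toC z.2))
    ∂((ptMeasure d r ℓ).prod (ptMeasure d r ℓ)) = L (rowOp G₂.toC (K.op (colOp G₁.toC x)))
  have hc : Continuous fun z : Pt d r ℓ × Pt d r ℓ =>
      K z.2 z.1 * (pairL2 (G₁.toC z.1) x * L (G₂.toC z.2)) :=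
    (K.toFun.continuous.comp continuous_swap).mul (by fun_prop)
  rw [integral_prod_symm _ (hc.integrable_of_hasCompactSupport
    (HasCompactSupport.of_compactSpace _)), apply_rowOp]
  refine integral_congr_ae ?_
  filter_upwards [ContinuousMap.coeFn_toLp (p := 2) (𝕜 := ℂ) (ptMeasure d r ℓ)
    (K.apply (colOp G₁.toC x))] with y hy
  have hy' : (K.op (colOp G₁.toC x) : L2 d r ℓ) y = K.apply (colOp G₁.toC x) y := hy
  rw [hy']
  change _ = (∫ u, K y u * (colOp G₁.toC x : L2 d r ℓ) u ∂(ptMeasure d r ℓ)) * _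
  rw [← integral_mul_const]
  refine integral_congr_ae ?_
  filter_upwards [coeFn_colOp G₁.toC x] with u hu
  rw [hu, mul_assoc]

theorem contDiff_curry (G : SmoothKernel d r ℓ) (a : Fin r) :
    ContDiff ℝ ∞ fun x : Fin d → ℝ =>
      ContinuousMap.toLp 2 (ptMeasure d r ℓ) ℂ (G.toFun.curry (a, torusMk ℓ x)) := by
  refine contDiff_infty.2 fun n => ?_
  exact (ContinuousMap.toLp (E := ℂ) 2 (ptMeasure d r ℓ) ℝ).contDiff.comp
    (contDiff_continuousMap n (fun x => G.toFun.curry (a, torusMk ℓ x)) fun b => G.smooth a b)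

/-- The kernel `K(y, x)`. -/
def SmoothKernel.flip (K : SmoothKernel d r ℓ) : SmoothKernel d r ℓ where
  toFun := ⟨fun z => K z.2 z.1, K.toFun.continuous.comp continuous_swap⟩
  smooth a b := (K.smooth b a).comp (contDiff_snd.prodMk contDiff_fst)

theorem contDiff_bilinear_comp {X Y H : Type*} [NormedAddCommGroup X] [NormedSpace ℝ X]
    [NormedAddCommGroup Y] [NormedSpace ℝ Y] [NormedAddCommGroup H] [NormedSpace ℂ H]
    [NormedSpace ℝ H] [IsScalarTower ℝ ℂ H] (T : H →L[ℂ] H →L[ℂ] ℂ) (A : H →L[ℂ] H) {u : X → H}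
    {v : Y → H} (hu : ContDiff ℝ ∞ u) (hv : ContDiff ℝ ∞ v) :
    ContDiff ℝ ∞ fun p : X × Y => T (A (v p.2)) (u p.1) := by
  have h1 : ContDiff ℝ ∞ fun q : H × H => T q.1 q.2 :=
    (T.bilinearRestrictScalars ℝ).isBoundedBilinearMap.contDiff
  have h2 : ContDiff ℝ ∞ fun v : H => A v := (A.restrictScalars ℝ).contDiff
  exact h1.comp ((h2.comp (hv.comp contDiff_snd)).prodMk (hu.comp contDiff_fst))

/-- `1 + G₂ R K G₁`, which is the resolvent `(1 - G₂ K G₁)⁻¹` for `R = (1 - K G)⁻¹`. -/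
def resolvent (K : SmoothKernel d r ℓ) (G₁ G₂ : Ck d r k ℓ Unit (L2 d r ℓ))
    (R : L2 d r ℓ →L[ℂ] L2 d r ℓ) : L2 d r ℓ →L[ℂ] L2 d r ℓ :=
  1 + rowOp G₂.toC * (R * K.op) * colOp G₁.toC

/-- (1 - G₂ K G₁)(1 + G₂ R K G₁) = 1 + G₂ (R - 1 - K G R) K G₁, and the bracket vanishes when R is a
right inverse of 1 - K G. -/
theorem resolvent_sub {G K : SmoothKernel d r ℓ} {G₁ G₂ : Ck d r k ℓ Unit (L2 d r ℓ)}
    (hG : G.FactorsAs G₁ G₂) {R : L2 d r ℓ →L[ℂ] L2 d r ℓ} (hR : (1 - K.op * G.op) * R = 1)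
    (x : L2 d r ℓ) :
    resolvent K G₁ G₂ R x -
      ((rowOp G₂.toC).comp (K.op.comp (colOp G₁.toC))) (resolvent K G₁ G₂ R x) = x := by
  have h1 : G.op = colOp G₁.toC * rowOp G₂.toC := G.op_eq_comp _ _ hG.eq_pairL2
  have h2 : R = 1 + K.op * (colOp G₁.toC * rowOp G₂.toC) * R := by
    rw [← h1, ← sub_eq_iff_eq_add, ← hR]
    noncomm_ring
  have h3 : resolvent K G₁ G₂ R - rowOp G₂.toC * (K.op * colOp G₁.toC) * resolvent K G₁ G₂ R
      = 1 := by
    unfold resolvent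
    have : rowOp G₂.toC * (R * K.op) * colOp G₁.toC =
        rowOp G₂.toC * ((1 + K.op * (colOp G₁.toC * rowOp G₂.toC) * R) * K.op) * colOp G₁.toC := by
      rw [← h2]
    nth_rw 1 [this]
    noncomm_ring
  exact DFunLike.congr_fun h3 x

/-- The kernel `⟨G₁(x), B G₂(y)⟩` of the operator `G (1 - K G)⁻¹`. -/
def resolventKernel {G : SmoothKernel d r ℓ} (K : SmoothKernel d r ℓ)
    {G₁ G₂ : Ck d r k ℓ Unit (L2 d r ℓ)}
    (hG : G.FactorsAs G₁ G₂) (R : L2 d r ℓ →L[ℂ] L2 d r ℓ) : SmoothKernel d r ℓ where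
  toFun := ⟨fun z => pairL2 (G₁.toC z.1) (resolvent K G₁ G₂ R (G₂.toC z.2)), by fun_prop⟩
  smooth a b := by
    -- The factors are only k times differentiable. Smoothness comes from rewriting the kernel as
    -- G(x, y) + ∫ G(x, u) (R K G(·, y))(u) du, in which only G itself occurs.
    refine Eq.mpr (congrArg (ContDiff ℝ ∞) (funext fun p => ?_))
      ((G.smooth a b).add (contDiff_bilinear_comp pairL2 (R * K.op)
        (contDiff_curry G a) (contDiff_curry G.flip b)))
    have h1 : colOp G₁.toC (G₂.toC (b, torusMk ℓ p.2)) =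
        ContinuousMap.toLp 2 (ptMeasure d r ℓ) ℂ (G.flip.toFun.curry (b, torusMk ℓ p.2)) := by
      exact congrArg (ContinuousMap.toLp 2 (ptMeasure d r ℓ) ℂ)
        (ContinuousMap.ext fun x => (hG.eq_pairL2 x (b, torusMk ℓ p.2)).symm)
    have h2 : colOp G₂.toC (G₁.toC (a, torusMk ℓ p.1)) =
        ContinuousMap.toLp 2 (ptMeasure d r ℓ) ℂ (G.toFun.curry (a, torusMk ℓ p.1)) := by
      refine congrArg (ContinuousMap.toLp 2 (ptMeasure d r ℓ) ℂ) (ContinuousMap.ext fun y => ?_)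
      exact (pairL2_comm _ _).trans (hG.eq_pairL2 _ y).symm
    rw [← h1, ← h2, ← pairL2_transposeL2]
    refine Eq.trans ?_ (congrArg (· + _) (hG.eq_pairL2 _ _).symm)
    exact map_add (pairL2 (G₁.toC (a, torusMk ℓ p.1))) _ _

/-- G₁ (1 + G₂ R K G₁) G₂ = G + R-term = (with G = G₁ G₂) G (1 + R K G) = G R, where R now acts as a
left inverse of 1 - K G. -/
theorem op_resolventKernel {G K : SmoothKernel d r ℓ} {G₁ G₂ : Ck d r k ℓ Unit (L2 d r ℓ)}
    (hG : G.FactorsAs G₁ G₂) {R : L2 d r ℓ →L[ℂ] L2 d r ℓ} (hR : R * (1 - K.op * G.op) = 1) :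
    (resolventKernel K hG R).op = G.op * R := by
  have h1 : G.op = colOp G₁.toC * rowOp G₂.toC := G.op_eq_comp _ _ hG.eq_pairL2
  rw [(resolventKernel K hG R).op_eq_comp G₁.toC
    ⟨fun y => resolvent K G₁ G₂ R (G₂.toC y), by fun_prop⟩ fun x y => rfl,
    rowOp_comp (resolvent K G₁ G₂ R) G₂.toC _ fun y => rfl]
  change colOp G₁.toC * ((1 + rowOp G₂.toC * (R * K.op) * colOp G₁.toC) * rowOp G₂.toC) = _
  have h2 : R = 1 + R * K.op * (colOp G₁.toC * rowOp G₂.toC) := by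
    rw [← h1, ← sub_eq_iff_eq_add, ← hR]
    noncomm_ring
  nth_rw 2 [h2]
  rw [h1]
  noncomm_ring

end Resolvent

/-! ### Gaussian functionals and multiplication by the exponential. -/

section Gaussian

variable {d r k : ℕ} {ℓ : ℝ} [Fact (0 < ℓ)] {h : ℝ} [Fact (0 < h)]

/-- The functional `I` is given by the kernels `ε_n D_n / (n!)²`. -/
def HasGaussianKernels (D : ∀ n : ℕ, Ck d r k ℓ (Fin n ⊕ Fin n) ℂ)
    (I : Grassmann d r k ℓ h →L[ℂ] ℂ) : Prop :=
  ∀ F : Grassmann d r k ℓ h,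
    HasSum (fun n : ℕ => gaussSign n / ((n ! : ℂ) ^ 2) * F.kern n n (D n)) (I F)

theorem norm_gaussSign (n : ℕ) : ‖gaussSign n‖ = 1 := by simp [gaussSign]

/-- The bound h^{2n} divided by (n!)² is exactly the weight of degree (n, n). Hence the functional
has norm at most one. -/
theorem norm_gaussianTerm_le {D : ∀ n : ℕ, Ck d r k ℓ (Fin n ⊕ Fin n) ℂ}
    (hD : ∀ n, ‖D n‖ ≤ h ^ (n + n)) (F : Grassmann d r k ℓ h) (n : ℕ) :
    ‖gaussSign n / ((n ! : ℂ) ^ 2) * F.kern n n (D n)‖ ≤ weight h n n * ‖F.kern n n‖ := by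
  have h1 : ‖F.kern n n (D n)‖ ≤ ‖F.kern n n‖ * h ^ (n + n) :=
    ((F.kern n n).le_opNorm _).trans (mul_le_mul_of_nonneg_left (hD n) (norm_nonneg _))
  rw [norm_mul, norm_div, norm_gaussSign, norm_pow, Complex.norm_natCast]
  refine (mul_le_mul_of_nonneg_left h1 (by positivity)).trans (le_of_eq ?_)
  unfold weight
  field_simp

theorem summable_gaussianTerm {D : ∀ n : ℕ, Ck d r k ℓ (Fin n ⊕ Fin n) ℂ}
    (hD : ∀ n, ‖D n‖ ≤ h ^ (n + n)) (F : Grassmann d r k ℓ h) :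
    Summable fun n : ℕ => gaussSign n / ((n ! : ℂ) ^ 2) * F.kern n n (D n) :=
  Summable.of_norm_bounded (F.summable.comp_injective (i := fun n : ℕ => (n, n))
    fun _ _ e => congrArg Prod.fst e) (norm_gaussianTerm_le hD F)

theorem norm_tsum_gaussianTerm_le {D : ∀ n : ℕ, Ck d r k ℓ (Fin n ⊕ Fin n) ℂ}
    (hD : ∀ n, ‖D n‖ ≤ h ^ (n + n)) (F : Grassmann d r k ℓ h) :
    ‖∑' n : ℕ, gaussSign n / ((n ! : ℂ) ^ 2) * F.kern n n (D n)‖ ≤ ‖F‖ := by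
  have hinj : Function.Injective fun n : ℕ => (n, n) := fun _ _ e => congrArg Prod.fst e
  have hb := Summable.comp_injective
    (f := fun p : ℕ × ℕ => weight h p.1 p.2 * ‖F.kern p.1 p.2‖) F.summable hinj
  have h1 := tsum_of_norm_bounded hb.hasSum (norm_gaussianTerm_le hD F)
  have h2 := tsum_comp_le_tsum_of_inj (f := fun p : ℕ × ℕ => weight h p.1 p.2 * ‖F.kern p.1 p.2‖)
    F.summable (fun p => mul_nonneg (weight_nonneg h _ _) (norm_nonneg _)) hinj
  rw [F.norm_def]
  exact h1.trans h2

/-- The functional with kernels `ε_n D_n / (n!)²`. -/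
def gaussianFunctional {D : ∀ n : ℕ, Ck d r k ℓ (Fin n ⊕ Fin n) ℂ}
    (hD : ∀ n, ‖D n‖ ≤ h ^ (n + n)) : Grassmann d r k ℓ h →L[ℂ] ℂ :=
  LinearMap.mkContinuous
    { toFun := fun F => ∑' n : ℕ, gaussSign n / ((n ! : ℂ) ^ 2) * F.kern n n (D n)
      map_add' := fun F H => by
        rw [← (summable_gaussianTerm hD F).tsum_add (summable_gaussianTerm hD H)]
        exact tsum_congr fun n => mul_add _ (F.kern n n (D n)) (H.kern n n (D n))
      map_smul' := fun c F => by
        rw [RingHom.id_apply, smul_eq_mul, ← tsum_mul_left]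
        exact tsum_congr fun n => mul_left_comm _ c (F.kern n n (D n)) } 1
    fun F => by
      rw [one_mul]
      exact norm_tsum_gaussianTerm_le hD F

theorem hasGaussianKernels_gaussianFunctional {D : ∀ n : ℕ, Ck d r k ℓ (Fin n ⊕ Fin n) ℂ}
    (hD : ∀ n, ‖D n‖ ≤ h ^ (n + n)) : HasGaussianKernels D (gaussianFunctional hD) :=
  fun F => (summable_gaussianTerm hD F).hasSum

theorem HasGaussianKernels.apply_single {D : ∀ n : ℕ, Ck d r k ℓ (Fin n ⊕ Fin n) ℂ}
    {I : Grassmann d r k ℓ h →L[ℂ] ℂ} (hI : HasGaussianKernels D I) {n : ℕ}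
    (A : Kern d r k ℓ n n) (hA : A.IsAntisymm) :
    I (single h A hA) = gaussSign n / ((n ! : ℂ) ^ 2) * A (D n) := by
  refine (hI _).unique ?_
  have h1 := _root_.hasSum_single (f := fun n' : ℕ => gaussSign n' / ((n' ! : ℂ) ^ 2) *
    (single h A hA).kern n' n' (D n')) n fun n' hn' => by
      rw [kern_single, singleKern_of_ne A fun e => hn' e.1.symm]
      simp
  rwa [kern_single, singleKern_self] at h1

theorem HasGaussianKernels.apply_single_of_ne {D : ∀ n : ℕ, Ck d r k ℓ (Fin n ⊕ Fin n) ℂ}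
    {I : Grassmann d r k ℓ h →L[ℂ] ℂ} (hI : HasGaussianKernels D I) {n m : ℕ} (hnm : n ≠ m)
    (A : Kern d r k ℓ n m) (hA : A.IsAntisymm) : I (single h A hA) = 0 := by
  refine (hI _).unique ?_
  convert hasSum_zero with n'
  rw [kern_single, singleKern_of_ne A fun e => hnm (e.1.trans e.2.symm)]
  simp

/-- The determinants in the definition are determined by their values, so any realization in 𝒞_k may
replace the given one. Uniqueness of the integral follows. -/
theorem IsGaussianIntegral.hasGaussianKernels {G : SmoothKernel d r ℓ}
    {I : Grassmann d r k ℓ h →L[ℂ] ℂ} (hI : IsGaussianIntegral G I)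
    {D : ∀ n : ℕ, Ck d r k ℓ (Fin n ⊕ Fin n) ℂ}
    (hD : ∀ n x, (D n).eval x =
      Matrix.det (Matrix.of fun i j : Fin n => G (x (Sum.inl i)) (x (Sum.inr j)))) :
    HasGaussianKernels D I := by
  obtain ⟨D', hD', hI'⟩ := hI
  obtain rfl : D' = D := funext fun n => Ck.ext_eval fun x => (hD' n x).trans (hD n x).symm
  exact hI'

section Gram

variable {H : Type} [NormedAddCommGroup H] [NormedSpace ℂ H]
variable (pair : H →L[ℂ] H →L[ℂ] ℂ)
  (hp : ∀ (n : ℕ) (a b : Fin n → H), ‖gramDet pair a b‖ ≤ (∏ i, ‖a i‖) * ∏ i, ‖b i‖)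
  (g₁ g₂ : Ck d r k ℓ Unit H)

/-- The function `det ⟨g₁(x_i), g₂(y_j)⟩`. -/
def detCk (n : ℕ) : Ck d r k ℓ (Fin n ⊕ Fin n) ℂ :=
  gramCk pair g₁ g₂ n (Fin.elim0 : Fin 0 → H) Fin.elim0

theorem detCk_apply (n : ℕ) (α : Fin n ⊕ Fin n → MultiIdx d k) (x : Fin n ⊕ Fin n → Pt d r ℓ) :
    (detCk pair g₁ g₂ n).1 α x =
      gramDet pair (fun i => g₁.one (α (Sum.inl i)) (x (Sum.inl i)))
        (fun i => g₂.one (α (Sum.inr i)) (x (Sum.inr i))) := by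
  refine (gramDet_equiv pair (Equiv.emptySum (Fin 0) (Fin n)).symm (fun i => ?_)
    (fun i => ?_)).symm <;> rfl

theorem reindex_detCk (n : ℕ) (σ τ : Equiv.Perm (Fin n)) :
    Ck.reindex (Equiv.sumCongr σ τ) (detCk pair g₁ g₂ n) = sgn σ τ • detCk pair g₁ g₂ n :=
  reindex_gramCk pair g₁ g₂ _ _ σ τ

/-- The partial contraction of `det ⟨g₁(x_i), g₂(y_j)⟩` with `⟨ψ̄, K ψ⟩^p`. -/
def contraction (K : SmoothKernel d r ℓ) (n p : ℕ) : Ck d r k ℓ (Fin n ⊕ Fin n) ℂ :=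
  -- The prefactor inverts the one in `powKern_gramCk`, so that the values are plain minors.
  (gaussSign p * (-1) ^ p / (p ! : ℂ) ^ 2) •
    (Ck.reindex (Equiv.sumComm _ _)
      (Ck.reindex (splitEquiv (rfl : n + p = n + p) (rfl : n + p = n + p))
        (detCk pair g₁ g₂ (n + p)))).curry.postcomp (powKern (K.formKern k) p)

variable {g₁ g₂} in
theorem contraction_apply (K : SmoothKernel d r ℓ) (n p : ℕ) (α : Fin n ⊕ Fin n → MultiIdx d k)
    (x : Fin n ⊕ Fin n → Pt d r ℓ) :
    (contraction pair g₁ g₂ K n p).1 α x = (K.fredholm pair hp g₁ g₂).minor p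
      (fun i => g₁.one (α (Sum.inl i)) (x (Sum.inl i)))
      (fun i => g₂.one (α (Sum.inr i)) (x (Sum.inr i))) := by
  change (gaussSign p * (-1) ^ p / (p ! : ℂ) ^ 2) * powKern (K.formKern k) p
    ((Ck.reindex (Equiv.sumComm _ _)
      (Ck.reindex (splitEquiv (rfl : n + p = n + p) (rfl : n + p = n + p))
        (gramCk pair g₁ g₂ (n + p) (Fin.elim0 : Fin 0 → H) Fin.elim0))).slice α x) = _
  rw [slice_gramCk_first, powKern_gramCk K pair hp g₁ g₂]
  have h1 := gaussSign_mul_self p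
  have h2 : ((-1 : ℂ) ^ p) * (-1) ^ p = 1 := by rw [← mul_pow]; simp
  have h3 : (p ! : ℂ) ≠ 0 := by exact_mod_cast p.factorial_ne_zero
  field_simp
  generalize (K.fredholm pair hp g₁ g₂).minor p _ _ = w
  linear_combination ((-1 : ℂ) ^ p * (-1) ^ p * w) * h1 + w * h2

theorem norm_contraction_le (K : SmoothKernel d r ℓ) (n p : ℕ) :
    ‖contraction pair g₁ g₂ K n p‖ ≤
      (K.fredholm pair hp g₁ g₂).bound ^ p * (‖g₁‖ ^ n * ‖g₂‖ ^ n) := by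
  have hb := (K.fredholm pair hp g₁ g₂).bound_nonneg
  refine Ck.norm_le (by positivity) fun α x => ?_
  rw [contraction_apply pair hp]
  refine ((K.fredholm pair hp g₁ g₂).norm_minor_le _ _ _).trans ?_
  refine mul_le_mul_of_nonneg_left ?_ (by positivity)
  refine mul_le_mul ?_ ?_ (Finset.prod_nonneg fun _ _ => norm_nonneg _) (by positivity)
  · refine (Finset.prod_le_prod (fun _ _ => norm_nonneg _) fun i _ =>
      g₁.norm_apply_le _ _).trans (by simp)
  · refine (Finset.prod_le_prod (fun _ _ => norm_nonneg _) fun i _ =>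
      g₂.norm_apply_le _ _).trans (by simp)

/-- The series converges absolutely in 𝒞_k, and every derivative of its sum at a point is a Fredholm
minor, to which `series_eq` applies. Pointwise convergence would not do: an arbitrary distribution
is applied to the sum afterwards. -/
theorem hasSum_contraction (K : SmoothKernel d r ℓ) {M B : H →L[ℂ] H}
    (hM : (K.fredholm pair hp g₁ g₂).Represents M) (hB : ∀ x, B x - M (B x) = x) (n : ℕ) :
    HasSum (fun p : ℕ => ((-1) ^ p / (p ! : ℂ)) • contraction pair g₁ g₂ K n p)
      ((K.fredholm pair hp g₁ g₂).series 0 (Fin.elim0 : Fin 0 → H) Fin.elim0 •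
        detCk pair g₁ (g₂.postcomp B) n) := by
  set P := K.fredholm pair hp g₁ g₂ with hP
  have hs : Summable fun p : ℕ => ((-1) ^ p / (p ! : ℂ)) • contraction pair g₁ g₂ K n p := by
    refine Summable.of_norm_bounded
      ((Real.summable_pow_div_factorial P.bound).mul_right (‖g₁‖ ^ n * ‖g₂‖ ^ n)) fun p => ?_
    rw [norm_smul, norm_div, norm_pow, norm_neg, norm_one, one_pow, Complex.norm_natCast]
    refine (mul_le_mul_of_nonneg_left (norm_contraction_le pair hp g₁ g₂ K n p)
      (by positivity)).trans (le_of_eq ?_)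
    ring
  convert hs.hasSum using 1
  refine Ck.ext' fun α x => ?_
  have h1 := hs.hasSum.mapL (Ck.derivL α x)
  have h2 := P.hasSum_series 0 (fun i => g₁.one (α (Sum.inl i)) (x (Sum.inl i)))
    (fun i => g₂.one (α (Sum.inr i)) (x (Sum.inr i)))
  have h3 := h1.unique (h2.congr_fun fun p => ?_)
  · rw [Ck.derivL_apply] at h3
    rw [h3, P.series_eq hM hB (fun i => g₁.one (α (Sum.inl i)) (x (Sum.inl i)))]
    change _ * (detCk pair g₁ (g₂.postcomp B) n).1 α x = _
    rw [detCk_apply]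
    rfl
  · rw [map_smul, Ck.derivL_apply, contraction_apply pair hp, smul_eq_mul]
    rfl

variable {pair g₁ g₂} {I : Grassmann d r k ℓ h →L[ℂ] ℂ}

/-- By Fubini the power of the form is contracted first and A is applied to the result. The (-1)^{n
p} of the product cancels the one in ε_{n+p}, and the factor ((n + p)!)² of the alternation cancels
the one in the functional. -/
theorem HasGaussianKernels.apply_single_mul_pow (hI : HasGaussianKernels (detCk pair g₁ g₂) I)
    (K : SmoothKernel d r ℓ) {n : ℕ} (A : Kern d r k ℓ n n) (hA : A.IsAntisymm) (p : ℕ) :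
    I (single h A hA * npowRec p (K.form k h)) =
      gaussSign n / ((n ! : ℂ) ^ 2) * ((-1) ^ p * A (contraction pair g₁ g₂ K n p)) := by
  have e : npowRec p (K.form k h) = single h (powKern (K.formKern k) p) (isAntisymm_powKern _ p) :=
    npowRec_single (K.formKern k) p
  rw [e, single_mul_single, hI.apply_single, mulTerm_apply_antisymm _ _ _ _ _
    (reindex_detCk pair g₁ g₂ _), commutes_powKern (commutes_formKern K) p, tensor_apply,
    gaussSign_add, contraction, map_smul, smul_eq_mul]
  generalize A _ = w
  have h1 := gaussSign_mul_self p
  have h2 : ((-1 : ℂ) ^ p) * (-1) ^ p = 1 := by rw [← mul_pow]; simp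
  have h3 : ((-1 : ℂ) ^ (n * p)) * (-1) ^ (n * p) = 1 := by rw [← mul_pow]; simp
  have h4 : (p ! : ℂ) ≠ 0 := by exact_mod_cast p.factorial_ne_zero
  have h5 : (n ! : ℂ) ≠ 0 := by exact_mod_cast n.factorial_ne_zero
  have h6 : ((n + p) ! : ℂ) ≠ 0 := by exact_mod_cast (n + p).factorial_ne_zero
  field_simp
  linear_combination (gaussSign n * gaussSign p * w) * (h3 - h2)

theorem HasGaussianKernels.apply_exp (hI : HasGaussianKernels (detCk pair g₁ g₂) I)
    (K : SmoothKernel d r ℓ) :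
    I (K.form k h).exp =
      (K.fredholm pair hp g₁ g₂).series 0 (Fin.elim0 : Fin 0 → H) Fin.elim0 := by
  have h1 := (summable_exp_single (h := h) (K.formKern k)).hasSum.mapL I
  refine h1.unique (((K.fredholm pair hp g₁ g₂).hasSum_series 0 _ _).congr_fun fun p => ?_)
  rw [npowRec_single, map_smul, hI.apply_single, detCk, powKern_gramCk K pair hp g₁ g₂, smul_eq_mul]
  have h2 := gaussSign_mul_self p
  have h3 : (p ! : ℂ) ≠ 0 := by exact_mod_cast p.factorial_ne_zero
  rw [add_zero]
  generalize (K.fredholm pair hp g₁ g₂).minor p _ _ = w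
  field_simp
  linear_combination w * h2

theorem HasGaussianKernels.apply_single_mul_exp (hI : HasGaussianKernels (detCk pair g₁ g₂) I)
    (K : SmoothKernel d r ℓ) {M B : H →L[ℂ] H}
    (hM : (K.fredholm pair hp g₁ g₂).Represents M) (hB : ∀ x, B x - M (B x) = x) {n : ℕ}
    (A : Kern d r k ℓ n n) (hA : A.IsAntisymm) :
    I (single h A hA * (K.form k h).exp) = I (K.form k h).exp *
      (gaussSign n / ((n ! : ℂ) ^ 2) * A (detCk pair g₁ (g₂.postcomp B) n)) := by
  have h1 := (summable_exp_single (h := h) (K.formKern k)).hasSum.mapL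
    (I.comp (Grassmann.mulL (single h A hA)))
  have h2 := ((hasSum_contraction pair hp g₁ g₂ K hM hB n).mapL A).mul_left
    (gaussSign n / ((n ! : ℂ) ^ 2))
  rw [hI.apply_exp hp K, mul_left_comm]
  rw [map_smul, smul_eq_mul] at h2
  refine h1.unique (h2.congr_fun fun p => ?_)
  have h3 := hI.apply_single_mul_pow K A hA p
  rw [map_smul, map_smul, smul_eq_mul, smul_eq_mul]
  refine (congrArg ((p ! : ℂ)⁻¹ * ·) h3).trans ?_
  ring

theorem HasGaussianKernels.apply_single_mul_exp_of_ne
    {D : ∀ n : ℕ, Ck d r k ℓ (Fin n ⊕ Fin n) ℂ} (hI : HasGaussianKernels D I)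
    (K : SmoothKernel d r ℓ) {n m : ℕ} (hnm : n ≠ m)
    (A : Kern d r k ℓ n m) (hA : A.IsAntisymm) : I (single h A hA * (K.form k h).exp) = 0 := by
  have h1 := (summable_exp_single (h := h) (K.formKern k)).hasSum.mapL
    (I.comp (Grassmann.mulL (single h A hA)))
  refine h1.unique (hasSum_zero.congr_fun fun p => ?_)
  rw [npowRec_single, map_smul, ContinuousLinearMap.comp_apply, Grassmann.mulL_apply,
    single_mul_single, hI.apply_single_of_ne (by omega), smul_zero]

/-- Multiplication by `e^{⟨ψ̄, K ψ⟩}` and normalization change the Gram vectors `g₂` to `B g₂`. -/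
theorem HasGaussianKernels.mul_exp (hI : HasGaussianKernels (detCk pair g₁ g₂) I)
    (K : SmoothKernel d r ℓ) {M B : H →L[ℂ] H}
    (hM : (K.fredholm pair hp g₁ g₂).Represents M) (hB : ∀ x, B x - M (B x) = x)
    {J : Grassmann d r k ℓ h →L[ℂ] ℂ}
    (hJ : ∀ F, J F = I (F * (K.form k h).exp) / I (K.form k h).exp)
    (hZ : I (K.form k h).exp ≠ 0) :
    HasGaussianKernels (detCk pair g₁ (g₂.postcomp B)) J := by
  intro F
  -- By continuity J is determined on single-degree elements, and the exponential, having equal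
  -- degrees in ψ and ψ̄, lets only the diagonal ones contribute.
  have h1 := (hasSum_single F).mapL J
  have h2 := (hasSum_diagonal_iff (f := fun p : ℕ × ℕ =>
    J (single h (F.kern p.1 p.2) (F.isAntisymm p.1 p.2))) (fun n m hnm => by
      rw [hJ, hI.apply_single_mul_exp_of_ne K hnm, zero_div])).2 h1
  refine h2.congr_fun fun n => ?_
  rw [hJ, hI.apply_single_mul_exp hp K hM hB, mul_div_cancel_left₀ _ hZ]

end Gram

end Gaussian

theorem eval_detCk {d r k : ℕ} {ℓ : ℝ} [Fact (0 < ℓ)] {G : SmoothKernel d r ℓ}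
    {g₁ g₂ : Ck d r k ℓ Unit (L2 d r ℓ)}
    (hG : ∀ x y, G x y = pairL2 (g₁.one 0 x) (g₂.one 0 y)) (n : ℕ)
    (x : Fin n ⊕ Fin n → Pt d r ℓ) : (detCk pairL2 g₁ g₂ n).eval x =
      Matrix.det (Matrix.of fun i j : Fin n => G (x (Sum.inl i)) (x (Sum.inr j))) := by
  refine (detCk_apply pairL2 g₁ g₂ n _ x).trans ?_
  simp only [gramDet, hG]

end GrassmannField

end

/-! ### The theorem. -/

open GrassmannField in
theorem mainTheorem7 (d r k : ℕ) (ℓ : ℝ) [Fact (0 < ℓ)] (h : ℝ) [Fact (0 < h)]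
    (G K : GrassmannField.SmoothKernel d r ℓ)
    (G₁ G₂ : GrassmannField.Ck d r k ℓ Unit (GrassmannField.L2 d r ℓ))
    (hfac : G.FactorsAs G₁ G₂) (hh : GrassmannField.gramBound G₁ G₂ ≤ h)
    (hKG : ‖K.op * G.op‖ < 1) :
    -- the Gaussian integral with covariance `G` on `𝒢_h`
    (∃! I_G : GrassmannField.Grassmann d r k ℓ h →L[ℂ] ℂ,
      GrassmannField.IsGaussianIntegral G I_G) ∧
    ∀ I_G : GrassmannField.Grassmann d r k ℓ h →L[ℂ] ℂ,
      GrassmannField.IsGaussianIntegral G I_G →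
      IsUnit (1 - K.op * G.op) ∧
      -- the exponential series for `e^{⟨ψ̄, K ψ⟩}` converges in `𝒢_h`
      Summable (fun p : ℕ => (Nat.factorial p : ℂ)⁻¹ • npowRec p (K.form k h)) ∧
      I_G (K.form k h).exp ≠ 0 ∧
      ∃ (G' : GrassmannField.SmoothKernel d r ℓ)
        (I_GK : GrassmannField.Grassmann d r k ℓ h →L[ℂ] ℂ),
        G'.op = G.op * Ring.inverse (1 - K.op * G.op) ∧
        (∀ F, I_GK F = I_G (F * (K.form k h).exp) / I_G (K.form k h).exp) ∧
        GrassmannField.IsGaussianIntegral G' I_GK := by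
  have hG₁ : ‖G₁‖ ≤ h := (le_max_left _ _).trans hh
  have hG₂ : ‖G₂‖ ≤ h := (le_max_right _ _).trans hh
  have hn : ∀ n, ‖detCk pairL2 G₁ G₂ n‖ ≤ h ^ (n + n) := fun n => by
    refine (norm_gramCk_le pairL2 G₁ G₂ norm_gramDet_pairL2_le n).trans ?_
    have h0 : 0 < h := Fact.out
    rw [pow_add]
    gcongr
  have hD := fun n x => eval_detCk (fun x y => hfac.eq_pairL2 x y) n x
  -- The norm condition enters only here.
  have hU : IsUnit (1 - K.op * G.op) := isUnit_one_sub_of_norm_lt_one hKG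
  refine ⟨⟨gaussianFunctional hn, ⟨_, hD, hasGaussianKernels_gaussianFunctional hn⟩,
    fun I hI => ?_⟩, fun I hI => ?_⟩
  · ext F
    exact (hI.hasGaussianKernels hD F).unique (hasGaussianKernels_gaussianFunctional hn F)
  have hI' := hI.hasGaussianKernels hD
  have hM := represents_fredholm K G₁ G₂
  have hB := resolvent_sub hfac (Ring.mul_inverse_cancel _ hU)
  have hZ : I (K.form k h).exp ≠ 0 := by
    rw [hI'.apply_exp norm_gramDet_pairL2_le K]
    exact FredholmData.series_ne_zero _ hM hB
  let J : Grassmann d r k ℓ h →L[ℂ] ℂ :=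
    (I (K.form k h).exp)⁻¹ • I.comp (Grassmann.mulL.flip (K.form k h).exp)
  have hJ : ∀ F, J F = I (F * (K.form k h).exp) / I (K.form k h).exp := fun F =>
    (mul_comm _ _).trans (div_eq_mul_inv _ _).symm
  -- The values of `resolventKernel` are by definition the pairings of G₁(x) with the resolvent
  -- applied to G₂(y), so its determinants are those produced by `mul_exp`.
  exact ⟨hU, summable_exp_single (K.formKern k), hZ, resolventKernel K hfac _, J,
    op_resolventKernel hfac (Ring.inverse_mul_cancel _ hU), hJ, _,
    eval_detCk fun x y => rfl, hI'.mul_exp norm_gramDet_pairL2_le K hM hB hJ hZ⟩
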